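/- Let $K\ge 2$ users, each with a cache, and $N\ge K$ independent files $F_1,\dots,F_N$ of $B$ i.i.d. uniform bits be given. In a D2D private caching scheme with a trusted server, user $k$ stores $Z_k=(\mathscr M(C_k),C_k)$, where the metadata $\mathscr M(C_1),\dots,\mathscr M(C_K)$ are (jointly random, finitely valued and) independent of the files and of the demands, and $C_k$ is a function of $\mathscr M(C_k)$ and of the library. The placement is uncoded: $C_k$ consists of bits copied from the files, the positions being determined by $\mathscr M(C_k)$. The demand vector $\mathbf D=(D_1,\dots,D_K)\in[N]^K$ is random, independent of the library, with a fixed law that gives positive probability to every vector of $[N]^K$. A trusted server that does not know the library sends metadata $\mathscr M(P_k)$ to user $k$, chosen (possibly at random) according to $\mathbf D$ and the cache metadata, and user $k$ broadcasts $X_k=(\mathscr M(P_k),P_k)$, a function of $\mathscr M(P_k)$ and $Z_k$. Put $\mathbf X=(X_1,\dots,X_K)$. For $M\in[N/K,N]$, a load $R$ is achievable (under uncoded cache placement and user collusion) if there are $\epsilon_B\ge 0$ with $\epsilon_B\to0$ as $B\to\infty$ and, for all sufficiently large $B$, such schemes with (entropies in bits) $$H(Z_k)\le B(M+\epsilon_B),\qquad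 H(F_{D_k}\mid \mathbf X,Z_k,D_k)\le B\epsilon_B\quad(k\in[K]),\qquad \sum_{k=1}^K H(X_k)\le B(R+\epsilon_B),$$ $$I\big(\mathbf D;\mathbf X,\{Z_k\}_{k\in S}\mid\{D_k\}_{k\in S}\big)=0\quad\text{for every nonempty } S\subseteq[K].$$ Let $R^\star_{\mathrm{u,c}}(M)$ be the infimum of the achievable loads. Let $U=(K-1)N$ and let $R_A(M)$, the load of Scheme A, be the value at $M$ of the lower convex envelope of the points $$\left(\frac{N+t-1}{K},\ \frac{\binom{U}{t}-\binom{U-N}{t}}{\binom{U}{t-1}}\right),\qquad t=1,\dots,U+1 .$$ Then, for every $M\in[N/K,N]$, the load $R_A(M)$ is achievable and is order optimal within a factor of $18$ under uncoded cache placement and user collusion: $$R_A(M)\le 18\,R^\star_{\mathrm{u,c}}(M).$$ -/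

import Mathlib

open Filter Topology

noncomputable section

namespace D2DCaching

/-! ### Shannon entropies (in bits) of random variables on a finite probability space -/

section Entropy

variable {Ω : Type*} [Fintype Ω] {α β γ : Type*}

/-- `H(X)`, in bits, of the random variable `X` when the outcome has law `P`. -/
def entropy (P : PMF Ω) (X : Ω → α) : ℝ :=
  open Classical in
  ∑ x ∈ Finset.univ.image X, Real.negMulLog ((P.map X) x).toReal / Real.log 2

/-- `H(X | Y) = H(X, Y) - H(Y)`. -/
def condEntropy (P : PMF Ω) (X : Ω → α) (Y : Ω → β) : ℝ :=
  entropy P (fun ω => (X ω, Y ω)) - entropy P Y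

/-- `I(X ; Y | Z) = H(X | Z) - H(X | Y, Z)`. -/
def condMutualInfo (P : PMF Ω) (X : Ω → α) (Y : Ω → β) (Z : Ω → γ) : ℝ :=
  condEntropy P X Z - condEntropy P X (fun ω => (Y ω, Z ω))

end Entropy

/-! ### The system with `K` users and `N` files of `B` bits -/

/-- A realization of the library: bit `b` of file `i` is `F i b`. -/
abbrev Library (N B : ℕ) : Type := Fin N → Fin B → Bool

/-- A vector of demands: user `k` wants the file `d k`. -/
abbrev Demand (K N : ℕ) : Type := Fin K → Fin N

/-- A two-phase scheme. The metadata of the caches is drawn without knowledge of the demands and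
of the library; the cached content of a user is a function of its metadata and of the library.
The trusted server, which knows the demands and the metadata of the caches but not the library,
draws (possibly at random) the metadata of the transmissions; the payload of user `k` is a function
of the metadata sent to user `k` and of its own cache (metadata and content) only. -/
structure Scheme (K N B : ℕ) where
  /-- the alphabet of the metadata of the cache of each user -/
  CacheMeta : Fin K → Type
  cacheMetaFintype : ∀ k, Fintype (CacheMeta k)
  /-- the alphabet of the metadata of the transmission of each user -/
  SendMeta : Fin K → Type
  sendMetaFintype : ∀ k, Fintype (SendMeta k)
  /-- the joint law of the metadata of the `K` caches -/
  placement : PMF (∀ k, CacheMeta k)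
  /-- the content stored by user `k` -/
  content : ∀ k, CacheMeta k → Library N B → List Bool
  /-- the law of the metadata sent by the trusted server -/
  query : Demand K N → (∀ k, CacheMeta k) → PMF (∀ k, SendMeta k)
  /-- the payload broadcast by user `k` -/
  payload : ∀ k, SendMeta k → CacheMeta k × List Bool → List Bool

namespace Scheme

variable {K N B : ℕ} (s : Scheme K N B)

instance (k : Fin K) : Fintype (s.CacheMeta k) := s.cacheMetaFintype k

instance (k : Fin K) : Fintype (s.SendMeta k) := s.sendMetaFintype k

/-- An outcome: library, metadata of the caches, demands, metadata of the transmissions. -/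
abbrev Outcome : Type :=
  Library N B × (∀ k, s.CacheMeta k) × Demand K N × (∀ k, s.SendMeta k)

/-- The law of the outcome when the demands have law `demandLaw`: the bits of the library are
i.i.d. uniform; library, cache metadata and demands are independent. -/
def law (demandLaw : PMF (Demand K N)) : PMF s.Outcome :=
  (PMF.uniformOfFintype (Library N B)).bind fun F =>
    s.placement.bind fun c =>
      demandLaw.bind fun d =>
        (s.query d c).map fun p => (F, c, d, p)

/-- The demand vector `D`. -/
def demands (ω : s.Outcome) : Demand K N := ω.2.2.1

/-- The file `F_{D_k}` wanted by user `k`. -/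
def wanted (k : Fin K) (ω : s.Outcome) : Fin B → Bool := ω.1 (s.demands ω k)

/-- The cache `Z_k` of user `k`: metadata and content. -/
def cache (k : Fin K) (ω : s.Outcome) : s.CacheMeta k × List Bool :=
  (ω.2.1 k, s.content k (ω.2.1 k) ω.1)

/-- The signal `X_k` broadcast by user `k`: metadata and payload. -/
def signal (k : Fin K) (ω : s.Outcome) : s.SendMeta k × List Bool :=
  (ω.2.2.2 k, s.payload k (ω.2.2.2 k) (s.cache k ω))

/-- The vector `X` of all signals. -/
def signals (ω : s.Outcome) : ∀ k, s.SendMeta k × List Bool := fun k => s.signal k ω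

/-- The caches of the users in `S`. -/
def cachesOf (S : Finset (Fin K)) (ω : s.Outcome) :
    ∀ k : S, s.CacheMeta k × List Bool := fun k => s.cache k ω

/-- The demands of the users in `S`. -/
def demandsOf (S : Finset (Fin K)) (ω : s.Outcome) : S → Fin N := fun k => s.demands ω k

/-- Uncoded cache placement: every user directly copies some bits of the library. -/
def IsUncoded : Prop :=
  ∀ k (c : s.CacheMeta k), ∃ pos : List (Fin N × Fin B),
    ∀ F : Library N B, s.content k c F = pos.map fun b => F b.1 b.2

/-- Cache size constraint. -/
def CacheSize (demandLaw : PMF (Demand K N)) (M ε : ℝ) : Prop :=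
  ∀ k, entropy (s.law demandLaw) (s.cache k) ≤ B * (M + ε)

/-- Decoding constraint. -/
def Decodable (demandLaw : PMF (Demand K N)) (ε : ℝ) : Prop :=
  ∀ k, condEntropy (s.law demandLaw) (s.wanted k)
    (fun ω => (s.signals ω, s.cache k ω, s.demands ω k)) ≤ B * ε

/-- Privacy of the demands against every non-empty set of colluding users. -/
def PrivateUnderCollusion (demandLaw : PMF (Demand K N)) : Prop :=
  ∀ S : Finset (Fin K), S.Nonempty →
    condMutualInfo (s.law demandLaw) s.demands
      (fun ω => (s.signals ω, s.cachesOf S ω)) (s.demandsOf S) = 0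

/-- Load constraint. -/
def LoadAtMost (demandLaw : PMF (Demand K N)) (R ε : ℝ) : Prop :=
  ∑ k, entropy (s.law demandLaw) (s.signal k) ≤ B * (R + ε)

end Scheme

/-- The load `R` is achievable with cache size `M` under uncoded cache placement and user
collusion. -/
def Achievable (K N : ℕ) (demandLaw : PMF (Demand K N)) (M R : ℝ) : Prop :=
  ∃ ε : ℕ → ℝ, (∀ B, 0 ≤ ε B) ∧ Tendsto ε atTop (𝓝 0) ∧
    ∀ᶠ B : ℕ in atTop, ∃ s : Scheme K N B,
      s.IsUncoded ∧ s.CacheSize demandLaw M (ε B) ∧ s.Decodable demandLaw (ε B) ∧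
      s.PrivateUnderCollusion demandLaw ∧ s.LoadAtMost demandLaw R (ε B)

/-- The optimal load under uncoded cache placement and user collusion. -/
def optimalLoad (K N : ℕ) (demandLaw : PMF (Demand K N)) (M : ℝ) : ℝ :=
  sInf {R : ℝ | Achievable K N demandLaw M R}

/-- The memory-load points of Scheme A, with `U = (K - 1) N` effective users. -/
def schemeAPoints (K N : ℕ) : Set (ℝ × ℝ) :=
  {q | ∃ t : ℕ, 1 ≤ t ∧ t ≤ (K - 1) * N + 1 ∧
    q = (((N : ℝ) + t - 1) / K,
      ((((K - 1) * N).choose t : ℝ) - (((K - 1) * N - N).choose t : ℝ)) /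
        (((K - 1) * N).choose (t - 1) : ℝ))}

/-- The load of Scheme A (with memory sharing): the lower convex envelope of its points. -/
def schemeALoad (K N : ℕ) (M : ℝ) : ℝ :=
  sInf {R : ℝ | (M, R) ∈ convexHull ℝ (schemeAPoints K N)}

end D2DCaching

end

/-! ### Shannon entropy on a finite probability space -/

/-! Achievability. Every user `j` draws a secret uniform slot `c j` among the `N` files and the
server publishes only the differences `d j - c j`. For a fixed transmitter, the pairs (other user,
slot) are `U = (K - 1) N` effective users; the pair `(j, n)` asks for the file `(d j - c j) + n`, so
the real user `j` sits at `n = c j` and obtains its own file. The effective users are served by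
coded multicasting. Those of one fixed user ask for each file exactly once and serve as leaders: the
messages for sets without a leader follow from the others (`sum_removeUser_eq_zero`), which gives
the difference of binomials in the load. Translating the slots by `d' - d` turns the demand `d` into
`d'` without changing what is published, nor the caches of users on which `d` and `d'` agree; this
is privacy (`schemeA_private`). Memory sharing gives the convex envelope (`achievable_of_weights`).

Converse. For uncoded caches everything reduces to counting positions (`sum_card_sdiff_le_entropy`):
a signal carries each position that is decoded from it and that was not among the side information
used so far. Letting `m` users decode distinct files in turn gives `R ≥ m - m (m + 1) M / (2 N)`.
Privacy gives a second bound, which is strong near `M = N / K`. What user `k` sees has the same law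
for all demands of the others, so its signal must serve `J` rounds at once, in which the other `L =
K - 1` users decode `J L ≤ N` distinct files. Only bits in the cache of `k` that the others lack can
come from `k`; summing over `k` and averaging over files gives `R ≥ L J (1 - J x / N)` with `x = K M
- N`.

Comparison. The load of Scheme A is at most `N` and at most `(L N - x) / x`. For `x ≤ N / 2` the
privacy bound gives factors `4` and `8`; for larger `x` the other bound gives `18` when `N ≤ 6 M`
and `36 / 5` otherwise (`Achievable.schemeALoad_le_mul`). -/

namespace D2DCaching

open Finset

section EntropyTheory

/-- The probability of an outcome, as a real number. -/
noncomputable def weight {Ω : Type*} (P : PMF Ω) (ω : Ω) : ℝ := (P ω).toReal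

lemma weight_nonneg {Ω : Type*} (P : PMF Ω) (ω : Ω) : 0 ≤ weight P ω := ENNReal.toReal_nonneg

variable {Ω : Type*} [Fintype Ω] {α β γ δ : Type*}

/-- The probability that `X = x`, as a real number. -/
noncomputable def prob (P : PMF Ω) (X : Ω → α) (x : α) : ℝ :=
  open Classical in ∑ ω, if X ω = x then weight P ω else 0

lemma sum_weight (P : PMF Ω) : ∑ ω, weight P ω = 1 := by
  have h := P.tsum_coe
  rw [tsum_fintype] at h
  rw [← ENNReal.toReal_one, ← h, ENNReal.toReal_sum fun ω _ => P.apply_ne_top ω]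
  rfl

lemma toReal_map_apply (P : PMF Ω) (X : Ω → α) (x : α) : ((P.map X) x).toReal = prob P X x := by
  classical
  rw [PMF.map_apply, tsum_fintype, ENNReal.toReal_sum]
  · refine Finset.sum_congr rfl fun ω _ => ?_
    by_cases h : X ω = x
    · simp [h, weight]
    · simp [h, Ne.symm h]
  · intro ω _
    split_ifs
    · exact P.apply_ne_top ω
    · simp

lemma prob_nonneg (P : PMF Ω) (X : Ω → α) (x : α) : 0 ≤ prob P X x :=
  Finset.sum_nonneg fun ω _ => by split_ifs <;> simp [weight_nonneg]

lemma weight_le_prob (P : PMF Ω) (X : Ω → α) (ω : Ω) : weight P ω ≤ prob P X (X ω) := by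
  classical
  refine le_trans ?_ (Finset.single_le_sum (f := fun ω' => if X ω' = X ω then weight P ω' else 0)
    (fun ω' _ => by split_ifs <;> simp [weight_nonneg]) (Finset.mem_univ ω))
  simp

lemma prob_le_prob (P : PMF Ω) {X : Ω → α} {Y : Ω → β} {x : α} {y : β}
    (h : ∀ ω, weight P ω ≠ 0 → X ω = x → Y ω = y) : prob P X x ≤ prob P Y y := by
  classical
  refine Finset.sum_le_sum fun ω _ => ?_
  by_cases hw : weight P ω = 0
  · simp [hw]
  · by_cases hx : X ω = x
    · simp [hx, h ω hw hx]
    · rw [if_neg hx]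
      split_ifs <;> simp [weight_nonneg]

lemma sum_weight_mul (P : PMF Ω) (X : Ω → α) (s : Finset α) (h : ∀ ω, X ω ∈ s) (g : α → ℝ) :
    ∑ ω, weight P ω * g (X ω) = ∑ x ∈ s, prob P X x * g x := by
  classical
  simp_rw [prob, Finset.sum_mul]
  rw [Finset.sum_comm]
  refine Finset.sum_congr rfl fun ω _ => ?_
  simp [ite_mul, h ω]

lemma entropy_eq (P : PMF Ω) (X : Ω → α) :
    entropy P X = -(∑ ω, weight P ω * Real.log (prob P X (X ω))) / Real.log 2 := by
  classical
  rw [sum_weight_mul P X (Finset.univ.image X) (by simp) (fun x => Real.log (prob P X x)), entropy,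
    ← Finset.sum_neg_distrib, Finset.sum_div]
  refine Finset.sum_congr (by congr) fun x _ => ?_
  rw [toReal_map_apply, Real.negMulLog]
  ring

lemma log_two_pos : 0 < Real.log 2 := Real.log_pos one_lt_two

/-- A function of `Y` has at most the entropy of `Y`. -/
lemma entropy_le_of_determines (P : PMF Ω) {X : Ω → α} {Y : Ω → β}
    (h : ∀ ω ω', weight P ω ≠ 0 → weight P ω' ≠ 0 → Y ω = Y ω' → X ω = X ω') :
    entropy P X ≤ entropy P Y := by
  rw [entropy_eq, entropy_eq]
  refine div_le_div_of_nonneg_right ?_ log_two_pos.le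
  rw [neg_le_neg_iff]
  refine Finset.sum_le_sum fun ω _ => ?_
  by_cases hw : weight P ω = 0
  · simp [hw]
  · refine mul_le_mul_of_nonneg_left (Real.log_le_log ?_ ?_) (weight_nonneg P ω)
    · exact lt_of_lt_of_le (lt_of_le_of_ne (weight_nonneg P ω) (Ne.symm hw)) (weight_le_prob P Y ω)
    -- Up to null outcomes, the fibre of `Y` through `ω` lies in the fibre of `X`.
    · exact prob_le_prob P fun ω' hw' hy => h ω' ω hw' hw hy

lemma entropy_congr (P : PMF Ω) {X : Ω → α} {Y : Ω → β}
    (h : ∀ ω ω', X ω = X ω' ↔ Y ω = Y ω') : entropy P X = entropy P Y :=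
  le_antisymm (entropy_le_of_determines P fun ω ω' _ _ => (h ω ω').2)
    (entropy_le_of_determines P fun ω ω' _ _ => (h ω ω').1)

lemma sum_prob_left (P : PMF Ω) (X : Ω → α) (Z : Ω → γ) (s : Finset α) (h : ∀ ω, X ω ∈ s) (z : γ) :
    ∑ x ∈ s, prob P (fun ω => (X ω, Z ω)) (x, z) = prob P Z z := by
  classical
  simp_rw [prob]
  rw [Finset.sum_comm]
  refine Finset.sum_congr rfl fun ω _ => ?_
  by_cases hz : Z ω = z <;> simp [hz, h ω]

lemma sum_prob (P : PMF Ω) (X : Ω → α) (s : Finset α) (h : ∀ ω, X ω ∈ s) :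
    ∑ x ∈ s, prob P X x = 1 := by
  simpa [sum_weight] using (sum_weight_mul P X s h (fun _ => 1)).symm

/-- This is `log r ≤ r - 1` at `r = b / a`, strict unless `r = 1`. The correction `-a + b`
disappears on summation when the two totals agree. -/
lemma sub_le_mul_log_sub {a b : ℝ} (ha : 0 ≤ a) (hb : 0 ≤ b) (hab : a ≠ 0 → b ≠ 0) :
    0 ≤ a * (Real.log a - Real.log b) - a + b ∧
      (a * (Real.log a - Real.log b) - a + b = 0 → a = b) := by
  rcases eq_or_lt_of_le ha with rfl | ha
  · simp only [zero_mul, sub_self, zero_add]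
    exact ⟨hb, fun h => h.symm⟩
  · have hb : 0 < b := lt_of_le_of_ne hb (Ne.symm (hab ha.ne'))
    have hr : 0 < b / a := div_pos hb ha
    have hlog : Real.log a - Real.log b = -Real.log (b / a) := by
      rw [Real.log_div hb.ne' ha.ne']; ring
    have hba : a * (b / a) = b := by field_simp
    rw [hlog]
    constructor
    · have := mul_le_mul_of_nonneg_left (Real.log_le_sub_one_of_pos hr) ha.le
      rw [mul_sub, hba] at this
      linarith
    · intro h0
      by_contra hne
      have hne1 : b / a ≠ 1 := fun h1 => hne (by rw [div_eq_one_iff_eq ha.ne'] at h1; exact h1.symm)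
      have := mul_lt_mul_of_pos_left (Real.log_lt_sub_one_of_pos hr hne1) ha
      rw [mul_sub, hba] at this
      linarith

/-- Gibbs' inequality, with its case of equality. -/
lemma gibbs {ι : Type*} (s : Finset ι) (a b : ι → ℝ) (ha : ∀ i ∈ s, 0 ≤ a i)
    (hb : ∀ i ∈ s, 0 ≤ b i) (hab : ∀ i ∈ s, a i ≠ 0 → b i ≠ 0)
    (hsum : ∑ i ∈ s, b i = ∑ i ∈ s, a i) :
    0 ≤ ∑ i ∈ s, a i * (Real.log (a i) - Real.log (b i)) ∧
      (∑ i ∈ s, a i * (Real.log (a i) - Real.log (b i)) = 0 → ∀ i ∈ s, a i = b i) := by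
  have key : ∑ i ∈ s, a i * (Real.log (a i) - Real.log (b i)) =
      ∑ i ∈ s, (a i * (Real.log (a i) - Real.log (b i)) - a i + b i) := by
    rw [Finset.sum_add_distrib, Finset.sum_sub_distrib, hsum]
    ring
  have hterm := fun i hi => sub_le_mul_log_sub (ha i hi) (hb i hi) (hab i hi)
  rw [key]
  refine ⟨Finset.sum_nonneg fun i hi => (hterm i hi).1, fun h i hi => (hterm i hi).2 ?_⟩
  exact (Finset.sum_eq_zero_iff_of_nonneg fun i hi => (hterm i hi).1).1 h i hi

/-- Conditional mutual information is the relative entropy of the joint law from `P(x,z) P(y,z) /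
P(z)`: Gibbs' inequality gives the sign, its case of equality gives conditional independence. -/
lemma condMutualInfo_nonneg_and_eq (P : PMF Ω) (X : Ω → α) (Y : Ω → β) (Z : Ω → γ) :
    0 ≤ condMutualInfo P X Y Z ∧ (condMutualInfo P X Y Z = 0 → ∀ x y z,
      prob P (fun ω => (X ω, (Y ω, Z ω))) (x, (y, z)) * prob P Z z =
        prob P (fun ω => (X ω, Z ω)) (x, z) * prob P (fun ω => (Y ω, Z ω)) (y, z)) := by
  classical
  set s := (Finset.univ.image X) ×ˢ ((Finset.univ.image Y) ×ˢ (Finset.univ.image Z)) with hs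
  set a : α × β × γ → ℝ := fun q => prob P (fun ω => (X ω, (Y ω, Z ω))) q with hadef
  set b : α × β × γ → ℝ := fun q => prob P (fun ω => (X ω, Z ω)) (q.1, q.2.2) *
    prob P (fun ω => (Y ω, Z ω)) (q.2.1, q.2.2) / prob P Z q.2.2 with hbdef
  have hXZ : ∀ q : α × β × γ, a q ≤ prob P (fun ω => (X ω, Z ω)) (q.1, q.2.2) := fun q =>
    prob_le_prob P fun ω _ h => by rw [← h]
  have hYZ : ∀ q : α × β × γ, a q ≤ prob P (fun ω => (Y ω, Z ω)) (q.2.1, q.2.2) := fun q =>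
    prob_le_prob P fun ω _ h => by rw [← h]
  have hZ : ∀ q : α × β × γ, a q ≤ prob P Z q.2.2 := fun q =>
    prob_le_prob P fun ω _ h => by rw [← h]
  have ha : ∀ q, 0 ≤ a q := fun q => prob_nonneg _ _ _
  have hb : ∀ q, 0 ≤ b q := fun q =>
    div_nonneg (mul_nonneg (prob_nonneg _ _ _) (prob_nonneg _ _ _)) (prob_nonneg _ _ _)
  have hpos : ∀ q, a q ≠ 0 → 0 < a q := fun q h => lt_of_le_of_ne (ha q) (Ne.symm h)
  have hab : ∀ q, a q ≠ 0 → b q ≠ 0 := fun q h =>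
    (div_pos (mul_pos ((hpos q h).trans_le (hXZ q)) ((hpos q h).trans_le (hYZ q)))
      ((hpos q h).trans_le (hZ q))).ne'
  have hsa : ∑ q ∈ s, a q = 1 := sum_prob P _ s (by simp [hs])
  have hsb : ∑ q ∈ s, b q = 1 := by
    have : ∀ z, ∑ x ∈ Finset.univ.image X, ∑ y ∈ Finset.univ.image Y, b (x, (y, z)) =
        prob P Z z := by
      intro z
      simp only [hbdef]
      simp_rw [← Finset.sum_div, ← Finset.mul_sum]
      rw [← Finset.sum_mul, sum_prob_left P X Z _ (by simp), sum_prob_left P Y Z _ (by simp)]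
      by_cases h0 : prob P Z z = 0
      · simp [h0]
      · field_simp
    calc ∑ q ∈ s, b q
        = ∑ x ∈ Finset.univ.image X, ∑ z ∈ Finset.univ.image Z, ∑ y ∈ Finset.univ.image Y,
            b (x, (y, z)) := by
          rw [hs, Finset.sum_product]
          refine Finset.sum_congr rfl fun x _ => ?_
          rw [Finset.sum_product_right]
      _ = 1 := by
          rw [Finset.sum_comm]
          simp_rw [this]
          exact sum_prob P Z _ (by simp)
  have hg := gibbs s a b (fun q _ => ha q) (fun q _ => hb q) (fun q _ => hab q) (hsb.trans hsa.symm)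
  have hlog : ∀ q, a q * (Real.log (a q) - Real.log (b q)) =
      a q * (Real.log (a q) + Real.log (prob P Z q.2.2)
        - Real.log (prob P (fun ω => (X ω, Z ω)) (q.1, q.2.2))
        - Real.log (prob P (fun ω => (Y ω, Z ω)) (q.2.1, q.2.2))) := by
    intro q
    by_cases h : a q = 0
    · simp [h]
    · have h1 := ((hpos q h).trans_le (hXZ q)).ne'
      have h2 := ((hpos q h).trans_le (hYZ q)).ne'
      have h3 := ((hpos q h).trans_le (hZ q)).ne'
      have : Real.log (b q) = Real.log (prob P (fun ω => (X ω, Z ω)) (q.1, q.2.2))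
          + Real.log (prob P (fun ω => (Y ω, Z ω)) (q.2.1, q.2.2))
          - Real.log (prob P Z q.2.2) := by
        simp only [hbdef]
        rw [Real.log_div (mul_ne_zero h1 h2) h3, Real.log_mul h1 h2]
      rw [this]
      ring
  have hI : condMutualInfo P X Y Z =
      (∑ q ∈ s, a q * (Real.log (a q) - Real.log (b q))) / Real.log 2 := by
    simp_rw [hlog]
    rw [← sum_weight_mul P (fun ω => (X ω, (Y ω, Z ω))) s (by simp [hs])
      (fun q => Real.log (a q) + Real.log (prob P Z q.2.2)
        - Real.log (prob P (fun ω => (X ω, Z ω)) (q.1, q.2.2))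
        - Real.log (prob P (fun ω => (Y ω, Z ω)) (q.2.1, q.2.2)))]
    simp only [condMutualInfo, condEntropy, entropy_eq, mul_add, mul_sub, Finset.sum_add_distrib,
      Finset.sum_sub_distrib, hadef]
    ring
  rw [hI]
  refine ⟨div_nonneg hg.1 log_two_pos.le, fun h0 x y z => ?_⟩
  have h1 := hg.2 ((div_eq_zero_iff.1 h0).resolve_right log_two_pos.ne')
  have hz_le : ∀ q : α × β × γ,
      prob P (fun ω => (X ω, Z ω)) (q.1, q.2.2) ≤ prob P Z q.2.2 := fun q =>
    prob_le_prob P fun ω _ h => congrArg Prod.snd h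
  by_cases hz : prob P Z z = 0
  · have h2 : prob P (fun ω => (X ω, Z ω)) (x, z) = 0 :=
      le_antisymm (by simpa [hz] using hz_le (x, y, z)) (prob_nonneg _ _ _)
    simp [hz, h2]
  by_cases hmem : (x, (y, z)) ∈ s
  · have h2 : prob P (fun ω => (X ω, (Y ω, Z ω))) (x, (y, z)) = b (x, (y, z)) := h1 _ hmem
    rw [h2]
    simp only [hbdef]
    field_simp
  · simp only [hs, Finset.mem_product, Finset.mem_image, Finset.mem_univ, true_and, not_and_or,
      not_exists] at hmem
    rcases hmem with h | h | h
    · have e1 : prob P (fun ω => (X ω, (Y ω, Z ω))) (x, (y, z)) = 0 := by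
        simp [prob, h]
      have e2 : prob P (fun ω => (X ω, Z ω)) (x, z) = 0 := by simp [prob, h]
      simp [e1, e2]
    · have e1 : prob P (fun ω => (X ω, (Y ω, Z ω))) (x, (y, z)) = 0 := by
        simp [prob, h]
      have e2 : prob P (fun ω => (Y ω, Z ω)) (y, z) = 0 := by simp [prob, h]
      simp [e1, e2]
    · exact absurd (by simp [prob, h]) hz

lemma condMutualInfo_nonneg (P : PMF Ω) (X : Ω → α) (Y : Ω → β) (Z : Ω → γ) :
    0 ≤ condMutualInfo P X Y Z := (condMutualInfo_nonneg_and_eq P X Y Z).1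

/-- Vanishing conditional mutual information is conditional independence. -/
lemma prob_mul_prob_of_condMutualInfo_eq_zero (P : PMF Ω) {X : Ω → α} {Y : Ω → β} {Z : Ω → γ}
    (h : condMutualInfo P X Y Z = 0) (x : α) (y : β) (z : γ) :
    prob P (fun ω => (X ω, (Y ω, Z ω))) (x, (y, z)) * prob P Z z =
      prob P (fun ω => (X ω, Z ω)) (x, z) * prob P (fun ω => (Y ω, Z ω)) (y, z) :=
  (condMutualInfo_nonneg_and_eq P X Y Z).2 h x y z

lemma condEntropy_nonneg (P : PMF Ω) (X : Ω → α) (Y : Ω → β) : 0 ≤ condEntropy P X Y :=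
  sub_nonneg.2 (entropy_le_of_determines P fun _ _ _ _ h => congrArg Prod.snd h)

lemma condEntropy_prod_le (P : PMF Ω) (X : Ω → α) (Y : Ω → β) (Z : Ω → γ) :
    condEntropy P X (fun ω => (Y ω, Z ω)) ≤ condEntropy P X Z :=
  sub_nonneg.1 (condMutualInfo_nonneg P X Y Z)

lemma condEntropy_congr (P : PMF Ω) {X : Ω → α} {Y : Ω → β} {X' : Ω → γ} {Y' : Ω → δ}
    (hX : ∀ ω ω', X ω = X ω' ↔ X' ω = X' ω') (hY : ∀ ω ω', Y ω = Y ω' ↔ Y' ω = Y' ω') :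
    condEntropy P X Y = condEntropy P X' Y' := by
  unfold condEntropy
  rw [entropy_congr P hY, entropy_congr P (Y := fun ω => (X' ω, Y' ω))]
  intro ω ω'
  simp only [Prod.mk.injEq, hX ω ω', hY ω ω']

/-- Conditioning on more decreases the conditional entropy. -/
lemma condEntropy_anti (P : PMF Ω) (X : Ω → α) {Y : Ω → β} {Z : Ω → γ}
    (h : ∀ ω ω', Y ω = Y ω' → Z ω = Z ω') : condEntropy P X Y ≤ condEntropy P X Z := by
  refine le_trans (le_of_eq ?_) (condEntropy_prod_le P X Y Z)
  refine condEntropy_congr P (fun _ _ => Iff.rfl) fun ω ω' => ?_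
  simp only [Prod.mk.injEq]
  exact ⟨fun hy => ⟨hy, h _ _ hy⟩, fun hy => hy.1⟩

lemma condEntropy_le_zero_of_determines (P : PMF Ω) {X : Ω → α} {Y : Ω → β}
    (h : ∀ ω ω', weight P ω ≠ 0 → weight P ω' ≠ 0 → Y ω = Y ω' → X ω = X ω') :
    condEntropy P X Y ≤ 0 := by
  refine sub_nonpos.2 (entropy_le_of_determines P fun ω ω' hw hw' hy => ?_)
  simp only [Prod.mk.injEq]
  exact ⟨h ω ω' hw hw' hy, hy⟩

lemma entropy_const (P : PMF Ω) (c : γ) : entropy P (fun _ => c) = 0 := by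
  rw [entropy_eq]
  have : prob P (fun _ => c) c = 1 := by simp [prob, sum_weight]
  simp [this]

lemma condEntropy_le_entropy (P : PMF Ω) (X : Ω → α) (Y : Ω → β) :
    condEntropy P X Y ≤ entropy P X := by
  refine (condEntropy_anti P X (Z := fun _ => ()) fun _ _ _ => rfl).trans (le_of_eq ?_)
  unfold condEntropy
  rw [entropy_const, sub_zero]
  exact entropy_congr P fun ω ω' => by simp

lemma entropy_prod_le (P : PMF Ω) (X : Ω → α) (Y : Ω → β) :
    entropy P (fun ω => (X ω, Y ω)) ≤ entropy P X + entropy P Y := by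
  have := condEntropy_le_entropy P X Y
  unfold condEntropy at this
  linarith

/-- Entropy is at most the logarithm of the size of the alphabet. -/
lemma entropy_le_log_card [Fintype α] (P : PMF Ω) (X : Ω → α) :
    entropy P X ≤ Real.logb 2 (Fintype.card α) := by
  classical
  have hne : Nonempty α := by
    obtain ⟨ω, _⟩ := P.support_nonempty
    exact ⟨X ω⟩
  have hc : (0 : ℝ) < Fintype.card α := by exact_mod_cast Fintype.card_pos
  have hg := (gibbs Finset.univ (prob P X) (fun _ => (1 : ℝ) / Fintype.card α)
    (fun x _ => prob_nonneg _ _ _) (fun _ _ => by positivity) (fun _ _ _ => by positivity)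
    (by rw [sum_prob P X Finset.univ (by simp)]; simp [hc.ne'])).1
  rw [entropy_eq, Real.logb]
  refine div_le_div_of_nonneg_right ?_ log_two_pos.le
  rw [sum_weight_mul P X Finset.univ (by simp) (fun x => Real.log (prob P X x))]
  simp only [mul_sub, Finset.sum_sub_distrib] at hg
  rw [← Finset.sum_mul, sum_prob P X Finset.univ (by simp), one_div, Real.log_inv] at hg
  linarith

lemma entropy_le_log_card_of_determines [Fintype β] (P : PMF Ω) (X : Ω → α) (Y : Ω → β)
    (h : ∀ ω ω', Y ω = Y ω' → X ω = X ω') : entropy P X ≤ Real.logb 2 (Fintype.card β) :=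
  (entropy_le_of_determines P fun ω ω' _ _ => h ω ω').trans (entropy_le_log_card P Y)

lemma entropy_uniform [Nonempty Ω] :
    entropy (PMF.uniformOfFintype Ω) (fun ω => ω) = Real.logb 2 (Fintype.card Ω) := by
  classical
  have hw : ∀ ω : Ω, weight (PMF.uniformOfFintype Ω) ω = (Fintype.card Ω : ℝ)⁻¹ := by
    intro ω
    simp [weight]
  have hp : ∀ ω : Ω, prob (PMF.uniformOfFintype Ω) (fun ω => ω) ω = (Fintype.card Ω : ℝ)⁻¹ := by
    intro ω
    simp [prob, hw]
  rw [entropy_eq]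
  simp_rw [hp]
  rw [← Finset.sum_mul, sum_weight, Real.log_inv, Real.logb]
  ring

/-- Subadditivity of entropy for a finite family. -/
lemma entropy_pi_le {ι : Type*} [Fintype ι] {α : ι → Type*} (P : PMF Ω) (X : ∀ i, Ω → α i) :
    entropy P (fun ω i => X i ω) ≤ ∑ i, entropy P (X i) := by
  classical
  have key : ∀ s : Finset ι, entropy P (fun ω (i : s) => X i ω) ≤ ∑ i ∈ s, entropy P (X i) := by
    intro s
    induction s using Finset.induction_on with
    | empty =>
      simp only [Finset.sum_empty]
      refine (entropy_le_of_determines P (Y := fun _ => ()) fun ω ω' _ _ _ => ?_).trans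
        (entropy_const P ()).le
      funext i
      exact absurd i.2 (Finset.notMem_empty _)
    | insert a s ha ih =>
      rw [Finset.sum_insert ha]
      refine le_trans ?_ (add_le_add_right ih _)
      refine le_trans (entropy_le_of_determines P fun ω ω' _ _ h => ?_) (entropy_prod_le P _ _)
      simp only [Prod.mk.injEq] at h
      funext ⟨i, hi⟩
      rcases Finset.mem_insert.1 hi with rfl | hi
      · exact h.1
      · exact congrFun h.2 ⟨i, hi⟩
  refine le_trans (entropy_le_of_determines P fun ω ω' _ _ h => ?_) (key Finset.univ)
  funext i
  exact congrFun h ⟨i, Finset.mem_univ i⟩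

/-- Conditional independence makes the conditional mutual information vanish: the conditional law
of `W` given `D` depends on `f (D)` only. -/
lemma condMutualInfo_eq_zero_of_factor (P : PMF Ω) (X : Ω → α) (Y : Ω → β) (f : α → γ)
    (q : α → β → ℝ) (hq : ∀ x x', f x = f x' → q x = q x')
    (h : ∀ x y, prob P (fun ω => (X ω, Y ω)) (x, y) = prob P X x * q x y) :
    condMutualInfo P X Y (fun ω => f (X ω)) = 0 := by
  classical
  have h1 : ∀ ω, weight P ω ≠ 0 → prob P (fun ω => (Y ω, f (X ω))) (Y ω, f (X ω)) =
      prob P (fun ω => f (X ω)) (f (X ω)) * q (X ω) (Y ω) := by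
    intro ω _
    have e1 : ∀ (y : β) (z : γ), prob P (fun ω => (Y ω, f (X ω))) (y, z) =
        ∑ x ∈ Finset.univ.image X, if f x = z then prob P (fun ω => (X ω, Y ω)) (x, y) else 0 := by
      intro y z
      have e0 : ∀ x, (if f x = z then prob P (fun ω => (X ω, Y ω)) (x, y) else 0) =
          ∑ ω, if f x = z ∧ X ω = x ∧ Y ω = y then weight P ω else 0 := by
        intro x
        by_cases hx : f x = z <;> simp [hx, prob]
      simp_rw [e0]
      rw [prob, Finset.sum_comm]
      refine Finset.sum_congr rfl fun ω' _ => ?_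
      rw [Finset.sum_eq_single (X ω')]
      · by_cases hy : Y ω' = y <;> by_cases hz : f (X ω') = z <;> simp [hy, hz]
      · intro x _ hx
        simp [Ne.symm hx]
      · simp
    have e2 : ∀ z : γ, prob P (fun ω => f (X ω)) z =
        ∑ x ∈ Finset.univ.image X, if f x = z then prob P X x else 0 := by
      intro z
      have := sum_weight_mul P X (Finset.univ.image X) (by simp) (fun x => if f x = z then 1 else 0)
      simp only [mul_ite, mul_one, mul_zero] at this
      exact this
    rw [e1, e2, Finset.sum_mul]
    refine Finset.sum_congr rfl fun x _ => ?_
    by_cases hx : f x = f (X ω)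
    · simp only [hx, if_true, h, hq x (X ω) hx]
    · simp [hx]
  simp only [condMutualInfo, condEntropy]
  have hA : entropy P (fun ω => (X ω, f (X ω))) = entropy P X :=
    entropy_congr P fun ω ω' => by simp +contextual
  have hB : entropy P (fun ω => (X ω, Y ω, f (X ω))) = entropy P (fun ω => (X ω, Y ω)) :=
    entropy_congr P fun ω ω' => by
      simp only [Prod.mk.injEq]
      exact ⟨fun h => ⟨h.1, h.2.1⟩, fun h => ⟨h.1, h.2, by rw [h.1]⟩⟩
  rw [hA, hB]
  have : ∑ ω, weight P ω * Real.log (prob P (fun ω => (X ω, Y ω)) (X ω, Y ω)) +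
      ∑ ω, weight P ω * Real.log (prob P (fun ω => f (X ω)) (f (X ω))) =
      ∑ ω, weight P ω * Real.log (prob P X (X ω)) +
      ∑ ω, weight P ω * Real.log (prob P (fun ω => (Y ω, f (X ω))) (Y ω, f (X ω))) := by
    rw [← Finset.sum_add_distrib, ← Finset.sum_add_distrib]
    refine Finset.sum_congr rfl fun ω _ => ?_
    by_cases hw : weight P ω = 0
    · simp [hw]
    have hw' := lt_of_le_of_ne (weight_nonneg P ω) (Ne.symm hw)
    have p1 := (hw'.trans_le (weight_le_prob P X ω)).ne'
    have p2 := (hw'.trans_le (weight_le_prob P (fun ω => (X ω, Y ω)) ω)).ne'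
    have p3 := (hw'.trans_le (weight_le_prob P (fun ω => f (X ω)) ω)).ne'
    rw [h1 ω hw]
    rw [h] at p2 ⊢
    have p4 := right_ne_zero_of_mul p2
    rw [Real.log_mul p1 p4, Real.log_mul p3 p4]
    ring
  simp only [entropy_eq]
  field_simp
  linarith

end EntropyTheory

end D2DCaching

/-! ### Products of a uniform library and independent metadata -/

namespace D2DCaching

section ProductLaw

variable {Ω Λ : Type*} [Fintype Ω] [Fintype Λ] {α β γ : Type*}

lemma weight_bind_map (P : PMF Ω) (Q : Ω → PMF Λ) (a : Ω) (b : Λ) :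
    weight (P.bind fun a => (Q a).map fun b => (a, b)) (a, b) = weight P a * weight (Q a) b := by
  classical
  unfold weight
  rw [← ENNReal.toReal_mul, PMF.bind_apply, tsum_fintype]
  congr 1
  rw [Finset.sum_eq_single a]
  · rw [PMF.map_apply, tsum_fintype, Finset.sum_eq_single b] <;> simp +contextual [eq_comm]
  · intro a' _ h
    rw [PMF.map_apply, tsum_fintype]
    simp [Ne.symm h]
  · simp

lemma sum_weight_comp_eq {P Q : PMF Ω} (W : Ω → α) (h : ∀ w, prob P W w = prob Q W w)
    (g : α → ℝ) : ∑ ω, weight P ω * g (W ω) = ∑ ω, weight Q ω * g (W ω) := by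
  classical
  rw [sum_weight_mul P W (Finset.univ.image W) (by simp),
    sum_weight_mul Q W (Finset.univ.image W) (by simp)]
  simp_rw [h]

lemma prob_comp_eq {P Q : PMF Ω} (W : Ω → α) (h : ∀ w, prob P W w = prob Q W w)
    (g : α → β) (b : β) : prob P (fun ω => g (W ω)) b = prob Q (fun ω => g (W ω)) b := by
  classical
  simpa [prob] using sum_weight_comp_eq W h (fun w => if g w = b then 1 else 0)

lemma entropy_eq_of_prob_eq {P Q : PMF Ω} (W : Ω → α) (h : ∀ w, prob P W w = prob Q W w) :
    entropy P W = entropy Q W := by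
  rw [entropy_eq, entropy_eq]
  simp_rw [h]
  rw [sum_weight_comp_eq W h (fun w => Real.log (prob Q W w))]

/-- Chain rule: under a product law, fixing the second coordinate leaves the first one with law `u`.
With the metadata as second coordinate, entropies in a scheme become averages of entropies over the
uniform library. -/
lemma entropy_prod_snd {P : PMF (Ω × Λ)} {u : PMF Ω} {ν : PMF Λ}
    (hP : ∀ a m, weight P (a, m) = weight u a * weight ν m) (X : Ω × Λ → α) :
    entropy P (fun ω => (X ω, ω.2)) =
      ∑ m, weight ν m * entropy u (fun a => X (a, m)) + entropy ν (fun m => m) := by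
  classical
  have h1 : ∀ x m, prob P (fun ω => (X ω, ω.2)) (x, m) =
      weight ν m * prob u (fun a => X (a, m)) x := by
    intro x m
    rw [prob, Fintype.sum_prod_type_right, Finset.sum_eq_single m]
    · rw [prob, Finset.mul_sum]
      refine Finset.sum_congr rfl fun a _ => ?_
      by_cases hx : X (a, m) = x <;> simp [hx, hP, mul_comm]
    · intro m' _ hm
      simp [hm]
    · simp
  have h2 : ∀ m, prob ν (fun m => m) m = weight ν m := by
    intro m
    simp [prob]
  simp only [entropy_eq, h2]
  rw [Fintype.sum_prod_type_right]
  simp_rw [h1, hP]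
  rw [← Finset.sum_neg_distrib, Finset.sum_div, ← Finset.sum_neg_distrib, Finset.sum_div,
    ← Finset.sum_add_distrib]
  refine Finset.sum_congr rfl fun m _ => ?_
  have : ∑ a, weight u a * weight ν m *
      Real.log (weight ν m * prob u (fun a => X (a, m)) (X (a, m))) =
      weight ν m * ∑ a, weight u a * Real.log (prob u (fun a => X (a, m)) (X (a, m))) +
      weight ν m * Real.log (weight ν m) := by
    have e : weight ν m * Real.log (weight ν m) =
        ∑ a, weight u a * (weight ν m * Real.log (weight ν m)) := by
      rw [← Finset.sum_mul, sum_weight, one_mul]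
    rw [e, Finset.mul_sum, ← Finset.sum_add_distrib]
    refine Finset.sum_congr rfl fun a _ => ?_
    by_cases hm : weight ν m = 0
    · simp [hm]
    by_cases ha : weight u a = 0
    · simp [ha]
    have hp := ((lt_of_le_of_ne (weight_nonneg u a) (Ne.symm ha)).trans_le
      (weight_le_prob u (fun a => X (a, m)) a)).ne'
    rw [Real.log_mul hm hp]
    ring
  rw [this]
  ring

lemma condEntropy_prod_snd {P : PMF (Ω × Λ)} {u : PMF Ω} {ν : PMF Λ}
    (hP : ∀ a m, weight P (a, m) = weight u a * weight ν m) (X : Ω × Λ → α) (Y : Ω × Λ → β) :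
    condEntropy P X (fun ω => (Y ω, ω.2)) =
      ∑ m, weight ν m * condEntropy u (fun a => X (a, m)) (fun a => Y (a, m)) := by
  have h1 := entropy_prod_snd hP (fun ω => (X ω, Y ω))
  have h2 := entropy_prod_snd hP Y
  have h3 : entropy P (fun ω => (X ω, Y ω, ω.2)) = entropy P (fun ω => ((X ω, Y ω), ω.2)) :=
    entropy_congr P fun ω ω' => by simp [and_assoc]
  unfold condEntropy
  rw [h3, h1, h2]
  simp only [mul_sub, Finset.sum_sub_distrib]
  ring

/-- The left side is the entropy of `X` given the second coordinate. This removes the metadata from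
the memory and load constraints. -/
lemma sum_entropy_le {P : PMF (Ω × Λ)} {u : PMF Ω} {ν : PMF Λ}
    (hP : ∀ a m, weight P (a, m) = weight u a * weight ν m) (X : Ω × Λ → α) :
    ∑ m, weight ν m * entropy u (fun a => X (a, m)) ≤ entropy P X := by
  have h1 := entropy_prod_snd hP X
  have h2 : entropy P (fun ω => ω.2) = entropy ν (fun m => m) := by
    have h3 := entropy_prod_snd hP (fun _ => ())
    simp only [entropy_const, mul_zero, Finset.sum_const_zero, zero_add] at h3
    rw [← h3]
    exact entropy_congr P fun ω ω' => by simp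
  have h4 := entropy_prod_le P X (fun ω => ω.2)
  linarith

end ProductLaw

/-! ### The uniform library -/

section UniformLibrary

variable {N B : ℕ} {α β : Type*}

/-- The uniform law on libraries. -/
noncomputable abbrev unif (N B : ℕ) : PMF (Library N B) := PMF.uniformOfFintype (Library N B)

/-- The bits of the library at the positions in `A`. -/
def mask (A : Finset (Fin N × Fin B)) (F : Library N B) : Fin N × Fin B → Bool :=
  fun x => if x ∈ A then F x.1 x.2 else false

lemma mask_eq_mask_iff {A : Finset (Fin N × Fin B)} {F G : Library N B} :
    mask A F = mask A G ↔ ∀ x ∈ A, F x.1 x.2 = G x.1 x.2 := by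
  constructor
  · intro h x hx
    have := congrFun h x
    simpa [mask, hx] using this
  · intro h
    funext x
    by_cases hx : x ∈ A
    · simp [mask, hx, h x hx]
    · simp [mask, hx]

lemma mask_eq_of_subset {A A' : Finset (Fin N × Fin B)} (h : A ⊆ A') {F G : Library N B}
    (hm : mask A' F = mask A' G) : mask A F = mask A G :=
  mask_eq_mask_iff.2 fun x hx => mask_eq_mask_iff.1 hm x (h hx)

lemma mask_union_eq_iff {A A' : Finset (Fin N × Fin B)} {F G : Library N B} :
    mask (A ∪ A') F = mask (A ∪ A') G ↔ mask A F = mask A G ∧ mask A' F = mask A' G := by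
  simp only [mask_eq_mask_iff, Finset.mem_union]
  exact ⟨fun h => ⟨fun x hx => h x (Or.inl hx), fun x hx => h x (Or.inr hx)⟩,
    fun h x hx => hx.elim (h.1 x) (h.2 x)⟩

lemma entropy_mask_le (A : Finset (Fin N × Fin B)) : entropy (unif N B) (mask A) ≤ A.card := by
  refine (entropy_le_log_card_of_determines _ (mask A)
    (fun F (x : A) => F x.1.1 x.1.2) fun F G h => ?_).trans (le_of_eq ?_)
  · exact mask_eq_mask_iff.2 fun x hx => congrFun h ⟨x, hx⟩
  · simp [Real.logb_pow]

/-- The bits in `A` and those in its complement together carry `N * B` bits, so neither upper bound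
by cardinality can be strict. -/
lemma entropy_mask (A : Finset (Fin N × Fin B)) : entropy (unif N B) (mask A) = A.card := by
  refine le_antisymm (entropy_mask_le A) ?_
  have h1 : entropy (unif N B) (fun F => F) = N * B := by
    rw [entropy_uniform]
    simp [Real.logb_pow]
  have h2 : entropy (unif N B) (fun F => F) ≤
      entropy (unif N B) (fun F => (mask A F, mask Aᶜ F)) :=
    entropy_le_of_determines _ fun F G _ _ h => by
      simp only [Prod.mk.injEq] at h
      funext n b
      by_cases hx : (n, b) ∈ A
      · exact mask_eq_mask_iff.1 h.1 _ hx
      · exact mask_eq_mask_iff.1 h.2 _ (Finset.mem_compl.2 hx)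
  have h3 := entropy_prod_le (unif N B) (mask A) (mask Aᶜ)
  have h4 := entropy_mask_le Aᶜ
  have h5 : (A.card : ℝ) + (Aᶜ.card : ℝ) = N * B := by
    have := Finset.card_add_card_compl A
    simp only [Fintype.card_prod, Fintype.card_fin] at this
    exact_mod_cast this
  linarith

/-- The entropy that `Y` has beyond the bits in `E`. -/
noncomputable def excess (Y : Library N B → α) (E : Finset (Fin N × Fin B)) : ℝ :=
  entropy (unif N B) (fun F => (Y F, mask E F)) - E.card

lemma excess_nonneg (Y : Library N B → α) (E : Finset (Fin N × Fin B)) : 0 ≤ excess Y E := by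
  rw [excess, ← entropy_mask E, sub_nonneg]
  exact entropy_le_of_determines _ fun F G _ _ h => congrArg Prod.snd h

lemma excess_union_le (Y : Library N B → α) (E A : Finset (Fin N × Fin B)) :
    excess Y (E ∪ A) ≤ excess Y E := by
  have h1 : entropy (unif N B) (fun F => (Y F, mask (E ∪ A) F)) ≤
      entropy (unif N B) (fun F => ((Y F, mask E F), mask (A \ E) F)) :=
    entropy_le_of_determines _ fun F G _ _ h => by
      simp only [Prod.mk.injEq] at h ⊢
      refine ⟨h.1.1, ?_⟩
      rw [← Finset.union_sdiff_self_eq_union]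
      exact mask_union_eq_iff.2 ⟨h.1.2, h.2⟩
  have h2 := entropy_prod_le (unif N B) (fun F => (Y F, mask E F)) (mask (A \ E))
  rw [entropy_mask] at h2
  have h3 : ((E ∪ A).card : ℝ) = E.card + (A \ E).card := by
    rw [← Finset.union_sdiff_self_eq_union, Finset.card_union_of_disjoint Finset.disjoint_sdiff]
    push_cast
    rfl
  unfold excess
  linarith

/-- Once `E` is known, `Y` reveals `W \ E` up to `e`; what is then left of `Y` is its excess beyond
`E ∪ W`. -/
lemma card_sdiff_add_excess_le (Y : Library N B → α) {A E W : Finset (Fin N × Fin B)} (hAE : A ⊆ E)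
    {e : ℝ} (he : condEntropy (unif N B) (mask W) (fun F => (Y F, mask A F)) ≤ e) :
    ((W \ E).card : ℝ) - e + excess Y (E ∪ W) ≤ excess Y E := by
  have h1 : condEntropy (unif N B) (mask W) (fun F => (Y F, mask E F)) ≤ e :=
    (condEntropy_anti _ _ fun F G h => by
      simp only [Prod.mk.injEq] at h ⊢
      exact ⟨h.1, mask_eq_of_subset hAE h.2⟩).trans he
  have h2 : entropy (unif N B) (fun F => (mask W F, Y F, mask E F)) =
      entropy (unif N B) (fun F => (Y F, mask (E ∪ W) F)) :=
    entropy_congr _ fun F G => by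
      simp only [Prod.mk.injEq, mask_union_eq_iff]
      tauto
  have h3 : ((E ∪ W).card : ℝ) = E.card + (W \ E).card := by
    rw [← Finset.union_sdiff_self_eq_union, Finset.card_union_of_disjoint Finset.disjoint_sdiff]
    push_cast
    rfl
  unfold condEntropy at h1
  unfold excess
  linarith

/-- If the positions `W s` can be recovered, up to `e s`, from `Y` and the positions `A s`, then `Y`
carries all the positions in `W s` that were not known by step `s`. -/
lemma sum_card_sdiff_le_entropy (Y : Library N B → α) (A W : ℕ → Finset (Fin N × Fin B))
    (e : ℕ → ℝ) (n : ℕ)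
    (he : ∀ s < n, condEntropy (unif N B) (mask (W s)) (fun F => (Y F, mask (A s) F)) ≤ e s)
    (hW : ∀ s < n, ∀ s' < s, Disjoint (W s) (W s')) :
    ∑ s ∈ Finset.range n, (((W s \ (Finset.range (s + 1)).biUnion A).card : ℝ) - e s) ≤
      entropy (unif N B) Y := by
  have h0 : excess Y ∅ = entropy (unif N B) Y := by
    rw [excess, Finset.card_empty, Nat.cast_zero, sub_zero]
    exact entropy_congr _ fun F G => by simp [mask_eq_mask_iff]
  have key : ∀ m ≤ n, ∑ s ∈ Finset.range m, (((W s \ (Finset.range (s + 1)).biUnion A).card : ℝ)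
      - e s) + excess Y ((Finset.range m).biUnion A ∪ (Finset.range m).biUnion W) ≤
      entropy (unif N B) Y := by
    intro m
    induction m with
    | zero => intro _; simp [h0]
    | succ m ih =>
      intro hm
      have ih := ih (by omega)
      set E := (Finset.range m).biUnion A ∪ (Finset.range m).biUnion W with hE
      have h1 := excess_union_le Y E (A m)
      have h2 := card_sdiff_add_excess_le Y (A := A m) (E := E ∪ A m) (W := W m)
        Finset.subset_union_right (he m (by omega))
      have h3 : (Finset.range (m + 1)).biUnion A ∪ (Finset.range (m + 1)).biUnion W =
          E ∪ A m ∪ W m := by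
        rw [hE, Finset.range_add_one, Finset.biUnion_insert, Finset.biUnion_insert]
        ac_rfl
      -- The `W s` are pairwise disjoint, so the positions decoded earlier remove nothing from `W
      -- m`.
      have h4 : W m \ (Finset.range (m + 1)).biUnion A = W m \ (E ∪ A m) := by
        ext x
        simp only [hE, Finset.mem_sdiff, Finset.mem_biUnion, Finset.mem_range, Finset.mem_union,
          not_or, not_exists, not_and, and_congr_right_iff]
        intro hx
        constructor
        · intro h
          refine ⟨⟨fun s hs => h s (by omega), fun s hs hxs => ?_⟩, h m (by omega)⟩
          exact (Finset.disjoint_left.1 (hW m (by omega) s hs)) hx hxs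
        · rintro ⟨⟨h, _⟩, h'⟩ s hs
          rcases Nat.lt_succ_iff_lt_or_eq.1 hs with hs | rfl
          · exact h s hs
          · exact h'
      rw [Finset.sum_range_succ, h3, h4]
      linarith
  have := key n le_rfl
  have h5 := excess_nonneg Y ((Finset.range n).biUnion A ∪ (Finset.range n).biUnion W)
  linarith

end UniformLibrary

end D2DCaching

/-! ### The law of a scheme -/

namespace D2DCaching

namespace Scheme

variable {K N B : ℕ} (s : Scheme K N B)

/-- All that is random apart from the library: cache metadata, demands, delivery metadata. -/
abbrev Metadata : Type := (∀ k, s.CacheMeta k) × Demand K N × (∀ k, s.SendMeta k)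

/-- The law of the cache metadata, the demands and the delivery metadata. -/
noncomputable def metaLaw (dl : PMF (Demand K N)) : PMF s.Metadata :=
  s.placement.bind fun c => (dl.bind fun d => (s.query d c).map fun p => (d, p)).map fun m => (c, m)

lemma law_eq (dl : PMF (Demand K N)) :
    s.law dl = (unif N B).bind fun F => (s.metaLaw dl).map fun m => (F, m) := by
  simp only [law, metaLaw, PMF.map_bind, PMF.map_comp, Function.comp_def]

lemma weight_law (dl : PMF (Demand K N)) (F : Library N B) (m : s.Metadata) :
    weight (s.law dl) (F, m) = weight (unif N B) F * weight (s.metaLaw dl) m := by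
  rw [law_eq]
  exact weight_bind_map _ (fun _ => s.metaLaw dl) F m

lemma weight_metaLaw (dl : PMF (Demand K N)) (c : ∀ k, s.CacheMeta k) (d : Demand K N)
    (p : ∀ k, s.SendMeta k) : weight (s.metaLaw dl) (c, d, p) =
      weight s.placement c * (weight dl d * weight (s.query d c) p) := by
  rw [metaLaw, weight_bind_map _ _ c (d, p), weight_bind_map]

/-- The mean of `f` over the cache metadata and the delivery metadata when the demands are `d`. -/
noncomputable def expect (d : Demand K N) (f : (∀ k, s.CacheMeta k) → (∀ k, s.SendMeta k) → ℝ) :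
    ℝ :=
  ∑ c, ∑ p, weight s.placement c * weight (s.query d c) p * f c p

/-- The mean of `f` over the cache metadata. -/
noncomputable def placementMean (f : (∀ k, s.CacheMeta k) → ℝ) : ℝ :=
  ∑ c, weight s.placement c * f c

lemma sum_metaLaw (dl : PMF (Demand K N)) (f : s.Metadata → ℝ) :
    ∑ m, weight (s.metaLaw dl) m * f m =
      ∑ d, weight dl d * s.expect d (fun c p => f (c, d, p)) := by
  simp_rw [expect, Finset.mul_sum]
  rw [Fintype.sum_prod_type]
  conv_rhs => rw [Finset.sum_comm]
  refine Finset.sum_congr rfl fun c _ => ?_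
  rw [Fintype.sum_prod_type]
  refine Finset.sum_congr rfl fun d _ => Finset.sum_congr rfl fun p _ => ?_
  rw [weight_metaLaw]
  ring

lemma weight_pure {Ω : Type*} [DecidableEq Ω] (a b : Ω) :
    weight (PMF.pure a) b = if b = a then 1 else 0 := by
  by_cases h : b = a <;> simp [weight, h]

lemma sum_metaLaw_pure (d : Demand K N) (f : s.Metadata → ℝ) :
    ∑ m, weight (s.metaLaw (PMF.pure d)) m * f m = s.expect d (fun c p => f (c, d, p)) := by
  rw [sum_metaLaw]
  simp [weight_pure]

lemma expect_const_send (d : Demand K N) (f : (∀ k, s.CacheMeta k) → ℝ) :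
    s.expect d (fun c _ => f c) = s.placementMean f := by
  unfold expect placementMean
  refine Finset.sum_congr rfl fun c _ => ?_
  rw [← Finset.sum_mul, ← Finset.mul_sum, sum_weight, mul_one]

lemma expect_mono {d : Demand K N} {f g : (∀ k, s.CacheMeta k) → (∀ k, s.SendMeta k) → ℝ}
    (h : ∀ c p, f c p ≤ g c p) : s.expect d f ≤ s.expect d g :=
  Finset.sum_le_sum fun c _ => Finset.sum_le_sum fun p _ =>
    mul_le_mul_of_nonneg_left (h c p) (mul_nonneg (weight_nonneg _ _) (weight_nonneg _ _))

lemma expect_sub (d : Demand K N) (f g : (∀ k, s.CacheMeta k) → (∀ k, s.SendMeta k) → ℝ) :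
    s.expect d (fun c p => f c p - g c p) = s.expect d f - s.expect d g := by
  simp only [expect, mul_sub, Finset.sum_sub_distrib]

lemma expect_sum {ι : Type*} (t : Finset ι) (d : Demand K N)
    (f : ι → (∀ k, s.CacheMeta k) → (∀ k, s.SendMeta k) → ℝ) :
    s.expect d (fun c p => ∑ i ∈ t, f i c p) = ∑ i ∈ t, s.expect d (f i) := by
  simp only [expect, Finset.mul_sum]
  conv_rhs => rw [Finset.sum_comm]
  refine Finset.sum_congr rfl fun c _ => ?_
  rw [Finset.sum_comm]

lemma expect_nonneg {d : Demand K N} {f : (∀ k, s.CacheMeta k) → (∀ k, s.SendMeta k) → ℝ}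
    (h : ∀ c p, 0 ≤ f c p) : 0 ≤ s.expect d f :=
  Finset.sum_nonneg fun c _ => Finset.sum_nonneg fun p _ =>
    mul_nonneg (mul_nonneg (weight_nonneg _ _) (weight_nonneg _ _)) (h c p)

lemma placementMean_mono {f g : (∀ k, s.CacheMeta k) → ℝ} (h : ∀ c, f c ≤ g c) :
    s.placementMean f ≤ s.placementMean g :=
  Finset.sum_le_sum fun c _ => mul_le_mul_of_nonneg_left (h c) (weight_nonneg _ _)

lemma placementMean_sum {ι : Type*} (t : Finset ι) (f : ι → (∀ k, s.CacheMeta k) → ℝ) :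
    s.placementMean (fun c => ∑ i ∈ t, f i c) = ∑ i ∈ t, s.placementMean (f i) := by
  simp only [placementMean, Finset.mul_sum]
  rw [Finset.sum_comm]

lemma placementMean_sub (f g : (∀ k, s.CacheMeta k) → ℝ) :
    s.placementMean (fun c => f c - g c) = s.placementMean f - s.placementMean g := by
  simp only [placementMean, mul_sub, Finset.sum_sub_distrib]

lemma placementMean_mul (a : ℝ) (f : (∀ k, s.CacheMeta k) → ℝ) :
    s.placementMean (fun c => a * f c) = a * s.placementMean f := by
  simp only [placementMean, Finset.mul_sum]
  exact Finset.sum_congr rfl fun c _ => by ring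

lemma placementMean_const (a : ℝ) : s.placementMean (fun _ => a) = a := by
  rw [placementMean, ← Finset.sum_mul, sum_weight, one_mul]

/-- The payload of user `k` for given metadata. -/
def sent (k : Fin K) (p : s.SendMeta k) (c : s.CacheMeta k) (F : Library N B) : List Bool :=
  s.payload k p (c, s.content k c F)

/-- The entropy of the payload of user `k` for given metadata. -/
noncomputable def sentEntropy (k : Fin K) (p : s.SendMeta k) (c : s.CacheMeta k) : ℝ :=
  entropy (unif N B) (s.sent k p c)

/-- The uncertainty about the file wanted by user `k`, for given metadata. -/
noncomputable def decodeError (d : Demand K N) (k : Fin K) (c : ∀ k, s.CacheMeta k)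
    (p : ∀ k, s.SendMeta k) : ℝ :=
  condEntropy (unif N B) (fun F => F (d k))
    (fun F => (fun i => s.sent i (p i) (c i) F, s.content k (c k) F))

lemma decodeError_nonneg (d : Demand K N) (k : Fin K) (c : ∀ k, s.CacheMeta k)
    (p : ∀ k, s.SendMeta k) : 0 ≤ s.decodeError d k c p := condEntropy_nonneg _ _ _

lemma placementMean_content_le (dl : PMF (Demand K N)) (k : Fin K) :
    s.placementMean (fun c => entropy (unif N B) (s.content k (c k))) ≤
      entropy (s.law dl) (s.cache k) := by
  refine le_trans (le_of_eq ?_) (sum_entropy_le (s.weight_law dl) (s.cache k))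
  rw [s.sum_metaLaw dl (fun m => entropy (unif N B) fun F => s.cache k (F, m))]
  have : ∀ d : Demand K N, s.expect d (fun c p => entropy (unif N B) fun F =>
      s.cache k (F, (c, d, p))) =
      s.placementMean (fun c => entropy (unif N B) (s.content k (c k))) := by
    intro d
    rw [← s.expect_const_send d]
    congr 1
    funext c p
    exact entropy_congr _ fun F G => by simp [cache]
  simp_rw [this]
  rw [← Finset.sum_mul, sum_weight, one_mul]

/-- Handing all the metadata to the decoder only lowers its uncertainty, which then splits over
demands and metadata. -/
lemma sum_expect_decodeError_le (dl : PMF (Demand K N)) (k : Fin K) :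
    ∑ d, weight dl d * s.expect d (s.decodeError d k) ≤
      condEntropy (s.law dl) (s.wanted k)
        (fun ω => (s.signals ω, s.cache k ω, s.demands ω k)) := by
  refine le_trans (le_of_eq ?_) (condEntropy_anti (s.law dl) (s.wanted k)
    (Y := fun ω => ((s.signals ω, s.cache k ω, s.demands ω k), ω.2))
    (fun ω ω' h => congrArg Prod.fst h))
  rw [condEntropy_prod_snd (s.weight_law dl), s.sum_metaLaw dl]
  refine Finset.sum_congr rfl fun d _ => ?_
  congr 2
  funext c p
  refine condEntropy_congr _ (fun F G => Iff.rfl) fun F G => ?_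
  simp only [signals, signal, cache, demands, sent, Prod.mk.injEq, funext_iff]
  simp

lemma expect_sentEntropy_le (d : Demand K N) (k : Fin K) :
    s.expect d (fun c p => s.sentEntropy k (p k) (c k)) ≤
      entropy (s.law (PMF.pure d)) (s.signal k) := by
  refine le_trans (le_of_eq ?_) (sum_entropy_le (s.weight_law (PMF.pure d)) (s.signal k))
  rw [s.sum_metaLaw_pure d]
  congr 1
  funext c p
  exact entropy_congr _ fun F G => by simp [signal, sent, cache]

/-- Conditioning on the demand `d` amounts to running the scheme with the deterministic demand `d`;
the product form avoids dividing by the probability of `d`. -/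
lemma weight_law_eq (dl : PMF (Demand K N)) (ω : s.Outcome) (d : Demand K N) :
    (if s.demands ω = d then weight (s.law dl) ω else 0) =
      weight dl d * weight (s.law (PMF.pure d)) ω := by
  obtain ⟨F, c, d', p⟩ := ω
  rw [s.weight_law, s.weight_law, s.weight_metaLaw, s.weight_metaLaw, weight_pure]
  by_cases h : d' = d
  · simp only [demands, h, if_true]
    ring
  · simp [demands, h]

lemma prob_law_demands (dl : PMF (Demand K N)) {α : Type*} (W : s.Outcome → α) (d : Demand K N)
    (w : α) : prob (s.law dl) (fun ω => (s.demands ω, W ω)) (d, w) =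
      weight dl d * prob (s.law (PMF.pure d)) W w := by
  classical
  rw [prob, prob, Finset.mul_sum]
  refine Finset.sum_congr rfl fun ω _ => ?_
  have h := s.weight_law_eq dl ω d
  by_cases hd : s.demands ω = d
  · rw [if_pos hd] at h
    by_cases hw : W ω = w <;> simp [hd, hw, h]
  · rw [if_neg hd] at h
    by_cases hw : W ω = w <;> simp [hd, hw, ← h]

lemma prob_law_eq_sum (dl : PMF (Demand K N)) {α : Type*} (W : s.Outcome → α) (w : α) :
    prob (s.law dl) W w = ∑ d, weight dl d * prob (s.law (PMF.pure d)) W w := by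
  simp_rw [← s.prob_law_demands]
  rw [sum_prob_left _ _ _ _ (by simp)]

lemma prob_demands (dl : PMF (Demand K N)) (d : Demand K N) :
    prob (s.law dl) s.demands d = weight dl d := by
  classical
  have h1 := s.prob_law_demands dl (fun _ => ()) d ()
  have h2 : prob (s.law (PMF.pure d)) (fun _ => ()) () = 1 := by simp [prob, sum_weight]
  rw [h2, mul_one] at h1
  rw [← h1, prob, prob]
  refine Finset.sum_congr rfl fun ω _ => ?_
  congr 1
  simp

/-- Privacy: what the users in `S` see has the same law for all demands that agree on `S`. -/
lemma prob_eq_of_condMutualInfo_eq_zero {dl : PMF (Demand K N)} (hfull : ∀ d, dl d ≠ 0)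
    {α β : Type*} {W : s.Outcome → α} {f : Demand K N → β}
    (h : condMutualInfo (s.law dl) s.demands W (fun ω => f (s.demands ω)) = 0)
    {d d' : Demand K N} (hd : f d = f d') (w : α) :
    prob (s.law (PMF.pure d)) W w = prob (s.law (PMF.pure d')) W w := by
  classical
  have hpos : ∀ d, 0 < weight dl d := fun d => ENNReal.toReal_pos (hfull d) (dl.apply_ne_top d)
  have hD := s.prob_demands dl
  have key : ∀ d, prob (s.law (PMF.pure d)) W w * prob (s.law dl) (fun ω => f (s.demands ω)) (f d)
      = prob (s.law dl) (fun ω => (W ω, f (s.demands ω))) (w, f d) := by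
    intro d
    have h1 := prob_mul_prob_of_condMutualInfo_eq_zero _ h d w (f d)
    have h2 : prob (s.law dl) (fun ω => (s.demands ω, (W ω, f (s.demands ω)))) (d, (w, f d)) =
        weight dl d * prob (s.law (PMF.pure d)) W w := by
      rw [← s.prob_law_demands, prob, prob]
      refine Finset.sum_congr rfl fun ω _ => ?_
      congr 1
      simp only [Prod.mk.injEq, eq_iff_iff]
      exact ⟨fun h => ⟨h.1, h.2.1⟩, fun h => ⟨h.1, h.2, by rw [h.1]⟩⟩
    have h3 : prob (s.law dl) (fun ω => (s.demands ω, f (s.demands ω))) (d, f d) =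
        weight dl d := by
      rw [← hD, prob, prob]
      refine Finset.sum_congr rfl fun ω _ => ?_
      congr 1
      simp only [Prod.mk.injEq, eq_iff_iff]
      exact ⟨fun h => h.1, fun h => ⟨h, by rw [h]⟩⟩
    rw [h2, h3, mul_assoc] at h1
    exact mul_left_cancel₀ (hpos d).ne' h1
  have hz : ∀ d, prob (s.law dl) (fun ω => f (s.demands ω)) (f d) ≠ 0 := by
    intro d
    have : prob (s.law dl) s.demands d ≤ prob (s.law dl) (fun ω => f (s.demands ω)) (f d) :=
      prob_le_prob _ fun ω _ h => by rw [h]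
    rw [hD] at this
    exact ((hpos d).trans_le this).ne'
  have h1 := key d
  have h2 := key d'
  rw [hd] at h1
  rw [← h2] at h1
  exact mul_right_cancel₀ (hz d') h1

variable {s}

lemma prob_signals_cache_eq {dl : PMF (Demand K N)} (hfull : ∀ d, dl d ≠ 0)
    (hs : s.PrivateUnderCollusion dl) (k : Fin K) {d d' : Demand K N} (hd : d k = d' k)
    (w : (∀ k, s.SendMeta k × List Bool) × (s.CacheMeta k × List Bool)) :
    prob (s.law (PMF.pure d)) (fun ω => (s.signals ω, s.cache k ω)) w =
      prob (s.law (PMF.pure d')) (fun ω => (s.signals ω, s.cache k ω)) w := by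
  have h := hs {k} (Finset.singleton_nonempty k)
  have h1 := s.prob_eq_of_condMutualInfo_eq_zero hfull (f := fun d (i : ({k} : Finset (Fin K))) =>
    d i) h (d := d) (d' := d') (by
      funext ⟨i, hi⟩
      rw [Finset.mem_singleton] at hi
      subst hi
      exact hd)
  exact prob_comp_eq (fun ω => (s.signals ω, s.cachesOf {k} ω)) h1
    (fun x => (x.1, x.2 ⟨k, Finset.mem_singleton_self k⟩)) w

/-- The law of the metadata seen by user `k` depends on the demand of user `k` only. -/
lemma expect_eq_of_private {dl : PMF (Demand K N)} (hfull : ∀ d, dl d ≠ 0)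
    (hs : s.PrivateUnderCollusion dl) (k : Fin K) {d d' : Demand K N} (hd : d k = d' k)
    (g : s.CacheMeta k → (∀ k, s.SendMeta k) → ℝ) :
    s.expect d (fun c p => g (c k) p) = s.expect d' (fun c p => g (c k) p) := by
  have h := sum_weight_comp_eq _ (prob_signals_cache_eq hfull hs k hd)
    (fun x => g x.2.1 (fun i => (x.1 i).1))
  have key : ∀ d : Demand K N, ∑ ω, weight (s.law (PMF.pure d)) ω *
      g (s.cache k ω).1 (fun i => (s.signals ω i).1) = s.expect d (fun c p => g (c k) p) := by
    intro d
    rw [Fintype.sum_prod_type]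
    simp_rw [s.weight_law, mul_assoc]
    simp_rw [← Finset.mul_sum]
    have : ∀ F : Library N B, ∑ m, weight (s.metaLaw (PMF.pure d)) m *
        g (s.cache k (F, m)).1 (fun i => (s.signals (F, m) i).1) =
        s.expect d (fun c p => g (c k) p) := fun F =>
      s.sum_metaLaw_pure d (fun m => g (s.cache k (F, m)).1 (fun i => (s.signals (F, m) i).1))
    simp_rw [this]
    rw [← Finset.sum_mul, sum_weight, one_mul]
  rw [← key, ← key]
  exact h

/-- The law of every signal is the same for all demands. -/
lemma entropy_signal_eq {dl : PMF (Demand K N)} (hK : 2 ≤ K) (hfull : ∀ d, dl d ≠ 0)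
    (hs : s.PrivateUnderCollusion dl) (k : Fin K) (d : Demand K N) :
    entropy (s.law dl) (s.signal k) = entropy (s.law (PMF.pure d)) (s.signal k) := by
  have h1 : ∀ (i : Fin K) (d d' : Demand K N), d i = d' i → ∀ w,
      prob (s.law (PMF.pure d)) (s.signal k) w = prob (s.law (PMF.pure d')) (s.signal k) w :=
    fun i d d' hd w => prob_comp_eq (fun ω => (s.signals ω, s.cache i ω))
      (prob_signals_cache_eq hfull hs i hd) (fun x => x.1 k) w
  have h2 : ∀ (d d' : Demand K N) w,
      prob (s.law (PMF.pure d)) (s.signal k) w = prob (s.law (PMF.pure d')) (s.signal k) w := by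
    intro d d' w
    -- `d` and `d'` are joined through a vector that agrees with `d` at user `0` and with `d'` at
    -- user `1`; privacy is applied to each of these two users in turn.
    have hne : (⟨0, by omega⟩ : Fin K) ≠ ⟨1, by omega⟩ := by simp
    rw [h1 ⟨0, by omega⟩ d (Function.update d ⟨1, by omega⟩ (d' ⟨1, by omega⟩)) (by simp [hne]),
      h1 ⟨1, by omega⟩ _ d' (by simp)]
  refine entropy_eq_of_prob_eq (s.signal k) fun w => ?_
  rw [s.prob_law_eq_sum]
  simp_rw [h2 _ d]
  rw [← Finset.sum_mul, sum_weight, one_mul]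

end Scheme

end D2DCaching

/-! ### Converse bounds for a given scheme -/

namespace D2DCaching

lemma sum_range_add_one (m : ℕ) : ∑ t ∈ Finset.range m, ((t : ℝ) + 1) = m * (m + 1) / 2 := by
  induction m with
  | zero => simp
  | succ m ih => rw [Finset.sum_range_succ, ih]; push_cast; ring

section FileBits

variable {N B : ℕ}

/-- The positions of the bits of file `n`. -/
def fileBits (B : ℕ) (n : Fin N) : Finset (Fin N × Fin B) := Finset.univ.filter fun x => x.1 = n

lemma mem_fileBits {n : Fin N} {x : Fin N × Fin B} : x ∈ fileBits B n ↔ x.1 = n := by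
  simp [fileBits]

lemma card_fileBits (n : Fin N) : (fileBits B n).card = B := by
  have : fileBits B n = {n} ×ˢ Finset.univ := by
    ext x
    simp only [mem_fileBits, Finset.mem_product, Finset.mem_singleton, Finset.mem_univ, and_true]
  simp [this]

lemma mask_fileBits_eq_iff {n : Fin N} {F G : Library N B} :
    mask (fileBits B n) F = mask (fileBits B n) G ↔ F n = G n := by
  rw [mask_eq_mask_iff]
  constructor
  · intro h
    funext b
    exact h (n, b) (mem_fileBits.2 rfl)
  · rintro h ⟨m, b⟩ hx
    rw [mem_fileBits] at hx
    subst hx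
    exact congrFun h b

lemma disjoint_fileBits {n n' : Fin N} (h : n ≠ n') :
    Disjoint (fileBits B n) (fileBits B n') := by
  rw [Finset.disjoint_left]
  intro x hx hx'
  rw [mem_fileBits] at hx hx'
  exact h (hx.symm.trans hx')

lemma sum_card_fileBits_inter (A : Finset (Fin N × Fin B)) :
    ∑ n, ((fileBits B n ∩ A).card : ℝ) = A.card := by
  rw [Finset.card_eq_sum_card_fiberwise (s := A) (t := Finset.univ) (f := Prod.fst) (by simp)]
  push_cast
  refine Finset.sum_congr rfl fun n _ => ?_
  congr 2
  ext x
  simp [mem_fileBits, and_comm]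

lemma sum_card_fileBits_add_inter [NeZero N] (n : Fin N) (A : Finset (Fin N × Fin B)) :
    ∑ σ : Fin N, ((fileBits B (n + σ) ∩ A).card : ℝ) = A.card := by
  rw [← sum_card_fileBits_inter A]
  exact Fintype.sum_equiv (Equiv.addLeft n) _ _ fun σ => rfl

/-- Union bound inside `W ∩ Z`. The converse without privacy takes `Z` to be everything, the one
from privacy takes the cache of the transmitter. -/
lemma card_sub_sum_le_card_sdiff {ι α : Type*} [DecidableEq α] (W Z : Finset α) (t : Finset ι)
    (A : ι → Finset α) :
    ((W ∩ Z).card : ℝ) - ∑ i ∈ t, ((W ∩ (Z ∩ A i)).card : ℝ) ≤ ((W \ t.biUnion A).card : ℝ) := by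
  have h : W ∩ Z ⊆ (W \ t.biUnion A) ∪ t.biUnion fun i => W ∩ (Z ∩ A i) := by
    intro x hx
    rw [Finset.mem_inter] at hx
    by_cases hA : x ∈ t.biUnion A
    · obtain ⟨i, hi, hxi⟩ := Finset.mem_biUnion.1 hA
      exact Finset.mem_union_right _ (Finset.mem_biUnion.2 ⟨i, hi, by simp [hx.1, hx.2, hxi]⟩)
    · exact Finset.mem_union_left _ (Finset.mem_sdiff.2 ⟨hx.1, hA⟩)
  have h1 := (Finset.card_le_card h).trans (Finset.card_union_le _ _)
  have h2 : (t.biUnion fun i => W ∩ (Z ∩ A i)).card ≤ ∑ i ∈ t, (W ∩ (Z ∩ A i)).card :=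
    Finset.card_biUnion_le
  have h3 : (W ∩ Z).card ≤ (W \ t.biUnion A).card + ∑ i ∈ t, (W ∩ (Z ∩ A i)).card := by omega
  have h4 : ((W ∩ Z).card : ℝ) ≤ (W \ t.biUnion A).card + ∑ i ∈ t, ((W ∩ (Z ∩ A i)).card : ℝ) := by
    exact_mod_cast h3
  linarith

end FileBits

namespace Scheme

variable {K N B : ℕ} {s : Scheme K N B}

/-- `A k c` is the set of the positions stored by user `k` when its metadata is `c`. -/
def Stores (s : Scheme K N B) (A : ∀ k, s.CacheMeta k → Finset (Fin N × Fin B)) : Prop :=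
  ∀ k c F G, s.content k c F = s.content k c G ↔ mask (A k c) F = mask (A k c) G

lemma IsUncoded.exists_stores (h : s.IsUncoded) : ∃ A, s.Stores A := by
  choose pos hpos using h
  refine ⟨fun k c => (pos k c).toFinset, fun k c F G => ?_⟩
  rw [hpos, hpos, mask_eq_mask_iff, List.map_inj_left]
  simp

variable {A : ∀ k, s.CacheMeta k → Finset (Fin N × Fin B)}

lemma placementMean_card_le {dl : PMF (Demand K N)} {M ε : ℝ} (hA : s.Stores A)
    (hs : s.CacheSize dl M ε) (k : Fin K) :
    s.placementMean (fun c => ((A k (c k)).card : ℝ)) ≤ B * (M + ε) := by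
  refine le_trans (le_of_eq ?_) ((s.placementMean_content_le dl k).trans (hs k))
  congr 1
  funext c
  rw [← entropy_mask]
  exact (entropy_congr _ fun F G => hA k (c k) F G).symm

/-- Only the error averaged over the demands is controlled. Every demand vector has probability at
least `1 / κ`, so the error at a single one is at most `κ` times larger. -/
lemma expect_decodeError_le {dl : PMF (Demand K N)} {κ ε : ℝ} (hκ : ∀ d, 1 ≤ κ * weight dl d)
    (hs : s.Decodable dl ε) (d : Demand K N) (k : Fin K) :
    s.expect d (s.decodeError d k) ≤ κ * (B * ε) := by
  have h1 := (s.sum_expect_decodeError_le dl k).trans (hs k)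
  have hnn : ∀ d, 0 ≤ s.expect d (s.decodeError d k) := fun d =>
    s.expect_nonneg fun c p => s.decodeError_nonneg d k c p
  have h2 : weight dl d * s.expect d (s.decodeError d k) ≤ B * ε :=
    (Finset.single_le_sum (f := fun d => weight dl d * s.expect d (s.decodeError d k))
      (fun d _ => mul_nonneg (weight_nonneg _ _) (hnn d)) (Finset.mem_univ d)).trans h1
  have hκ0 : 0 ≤ κ := by
    by_contra h
    have := mul_nonpos_of_nonpos_of_nonneg (not_le.1 h).le (weight_nonneg dl d)
    linarith [hκ d]
  calc s.expect d (s.decodeError d k)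
      = 1 * s.expect d (s.decodeError d k) := (one_mul _).symm
    _ ≤ κ * weight dl d * s.expect d (s.decodeError d k) :=
        mul_le_mul_of_nonneg_right (hκ d) (hnn d)
    _ = κ * (weight dl d * s.expect d (s.decodeError d k)) := by ring
    _ ≤ κ * (B * ε) := mul_le_mul_of_nonneg_left h2 hκ0

lemma sent_eq_of_mask_eq (hA : s.Stores A) {k : Fin K} {p : s.SendMeta k} {c : s.CacheMeta k}
    {F G : Library N B} (h : mask (A k c) F = mask (A k c) G) : s.sent k p c F = s.sent k p c G := by
  unfold sent
  rw [(hA k c F G).2 h]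

/-- Bits that nobody stores cannot be decoded. -/
lemma card_fileBits_sdiff_le_decodeError (hA : s.Stores A) (d : Demand K N) (k : Fin K)
    (c : ∀ k, s.CacheMeta k) (p : ∀ k, s.SendMeta k) :
    ((fileBits B (d k) \ Finset.univ.biUnion fun i => A i (c i)).card : ℝ) ≤
      s.decodeError d k c p := by
  set E := Finset.univ.biUnion fun i => A i (c i) with hE
  have hsub : ∀ i, A i (c i) ⊆ E := fun i => by
    rw [hE]
    exact Finset.subset_biUnion_of_mem (fun i => A i (c i)) (Finset.mem_univ i)
  have h1 : condEntropy (unif N B) (fun F => F (d k)) (mask E) ≤ s.decodeError d k c p := by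
    refine condEntropy_anti _ _ fun F G h => ?_
    simp only [Prod.mk.injEq]
    refine ⟨?_, (hA k (c k) F G).2 (mask_eq_of_subset (hsub k) h)⟩
    funext i
    exact sent_eq_of_mask_eq hA (mask_eq_of_subset (hsub i) h)
  refine le_trans (le_of_eq ?_) h1
  have h2 : entropy (unif N B) (fun F => (F (d k), mask E F)) =
      entropy (unif N B) (mask (E ∪ fileBits B (d k))) :=
    entropy_congr _ fun F G => by
      rw [mask_union_eq_iff, mask_fileBits_eq_iff]
      simp only [Prod.mk.injEq]
      tauto
  rw [condEntropy, h2, entropy_mask, entropy_mask, ← Finset.union_sdiff_self_eq_union,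
    Finset.card_union_of_disjoint Finset.disjoint_sdiff]
  push_cast
  ring

/-- When everybody wants file `n`, its unstored bits remain undecoded; summing over `n` covers the
library. -/
lemma placementMean_card_compl_le {dl : PMF (Demand K N)} {κ ε : ℝ} (hA : s.Stores A)
    (hκ : ∀ d, 1 ≤ κ * weight dl d) (hs : s.Decodable dl ε) (k : Fin K) :
    s.placementMean (fun c => (((Finset.univ.biUnion fun i => A i (c i))ᶜ).card : ℝ)) ≤
      N * (κ * (B * ε)) := by
  have h : ∀ c : ∀ k, s.CacheMeta k, (((Finset.univ.biUnion fun i => A i (c i))ᶜ).card : ℝ) =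
      ∑ n, ((fileBits B n ∩ (Finset.univ.biUnion fun i => A i (c i))ᶜ).card : ℝ) :=
    fun c => (sum_card_fileBits_inter _).symm
  simp_rw [h]
  rw [placementMean_sum]
  refine (Finset.sum_le_sum (g := fun _ => κ * (B * ε)) fun n _ => ?_).trans
    (le_of_eq (by simp))
  refine le_trans ?_ (expect_decodeError_le hκ hs (fun _ => n) k)
  rw [← s.expect_const_send (fun _ => n)]
  refine s.expect_mono fun c p => ?_
  have := card_fileBits_sdiff_le_decodeError hA (fun _ => n) k c p
  rwa [Finset.sdiff_eq_inter_compl] at this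

/-- By privacy the law of each signal does not depend on the demands, so the demand vector may be
chosen separately for every transmitter. -/
lemma sum_expect_sentEntropy_le {dl : PMF (Demand K N)} {R ε : ℝ} (hK : 2 ≤ K)
    (hfull : ∀ d, dl d ≠ 0) (hs : s.PrivateUnderCollusion dl) (hR : s.LoadAtMost dl R ε)
    (D : Fin K → Demand K N) :
    ∑ k, s.expect (D k) (fun c p => s.sentEntropy k (p k) (c k)) ≤ B * (R + ε) := by
  refine (Finset.sum_le_sum fun k _ => ?_).trans hR
  rw [entropy_signal_eq hK hfull hs k (D k)]
  exact s.expect_sentEntropy_le (D k) k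

/-- The first `m` users decode distinct files one after the other. -/
lemma sum_card_le_sum_sentEntropy (hA : s.Stores A) {d : Demand K N} (hd : Function.Injective d)
    (c : ∀ k, s.CacheMeta k) (p : ∀ k, s.SendMeta k) {m : ℕ} (ι : ℕ → Fin K)
    (hι : ∀ i < m, ∀ j < m, ι i = ι j → i = j) :
    ∑ t ∈ Finset.range m, ((B : ℝ) - ∑ i ∈ Finset.range (t + 1),
        ((fileBits B (d (ι t)) ∩ A (ι i) (c (ι i))).card : ℝ) - s.decodeError d (ι t) c p) ≤
      ∑ k, s.sentEntropy k (p k) (c k) := by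
  have h1 := sum_card_sdiff_le_entropy (N := N) (B := B)
    (fun F => fun k => s.sent k (p k) (c k) F)
    (fun t => A (ι t) (c (ι t))) (fun t => fileBits B (d (ι t)))
    (fun t => s.decodeError d (ι t) c p) m (fun t ht => le_of_eq ?_) (fun t ht t' ht' => ?_)
  · refine le_trans (Finset.sum_le_sum fun t ht => ?_)
      (h1.trans (entropy_pi_le (unif N B) fun k => s.sent k (p k) (c k)))
    have h2 := card_sub_sum_le_card_sdiff (fileBits B (d (ι t))) Finset.univ
      (Finset.range (t + 1)) (fun t => A (ι t) (c (ι t)))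
    simp only [Finset.inter_univ, Finset.univ_inter, card_fileBits] at h2
    linarith
  · exact condEntropy_congr _ (fun F G => mask_fileBits_eq_iff) fun F G => by
      simp only [Prod.mk.injEq, hA (ι t) (c (ι t)) F G]
  · refine disjoint_fileBits fun h => ?_
    have := hι t ht t' (by omega) (hd h)
    omega

/-- The bound without privacy. -/
theorem shared_link_bound [NeZero N] {dl : PMF (Demand K N)} {M R κ ε : ℝ} (hK : 2 ≤ K)
    (hKN : K ≤ N) (hfull : ∀ d, dl d ≠ 0) (hκ : ∀ d, 1 ≤ κ * weight dl d) (hu : s.IsUncoded)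
    (hM : s.CacheSize dl M ε) (hD : s.Decodable dl ε) (hP : s.PrivateUnderCollusion dl)
    (hR : s.LoadAtMost dl R ε) {m : ℕ} (hm : m ≤ K) :
    (B : ℝ) * (N * m - (m * (m + 1) / 2) * (M + ε) - N * m * (κ * ε)) ≤ B * (N * (R + ε)) := by
  obtain ⟨A, hA⟩ := hu.exists_stores
  set ι : ℕ → Fin K := fun i => ⟨i % K, Nat.mod_lt _ (by omega)⟩ with hι
  -- As `σ` varies, the file wanted by each user runs over the whole library, so only the total size
  -- of each cache matters after summation.
  set d : Fin N → Demand K N := fun σ i => Fin.castLE hKN i + σ with hd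
  have h1 : ∀ σ, ∑ t ∈ Finset.range m, ((B : ℝ) - ∑ i ∈ Finset.range (t + 1), s.placementMean
      (fun c => ((fileBits B (d σ (ι t)) ∩ A (ι i) (c (ι i))).card : ℝ)) - κ * (B * ε)) ≤
      B * (R + ε) := by
    intro σ
    refine le_trans ?_ (sum_expect_sentEntropy_le hK hfull hP hR (fun _ => d σ))
    rw [← s.expect_sum Finset.univ]
    refine le_trans ?_ (s.expect_mono fun c p => sum_card_le_sum_sentEntropy hA (d := d σ) (m := m)
      (fun i j h => ?_) c p ι fun i hi j hj h => ?_)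
    · rw [s.expect_sum (Finset.range m) (d σ)]
      refine Finset.sum_le_sum fun t _ => ?_
      rw [s.expect_sub (d σ) (fun c _ => (B : ℝ) - ∑ i ∈ Finset.range (t + 1),
        ((fileBits B (d σ (ι t)) ∩ A (ι i) (c (ι i))).card : ℝ)), s.expect_const_send,
        s.placementMean_sub, s.placementMean_const, s.placementMean_sum]
      have := expect_decodeError_le hκ hD (d σ) (ι t)
      exact sub_le_sub_left this _
    · simpa [hd] using h
    · simp only [hι, Fin.mk.injEq] at h
      rwa [Nat.mod_eq_of_lt (by omega), Nat.mod_eq_of_lt (by omega)] at h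
  have h2 := Finset.sum_le_sum fun σ (_ : σ ∈ (Finset.univ : Finset (Fin N))) => h1 σ
  have h3 : ∑ σ : Fin N, ∑ t ∈ Finset.range m, ((B : ℝ) - ∑ i ∈ Finset.range (t + 1),
      s.placementMean (fun c => ((fileBits B (d σ (ι t)) ∩ A (ι i) (c (ι i))).card : ℝ))
        - κ * (B * ε)) =
      ∑ t ∈ Finset.range m, (N * (B : ℝ) - ∑ i ∈ Finset.range (t + 1),
      s.placementMean (fun c => ((A (ι i) (c (ι i))).card : ℝ)) - N * (κ * (B * ε))) := by
    rw [Finset.sum_comm]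
    refine Finset.sum_congr rfl fun t _ => ?_
    rw [Finset.sum_sub_distrib, Finset.sum_sub_distrib, Finset.sum_comm]
    simp only [Finset.sum_const, Finset.card_univ, Fintype.card_fin, nsmul_eq_mul]
    congr 2
    refine Finset.sum_congr rfl fun i _ => ?_
    rw [← s.placementMean_sum]
    congr 1
    funext c
    exact sum_card_fileBits_add_inter _ _
  have h4 : ∑ t ∈ Finset.range m, (N * (B : ℝ) - (t + 1) * (B * (M + ε)) - N * (κ * (B * ε))) ≤
      ∑ t ∈ Finset.range m, (N * (B : ℝ) - ∑ i ∈ Finset.range (t + 1),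
      s.placementMean (fun c => ((A (ι i) (c (ι i))).card : ℝ)) - N * (κ * (B * ε))) := by
    refine Finset.sum_le_sum fun t _ => ?_
    have : ∑ i ∈ Finset.range (t + 1), s.placementMean (fun c => ((A (ι i) (c (ι i))).card : ℝ)) ≤
        ∑ i ∈ Finset.range (t + 1), B * (M + ε) :=
      Finset.sum_le_sum fun i _ => placementMean_card_le hA hM (ι i)
    simp only [Finset.sum_const, Finset.card_range, nsmul_eq_mul] at this
    push_cast at this
    linarith
  have h6 : ∑ t ∈ Finset.range m, (N * (B : ℝ) - (t + 1) * (B * (M + ε)) - N * (κ * (B * ε))) =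
      m * (N * B) - m * (m + 1) / 2 * (B * (M + ε)) - m * (N * (κ * (B * ε))) := by
    rw [Finset.sum_sub_distrib, Finset.sum_sub_distrib, ← Finset.sum_mul _ (fun t : ℕ => (t : ℝ) + 1),
      sum_range_add_one]
    simp
  rw [h3] at h2
  rw [h6] at h4
  simp only [Finset.sum_const, Finset.card_univ, Fintype.card_fin, nsmul_eq_mul] at h2
  linarith

end Scheme

end D2DCaching

/-! ### The converse from privacy: one signal serving several rounds of demands. -/

namespace D2DCaching

lemma sum_range_mul_eq {M : Type*} [AddCommMonoid M] (J L : ℕ) (f : ℕ → M) :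
    ∑ t ∈ Finset.range (J * L), f t = ∑ j ∈ Finset.range J, ∑ r ∈ Finset.range L, f (j * L + r) := by
  induction J with
  | zero => simp
  | succ J ih => rw [Nat.succ_mul, Finset.sum_range_add, ih, Finset.sum_range_succ]

lemma sum_range_div_add_one (J L : ℕ) :
    ∑ t ∈ Finset.range (J * L), (((t / L : ℕ) : ℝ) + 1) = L * (J * (J + 1) / 2) := by
  rw [sum_range_mul_eq, ← sum_range_add_one, Finset.mul_sum]
  refine Finset.sum_congr rfl fun j _ => ?_
  rw [Finset.sum_congr rfl (g := fun _ => (j : ℝ) + 1) fun r hr => ?_]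
  · simp [mul_add]
  · have hr := Finset.mem_range.1 hr
    rw [mul_comm, Nat.mul_add_div (by omega), Nat.div_eq_of_lt hr, add_zero]

/-- A position stored `r` times gives credit `1` minus a multiple of `r - 1`, or of the indicator
of `r = 0`. -/
lemma le_sum_card_sub {ι α : Type*} [Fintype ι] [DecidableEq ι] [Fintype α] [DecidableEq α]
    (A : ι → Finset α) (O : ι → Finset α) (hO : ∀ i x, x ∈ O i ↔ ∃ j ≠ i, x ∈ A j) (q : ℝ)
    (hq : 1 ≤ q) :
    2 * q * Fintype.card α - (2 * q - 1) * ∑ i, ((A i).card : ℝ)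
        - 2 * q * (((Finset.univ.biUnion A)ᶜ).card : ℝ) ≤
      ∑ i, (((A i).card : ℝ) - q * ((A i ∩ O i).card : ℝ)) := by
  have hcard : ∀ s : Finset α, (s.card : ℝ) = ∑ x, if x ∈ s then 1 else 0 := by
    intro s
    simp
  have hc : (Fintype.card α : ℝ) = ∑ _x : α, 1 := by simp
  rw [hc]
  simp_rw [hcard]
  simp_rw [Finset.mul_sum]
  simp_rw [← Finset.sum_sub_distrib]
  conv_rhs => rw [Finset.sum_comm]
  conv_lhs => rw [Finset.sum_comm]
  rw [← Finset.sum_sub_distrib, ← Finset.sum_sub_distrib]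
  refine Finset.sum_le_sum fun x _ => ?_
  set T := Finset.univ.filter fun i => x ∈ A i with hT
  have h1 : ∑ i, (2 * q - 1) * (if x ∈ A i then (1 : ℝ) else 0) = (2 * q - 1) * T.card := by
    rw [← Finset.mul_sum]
    simp [hT]
  rw [h1]
  simp only [Finset.mem_compl, Finset.mem_biUnion, Finset.mem_univ, true_and, Finset.mem_inter]
  -- Stored `r ≥ 2` times: the credit is `(1 - q) r`, which exceeds the linear bound `2q - (2q - 1)
  -- r` by `q (r - 2)`.
  rcases Nat.lt_or_ge 1 T.card with h | h
  · have h2 : ∑ i, ((if x ∈ A i then (1 : ℝ) else 0) - q * if x ∈ A i ∧ x ∈ O i then 1 else 0) =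
        (1 - q) * T.card := by
      have : ∀ i, ((if x ∈ A i then (1 : ℝ) else 0) - q * if x ∈ A i ∧ x ∈ O i then 1 else 0) =
          (1 - q) * if x ∈ A i then 1 else 0 := by
        intro i
        by_cases hi : x ∈ A i
        · have : x ∈ O i := by
            obtain ⟨j, hj, hji⟩ := Finset.exists_mem_ne h i
            exact (hO i x).2 ⟨j, hji, by simpa [hT] using hj⟩
          simp [hi, this]
        · simp [hi]
      simp_rw [this]
      rw [← Finset.mul_sum]
      simp [hT]
    rw [h2]
    have h3 : (2 : ℝ) ≤ T.card := by exact_mod_cast h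
    split_ifs <;> nlinarith
  -- Stored once or never: equality holds, for `r = 0` thanks to the last term on the left.
  · have h2 : ∀ i, ((if x ∈ A i then (1 : ℝ) else 0) - q * if x ∈ A i ∧ x ∈ O i then 1 else 0) =
        if x ∈ A i then 1 else 0 := by
      intro i
      have : ¬ (x ∈ A i ∧ x ∈ O i) := by
        rintro ⟨hi, hx⟩
        obtain ⟨j, hji, hj⟩ := (hO i x).1 hx
        exact hji (Finset.card_le_one.1 h j (by simpa [hT] using hj) i (by simpa [hT] using hi))
      simp [this]
    simp_rw [h2]
    have h3 : ∑ i, (if x ∈ A i then (1 : ℝ) else 0) = T.card := by simp [hT]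
    rw [h3]
    by_cases h0 : ∃ i, x ∈ A i
    · have h4 : T.card = 1 := by
        obtain ⟨i, hi⟩ := h0
        have : 0 < T.card := Finset.card_pos.2 ⟨i, by simpa [hT] using hi⟩
        omega
      simp [h0, h4]
    · have h4 : T.card = 0 := by
        rw [Finset.card_eq_zero, hT, Finset.filter_eq_empty_iff]
        exact fun i _ hi => h0 ⟨i, hi⟩
      simp [h0, h4]

namespace Scheme

section Decoupling

variable {K N B : ℕ} {s : Scheme K N B}

/-- If a bound holds for all choices of caches that user `k` cannot tell apart, one for every round,
then it holds for the means, as the law of what user `k` knows is the same in all the rounds. -/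
lemma sum_expect_le_expect {dl : PMF (Demand K N)} (hfull : ∀ d, dl d ≠ 0)
    (hP : s.PrivateUnderCollusion dl) (k : Fin K) (J : ℕ) (D : ℕ → Demand K N) (d : Demand K N)
    (hD : ∀ j, D j k = d k) (f : ℕ → (∀ k, s.CacheMeta k) → (∀ k, s.SendMeta k) → ℝ)
    (h : s.CacheMeta k → (∀ k, s.SendMeta k) → ℝ)
    (H : ∀ p a (c : ℕ → ∀ k, s.CacheMeta k), (∀ j, c j k = a) →
      ∑ j ∈ Finset.range J, f j (c j) p ≤ h a p) :
    ∑ j ∈ Finset.range J, s.expect (D j) (f j) ≤ s.expect d (fun c p => h (c k) p) := by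
  classical
  obtain ⟨c₀, -⟩ := s.placement.support_nonempty
  -- No coupling of the rounds is built. Given the metadata that user `k` sees, each round is
  -- replaced by its most favourable choice of the other caches, which depends on those metadata
  -- only.
  have hmax : ∀ (j : ℕ) (a : s.CacheMeta k) (p : ∀ k, s.SendMeta k), ∃ c : ∀ k, s.CacheMeta k,
      c k = a ∧ ∀ c' : ∀ k, s.CacheMeta k, c' k = a → f j c' p ≤ f j c p := by
    intro j a p
    obtain ⟨c, hc, hmax⟩ := Finset.exists_max_image
      (Finset.univ.filter fun c : ∀ k, s.CacheMeta k => c k = a) (fun c => f j c p)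
      ⟨Function.update c₀ k a, by simp⟩
    exact ⟨c, by simpa using hc, fun c' hc' => hmax c' (by simpa using hc')⟩
  choose best hbest hle using hmax
  calc ∑ j ∈ Finset.range J, s.expect (D j) (f j)
      ≤ ∑ j ∈ Finset.range J, s.expect (D j) (fun c p => f j (best j (c k) p) p) :=
        Finset.sum_le_sum fun j _ => s.expect_mono fun c p => hle j (c k) p c rfl
    _ = ∑ j ∈ Finset.range J, s.expect d (fun c p => f j (best j (c k) p) p) :=
        Finset.sum_congr rfl fun j _ =>
          expect_eq_of_private hfull hP k (hD j) (fun a p => f j (best j a p) p)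
    _ = s.expect d (fun c p => ∑ j ∈ Finset.range J, f j (best j (c k) p) p) :=
        (s.expect_sum _ _ _).symm
    _ ≤ s.expect d (fun c p => h (c k) p) :=
        s.expect_mono fun c p => H p (c k) (fun j => best j (c k) p) fun j => hbest j (c k) p

end Decoupling

variable {L N B : ℕ} {s : Scheme (L + 1) N B}
  {A : ∀ k, s.CacheMeta k → Finset (Fin N × Fin B)}

/-- The positions stored by the users other than `k`. -/
def storedByOthers (A : ∀ k, s.CacheMeta k → Finset (Fin N × Fin B)) (k : Fin (L + 1))
    (c : ∀ k, s.CacheMeta k) : Finset (Fin N × Fin B) :=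
  Finset.univ.biUnion fun r : Fin L => A (k.succAbove r) (c (k.succAbove r))

lemma mem_storedByOthers {k : Fin (L + 1)} {c : ∀ k, s.CacheMeta k} {x : Fin N × Fin B} :
    x ∈ storedByOthers A k c ↔ ∃ j ≠ k, x ∈ A j (c j) := by
  simp only [storedByOthers, Finset.mem_biUnion, Finset.mem_univ, true_and]
  constructor
  · rintro ⟨r, hr⟩
    exact ⟨_, Fin.succAbove_ne k r, hr⟩
  · rintro ⟨j, hj, hx⟩
    obtain ⟨r, rfl⟩ := Fin.exists_succAbove_eq hj
    exact ⟨r, hx⟩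

/-- The bits that user `k` must send when the other users, in several rounds that user `k` cannot
tell apart, decode distinct files. -/
lemma sum_card_le_sentEntropy (hA : s.Stores A) (k : Fin (L + 1))
    (p : ∀ k, s.SendMeta k) (a : s.CacheMeta k) (c : ℕ → ∀ k, s.CacheMeta k)
    (hc : ∀ j, c j k = a) (D : ℕ → Demand (L + 1) N) (n : ℕ) (file : ℕ → Fin N)
    (hfile : ∀ t < n, ∀ t' < t, file t ≠ file t') (user : ℕ → Fin (L + 1))
    (huser : ∀ t, user t ≠ k) (hD : ∀ t < n, D (t / L) (user t) = file t) :
    ∑ t ∈ Finset.range n, (((fileBits B (file t) ∩ A k a).card : ℝ) -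
      ∑ j ∈ Finset.range (t / L + 1),
        ((fileBits B (file t) ∩ (A k a ∩ storedByOthers A k (c j))).card : ℝ) -
      s.decodeError (D (t / L)) (user t) (c (t / L)) p) ≤ s.sentEntropy k (p k) a := by
  have h1 := sum_card_sdiff_le_entropy (N := N) (B := B) (s.sent k (p k) a)
    (fun t => storedByOthers A k (c (t / L))) (fun t => fileBits B (file t))
    (fun t => s.decodeError (D (t / L)) (user t) (c (t / L)) p) n (fun t ht => ?_)
    (fun t ht t' ht' => disjoint_fileBits (hfile t ht t' ht'))
  · refine le_trans (Finset.sum_le_sum fun t _ => ?_) h1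
    refine sub_le_sub_right (le_trans (card_sub_sum_le_card_sdiff _ _ _ _) ?_) _
    rw [Nat.cast_le]
    refine Finset.card_le_card (Finset.sdiff_subset_sdiff le_rfl ?_)
    -- Step `t` belongs to round `t / L`, so the steps up to `t` involve only the rounds up to `t /
    -- L`.
    intro x hx
    obtain ⟨t', ht', hx⟩ := Finset.mem_biUnion.1 hx
    refine Finset.mem_biUnion.2 ⟨t' / L, ?_, hx⟩
    rw [Finset.mem_range] at ht' ⊢
    exact Nat.lt_succ_of_le (Nat.div_le_div_right (Nat.le_of_lt_succ ht'))
  -- The signals of the other users are functions of their own caches, so only the signal of `k`,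
  -- computed from `a` in every round, brings anything new.
  · have hstored : ∀ i, i ≠ k → ∀ F G : Library N B,
        mask (storedByOthers A k (c (t / L))) F = mask (storedByOthers A k (c (t / L))) G →
        mask (A i (c (t / L) i)) F = mask (A i (c (t / L) i)) G := fun i hi F G h =>
      mask_eq_of_subset (fun x hx => mem_storedByOthers.2 ⟨i, hi, hx⟩) h
    rw [decodeError, hD t ht]
    refine le_trans (le_of_eq (condEntropy_congr _ (fun F G => mask_fileBits_eq_iff)
      fun F G => Iff.rfl)) (condEntropy_anti _ _ fun F G h => ?_)
    simp only [Prod.mk.injEq] at h ⊢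
    refine ⟨?_, (hA _ _ F G).2 (hstored _ (huser t) F G h.2)⟩
    funext i
    by_cases hi : i = k
    · subst hi
      rw [hc]
      exact h.1
    · exact sent_eq_of_mask_eq hA (hstored i hi F G h.2)

/-- User `k` keeps the demand `σ` in all rounds; in round `j` the other `L` users ask for the files
numbered from `j * L` to `j * L + L - 1`, shifted by `σ`. Privacy makes a single signal of `k`
answer for all `J` rounds. -/
lemma placementMean_sum_le_expect [NeZero N] {dl : PMF (Demand (L + 1) N)} {κ ε : ℝ}
    (hfull : ∀ d, dl d ≠ 0) (hκ : ∀ d, 1 ≤ κ * weight dl d) (hA : s.Stores A)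
    (hDec : s.Decodable dl ε) (hP : s.PrivateUnderCollusion dl) (hL : 0 < L) {J : ℕ}
    (hJ : J * L ≤ N) (k : Fin (L + 1)) (σ : Fin N) :
    s.placementMean (fun c => ∑ t ∈ Finset.range (J * L),
        (((fileBits B (Fin.ofNat N t + σ) ∩ A k (c k)).card : ℝ) - (((t / L : ℕ) : ℝ) + 1) *
          ((fileBits B (Fin.ofNat N t + σ) ∩ (A k (c k) ∩ storedByOthers A k c)).card : ℝ)))
        - (J * L) * (κ * (B * ε)) ≤
      s.expect (fun _ => σ) (fun c p => s.sentEntropy k (p k) (c k)) := by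
  set n := J * L with hn
  set file : ℕ → Fin N := fun t => Fin.ofNat N t + σ with hfile
  set user : ℕ → Fin (L + 1) := fun t => k.succAbove ⟨t % L, Nat.mod_lt _ hL⟩ with huser
  set D : ℕ → Demand (L + 1) N := fun j =>
    k.insertNth (α := fun _ => Fin N) σ (fun r => file (j * L + r)) with hDdef
  have hDk : ∀ j, D j k = σ := fun j => by simp [hDdef]
  have hDu : ∀ t, D (t / L) (user t) = file t := fun t => by
    simp only [hDdef, huser, Fin.insertNth_apply_succAbove]
    rw [Nat.div_add_mod']
  have hfi : ∀ t < n, ∀ t' < t, file t ≠ file t' := by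
    intro t ht t' ht' h
    have h1 := congrArg Fin.val (add_right_cancel h)
    simp only [Fin.ofNat, Nat.mod_eq_of_lt (show t < N by omega),
      Nat.mod_eq_of_lt (show t' < N by omega)] at h1
    omega
  -- The total in `sum_card_le_sentEntropy`, regrouped by rounds: the caches of round `j` are
  -- charged at every step of round `j` and of the later ones.
  set f : ℕ → (∀ k, s.CacheMeta k) → (∀ k, s.SendMeta k) → ℝ := fun j c p =>
    ∑ t ∈ Finset.range n, ((if t / L = j then ((fileBits B (file t) ∩ A k (c k)).card : ℝ) else 0) -
      (if j < t / L + 1 then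
        ((fileBits B (file t) ∩ (A k (c k) ∩ storedByOthers A k c)).card : ℝ) else 0) -
      (if t / L = j then s.decodeError (D j) (user t) c p else 0)) with hf
  have hdiv : ∀ t ∈ Finset.range n, t / L ∈ Finset.range J := fun t ht => by
    rw [Finset.mem_range] at ht ⊢
    exact Nat.div_lt_of_lt_mul (by rwa [mul_comm])
  have hrange : ∀ t ∈ Finset.range n, (Finset.range J).filter (fun j => j < t / L + 1) =
      Finset.range (t / L + 1) := fun t ht => by
    have := Finset.mem_range.1 (hdiv t ht)
    ext j
    simp only [Finset.mem_filter, Finset.mem_range]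
    omega
  have h1 := sum_expect_le_expect hfull hP k J D (fun _ => σ) hDk f
    (fun a p => s.sentEntropy k (p k) a) fun p a c hc => by
      refine le_trans (le_of_eq ?_) (sum_card_le_sentEntropy hA k p a c hc D n file hfi user
        (fun t => Fin.succAbove_ne _ _) fun t _ => hDu t)
      simp only [hf]
      rw [Finset.sum_comm]
      refine Finset.sum_congr rfl fun t ht => ?_
      rw [Finset.sum_sub_distrib, Finset.sum_sub_distrib, Finset.sum_ite_eq, Finset.sum_ite_eq,
        if_pos (hdiv t ht), if_pos (hdiv t ht), ← Finset.sum_filter, hrange t ht, hc]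
      simp_rw [hc]
  refine le_trans ?_ h1
  have h2 : ∀ j, s.placementMean (fun c => ∑ t ∈ Finset.range n,
      ((if t / L = j then ((fileBits B (file t) ∩ A k (c k)).card : ℝ) else 0) -
      (if j < t / L + 1 then
        ((fileBits B (file t) ∩ (A k (c k) ∩ storedByOthers A k c)).card : ℝ) else 0))) -
      ∑ t ∈ Finset.range n, (if t / L = j then κ * (B * ε) else 0) ≤ s.expect (D j) (f j) := by
    intro j
    have e : s.expect (D j) (f j) = s.placementMean (fun c => ∑ t ∈ Finset.range n,
        ((if t / L = j then ((fileBits B (file t) ∩ A k (c k)).card : ℝ) else 0) -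
        (if j < t / L + 1 then
          ((fileBits B (file t) ∩ (A k (c k) ∩ storedByOthers A k c)).card : ℝ) else 0))) -
        ∑ t ∈ Finset.range n, s.expect (D j) (fun c p =>
          if t / L = j then s.decodeError (D j) (user t) c p else 0) := by
      rw [← s.expect_const_send (D j), ← s.expect_sum, ← s.expect_sub]
      congr 1
      funext c p
      simp only [hf]
      rw [← Finset.sum_sub_distrib]
    rw [e]
    refine sub_le_sub_left ?_ _
    refine Finset.sum_le_sum fun t _ => ?_
    by_cases htj : t / L = j
    · simp only [htj, if_true]
      exact expect_decodeError_le hκ hDec (D j) (user t)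
    · simp only [htj, if_false]
      simp [expect]
  -- The caches have the same law in every round, so the `t / L + 1` charges at step `t` have equal
  -- means.
  refine le_trans (le_of_eq ?_) (Finset.sum_le_sum fun j _ => h2 j)
  rw [Finset.sum_sub_distrib, ← s.placementMean_sum]
  congr 1
  · congr 1
    funext c
    rw [Finset.sum_comm]
    refine Finset.sum_congr rfl fun t ht => ?_
    rw [Finset.sum_sub_distrib, Finset.sum_ite_eq, if_pos (hdiv t ht), ← Finset.sum_filter,
      hrange t ht]
    simp [hfile]
  · rw [Finset.sum_comm]
    rw [Finset.sum_congr rfl (g := fun _ => κ * (B * ε)) fun t ht => by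
      rw [Finset.sum_ite_eq, if_pos (hdiv t ht)]]
    simp [hn]

/-- The bound from privacy. -/
theorem private_bound [NeZero N] {dl : PMF (Demand (L + 1) N)} {M R κ ε : ℝ} (hL : 0 < L)
    (hfull : ∀ d, dl d ≠ 0) (hκ : ∀ d, 1 ≤ κ * weight dl d) (hu : s.IsUncoded)
    (hM : s.CacheSize dl M ε) (hDec : s.Decodable dl ε) (hP : s.PrivateUnderCollusion dl)
    (hR : s.LoadAtMost dl R ε) {J : ℕ} (hJ : J * L ≤ N) :
    (B : ℝ) * (L * (J * (J + 1)) * N - L * J ^ 2 * ((L + 1) * (M + ε))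
      - (L * (J * (J + 1)) + (L + 1) * (J * L)) * N * (κ * ε)) ≤ B * (N * (R + ε)) := by
  obtain ⟨A, hA⟩ := hu.exists_stores
  set n := J * L with hn
  have h1 := sum_expect_sentEntropy_le (by omega) hfull hP hR
  have h2 : ∀ k, s.placementMean (fun c => ∑ t ∈ Finset.range n, (((A k (c k)).card : ℝ) -
      (((t / L : ℕ) : ℝ) + 1) * ((A k (c k) ∩ storedByOthers A k c).card : ℝ))) -
      N * ((J * L) * (κ * (B * ε))) ≤
      ∑ σ : Fin N, s.expect (fun _ => σ) (fun c p => s.sentEntropy k (p k) (c k)) := by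
    intro k
    refine le_trans (le_of_eq ?_) (Finset.sum_le_sum fun σ _ =>
      placementMean_sum_le_expect hfull hκ hA hDec hP hL hJ k σ)
    rw [Finset.sum_sub_distrib, ← s.placementMean_sum]
    congr 1
    · congr 1
      funext c
      rw [Finset.sum_comm]
      refine Finset.sum_congr rfl fun t _ => ?_
      rw [Finset.sum_sub_distrib, ← Finset.mul_sum, sum_card_fileBits_add_inter,
        sum_card_fileBits_add_inter]
    · simp
  have h3 : ∑ k, (s.placementMean (fun c => ∑ t ∈ Finset.range n, (((A k (c k)).card : ℝ) -
      (((t / L : ℕ) : ℝ) + 1) * ((A k (c k) ∩ storedByOthers A k c).card : ℝ))) -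
      N * ((J * L) * (κ * (B * ε)))) ≤ N * (B * (R + ε)) := by
    refine (Finset.sum_le_sum fun k _ => h2 k).trans ?_
    rw [Finset.sum_comm]
    refine (Finset.sum_le_sum (g := fun _ => B * (R + ε)) fun σ _ => h1 fun _ _ => σ).trans ?_
    simp
  rw [Finset.sum_sub_distrib, ← s.placementMean_sum] at h3
  -- After summing over the transmitters, `le_sum_card_sub` applies at step `t` with `q = t / L +
  -- 1`.
  have h4 : s.placementMean (fun c => ∑ t ∈ Finset.range n,
      (2 * (((t / L : ℕ) : ℝ) + 1) * (N * B)
        - (2 * (((t / L : ℕ) : ℝ) + 1) - 1) * ∑ k, ((A k (c k)).card : ℝ)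
        - 2 * (((t / L : ℕ) : ℝ) + 1) *
          (((Finset.univ.biUnion fun k => A k (c k))ᶜ).card : ℝ))) ≤
      s.placementMean (fun c => ∑ k, ∑ t ∈ Finset.range n, (((A k (c k)).card : ℝ) -
      (((t / L : ℕ) : ℝ) + 1) * ((A k (c k) ∩ storedByOthers A k c).card : ℝ))) := by
    refine s.placementMean_mono fun c => ?_
    conv_rhs => rw [Finset.sum_comm]
    refine Finset.sum_le_sum fun t _ => ?_
    have := le_sum_card_sub (fun k => A k (c k)) (fun k => storedByOthers A k c)
      (fun k x => mem_storedByOthers) (((t / L : ℕ) : ℝ) + 1) (by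
        have : (0 : ℝ) ≤ ((t / L : ℕ) : ℝ) := Nat.cast_nonneg _
        linarith)
    simp only [Fintype.card_prod, Fintype.card_fin] at this
    push_cast at this ⊢
    exact this
  -- Over the `J * L` steps, `2q` sums to `L * (J * (J + 1))` and `2q - 1` to `L * J ^ 2`.
  have h5 := sum_range_div_add_one J L
  rw [← hn] at h5
  have h6 : s.placementMean (fun c => ∑ t ∈ Finset.range n,
      (2 * (((t / L : ℕ) : ℝ) + 1) * (N * B)
        - (2 * (((t / L : ℕ) : ℝ) + 1) - 1) * ∑ k, ((A k (c k)).card : ℝ)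
        - 2 * (((t / L : ℕ) : ℝ) + 1) *
          (((Finset.univ.biUnion fun k => A k (c k))ᶜ).card : ℝ))) =
      L * (J * (J + 1)) * (N * B)
        - L * J ^ 2 * ∑ k, s.placementMean (fun c => ((A k (c k)).card : ℝ))
        - L * (J * (J + 1)) * s.placementMean (fun c =>
          (((Finset.univ.biUnion fun k => A k (c k))ᶜ).card : ℝ)) := by
    rw [← s.placementMean_sum, ← s.placementMean_mul, ← s.placementMean_mul,
      ← s.placementMean_const (L * (J * (J + 1)) * (N * B)), ← s.placementMean_sub,
      ← s.placementMean_sub]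
    congr 1
    funext c
    rw [Finset.sum_sub_distrib, Finset.sum_sub_distrib, ← Finset.sum_mul, ← Finset.sum_mul,
      ← Finset.sum_mul, Finset.sum_sub_distrib, ← Finset.mul_sum, h5]
    simp only [Finset.sum_const, Finset.card_range, hn, nsmul_eq_mul]
    push_cast
    ring
  have h7 : ∑ k, s.placementMean (fun c => ((A k (c k)).card : ℝ)) ≤
      (L + 1) * (B * (M + ε)) := by
    refine (Finset.sum_le_sum fun k _ => placementMean_card_le hA hM k).trans (le_of_eq ?_)
    simp
  have h8 := placementMean_card_compl_le hA hκ hDec 0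
  have h9 := mul_le_mul_of_nonneg_left h7 (show (0 : ℝ) ≤ L * J ^ 2 by positivity)
  have h10 := mul_le_mul_of_nonneg_left h8 (show (0 : ℝ) ≤ L * (J * (J + 1)) by positivity)
  simp only [Finset.sum_const, Finset.card_univ, Fintype.card_fin, nsmul_eq_mul] at h3
  push_cast at h3
  linarith

end Scheme

end D2DCaching

/-! ### Converse bounds on achievable loads -/

namespace D2DCaching

lemma exists_one_le_mul_weight {Ω : Type*} [Fintype Ω] {P : PMF Ω} (h : ∀ ω, P ω ≠ 0) :
    ∃ κ : ℝ, ∀ ω, 1 ≤ κ * weight P ω := by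
  have hpos : ∀ ω, 0 < weight P ω := fun ω => ENNReal.toReal_pos (h ω) (P.apply_ne_top ω)
  refine ⟨∑ ω, (weight P ω)⁻¹, fun ω => ?_⟩
  have h1 : (weight P ω)⁻¹ ≤ ∑ ω, (weight P ω)⁻¹ :=
    Finset.single_le_sum (f := fun ω => (weight P ω)⁻¹) (fun ω _ => (inv_pos.2 (hpos ω)).le)
      (Finset.mem_univ ω)
  calc (1 : ℝ) = (weight P ω)⁻¹ * weight P ω := (inv_mul_cancel₀ (hpos ω).ne').symm
    _ ≤ _ := mul_le_mul_of_nonneg_right h1 (hpos ω).le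

/-- Divide by `B` and let `B` tend to infinity: `κ` depends on the demand law only, so every error
term vanishes with `ε B`. -/
lemma Achievable.shared_link_bound {K N : ℕ} {dl : PMF (Demand K N)} {M R : ℝ}
    (h : Achievable K N dl M R) (hK : 2 ≤ K) (hKN : K ≤ N) (hfull : ∀ d, dl d ≠ 0) {m : ℕ}
    (hm : m ≤ K) : (N : ℝ) * m - (m * (m + 1) / 2) * M ≤ N * R := by
  have : NeZero N := ⟨by omega⟩
  obtain ⟨κ, hκ⟩ := exists_one_le_mul_weight hfull
  obtain ⟨ε, -, hε, hs⟩ := h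
  have h1 : Tendsto (fun B => (N : ℝ) * m - (m * (m + 1) / 2) * (M + ε B) - N * m * (κ * ε B))
      atTop (𝓝 ((N : ℝ) * m - (m * (m + 1) / 2) * (M + 0) - N * m * (κ * 0))) :=
    (tendsto_const_nhds.sub (tendsto_const_nhds.mul (tendsto_const_nhds.add hε))).sub
      (tendsto_const_nhds.mul (tendsto_const_nhds.mul hε))
  have h2 : Tendsto (fun B => (N : ℝ) * (R + ε B)) atTop (𝓝 ((N : ℝ) * (R + 0))) :=
    tendsto_const_nhds.mul (tendsto_const_nhds.add hε)
  have h3 := le_of_tendsto_of_tendsto h1 h2 (by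
    filter_upwards [hs, eventually_gt_atTop 0] with B hB hB0
    obtain ⟨s, hu, hM, hD, hP, hR⟩ := hB
    exact le_of_mul_le_mul_left (Scheme.shared_link_bound hK hKN hfull hκ hu hM hD hP hR hm)
      (Nat.cast_pos.2 hB0))
  simpa using h3

lemma Achievable.private_bound {L N : ℕ} {dl : PMF (Demand (L + 1) N)} {M R : ℝ}
    (h : Achievable (L + 1) N dl M R) (hL : 0 < L) (hN : 0 < N) (hfull : ∀ d, dl d ≠ 0) {J : ℕ}
    (hJ : J * L ≤ N) :
    (L : ℝ) * (J * (J + 1)) * N - L * J ^ 2 * ((L + 1) * M) ≤ N * R := by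
  have : NeZero N := ⟨by omega⟩
  obtain ⟨κ, hκ⟩ := exists_one_le_mul_weight hfull
  obtain ⟨ε, -, hε, hs⟩ := h
  have h1 : Tendsto (fun B => (L : ℝ) * (J * (J + 1)) * N - L * J ^ 2 * ((L + 1) * (M + ε B))
      - (L * (J * (J + 1)) + (L + 1) * (J * L)) * N * (κ * ε B)) atTop
      (𝓝 ((L : ℝ) * (J * (J + 1)) * N - L * J ^ 2 * ((L + 1) * (M + 0))
      - (L * (J * (J + 1)) + (L + 1) * (J * L)) * N * (κ * 0))) :=
    (tendsto_const_nhds.sub (tendsto_const_nhds.mul (tendsto_const_nhds.mul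
      (tendsto_const_nhds.add hε)))).sub (tendsto_const_nhds.mul (tendsto_const_nhds.mul hε))
  have h2 : Tendsto (fun B => (N : ℝ) * (R + ε B)) atTop (𝓝 ((N : ℝ) * (R + 0))) :=
    tendsto_const_nhds.mul (tendsto_const_nhds.add hε)
  have h3 := le_of_tendsto_of_tendsto h1 h2 (by
    filter_upwards [hs, eventually_gt_atTop 0] with B hB hB0
    obtain ⟨s, hu, hM, hD, hP, hR⟩ := hB
    exact le_of_mul_le_mul_left (Scheme.private_bound hL hfull hκ hu hM hD hP hR hJ)
      (Nat.cast_pos.2 hB0))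
  simpa using h3

/-! ### The load of Scheme A -/

/-- The load of Scheme A at its corner points, as a function of `τ = t - 1`. -/
noncomputable def cornerLoad (U N τ : ℕ) : ℝ :=
  ((U.choose (τ + 1) : ℝ) - ((U - N).choose (τ + 1) : ℝ)) / (U.choose τ : ℝ)

lemma schemeAPoints_eq (K N : ℕ) : schemeAPoints K N =
    (fun τ : ℕ => (((N : ℝ) + τ) / K, cornerLoad ((K - 1) * N) N τ)) ''
      Set.Iic ((K - 1) * N) := by
  ext q
  simp only [schemeAPoints, Set.mem_ofPred_eq, Set.mem_image, Set.mem_Iic, cornerLoad]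
  constructor
  · rintro ⟨t, h1, h2, rfl⟩
    obtain ⟨τ, rfl⟩ := Nat.exists_eq_add_of_le' h1
    refine ⟨τ, by omega, ?_⟩
    simp only [Nat.add_sub_cancel, Nat.cast_add, Nat.cast_one]
    ring_nf
  · rintro ⟨τ, h, rfl⟩
    refine ⟨τ + 1, by omega, by omega, ?_⟩
    simp only [Nat.add_sub_cancel, Nat.cast_add, Nat.cast_one]
    ring_nf

lemma cornerLoad_nonneg (U N τ : ℕ) : 0 ≤ cornerLoad U N τ :=
  div_nonneg (sub_nonneg.2 (Nat.cast_le.2 (Nat.choose_le_choose _ (Nat.sub_le _ _))))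
    (Nat.cast_nonneg _)

/-- Dropping the second binomial leaves the ratio of two consecutive binomials. -/
lemma cornerLoad_le {U N τ : ℕ} (hτ : τ ≤ U) : cornerLoad U N τ ≤ ((U : ℝ) - τ) / (τ + 1) := by
  have h1 : (0 : ℝ) < (U.choose τ : ℝ) := Nat.cast_pos.2 (Nat.choose_pos hτ)
  rw [cornerLoad, div_le_div_iff₀ h1 (by positivity)]
  have h2 : (U.choose (τ + 1) : ℝ) * (τ + 1) = U.choose τ * ((U : ℝ) - τ) := by
    have := Nat.choose_succ_right_eq U τ
    rw [← Nat.cast_sub hτ]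
    exact_mod_cast this
  have h3 : (0 : ℝ) ≤ ((U - N).choose (τ + 1) : ℝ) := Nat.cast_nonneg _
  nlinarith [(Nat.cast_nonneg τ : (0 : ℝ) ≤ τ)]

/-- Lowering the upper index from `U` to `U - N` one unit at a time, Pascal's rule costs at most
`U.choose τ` each time. -/
lemma choose_le_choose_sub_add (U τ N : ℕ) :
    U.choose (τ + 1) ≤ (U - N).choose (τ + 1) + N * U.choose τ := by
  induction N with
  | zero => simp
  | succ N ih =>
    have h : (U - N).choose (τ + 1) ≤ (U - (N + 1)).choose (τ + 1) + U.choose τ := by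
      rcases Nat.eq_zero_or_pos (U - N) with h0 | h0
      · simp [h0]
      · obtain ⟨V, hV⟩ := Nat.exists_eq_succ_of_ne_zero h0.ne'
        have h2 : U - (N + 1) = V := by omega
        have h3 := Nat.choose_le_choose τ (show V ≤ U by omega)
        rw [hV, h2, Nat.succ_eq_add_one, Nat.choose_succ_succ']
        omega
    rw [Nat.succ_mul]
    omega

lemma cornerLoad_le_natCast {U τ : ℕ} (N : ℕ) (hτ : τ ≤ U) : cornerLoad U N τ ≤ N := by
  have h1 : (0 : ℝ) < (U.choose τ : ℝ) := Nat.cast_pos.2 (Nat.choose_pos hτ)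
  rw [cornerLoad, div_le_iff₀ h1, sub_le_iff_le_add']
  exact_mod_cast choose_le_choose_sub_add U τ N

lemma convexHull_schemeAPoints_snd_nonneg {K N : ℕ} {q : ℝ × ℝ}
    (hq : q ∈ convexHull ℝ (schemeAPoints K N)) : 0 ≤ q.2 := by
  have h : convexHull ℝ (schemeAPoints K N) ⊆ {q : ℝ × ℝ | 0 ≤ q.2} := by
    refine convexHull_min ?_ ?_
    · rw [schemeAPoints_eq]
      rintro _ ⟨τ, -, rfl⟩
      exact cornerLoad_nonneg _ _ _
    · exact convex_halfSpace_ge (LinearMap.snd ℝ ℝ ℝ).isLinear 0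
  exact h hq

lemma bddBelow_schemeA (K N : ℕ) (M : ℝ) :
    BddBelow {R : ℝ | (M, R) ∈ convexHull ℝ (schemeAPoints K N)} :=
  ⟨0, fun _ hR => convexHull_schemeAPoints_snd_nonneg hR⟩

/-- A point of the convex hull above `M`, on a chord between consecutive corner points. -/
lemma exists_mem_convexHull {L N : ℕ} {M : ℝ} (hM₁ : (N : ℝ) / (L + 1) ≤ M) (hM₂ : M ≤ N) :
    ∃ R, (M, R) ∈ convexHull ℝ (schemeAPoints (L + 1) N) ∧ R ≤ N ∧
      (0 < (L + 1) * M - N → R ≤ (L * N - ((L + 1) * M - N)) / ((L + 1) * M - N)) := by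
  have hL : (0 : ℝ) < (L : ℝ) + 1 := by positivity
  -- On the scale of `x` the corner points sit at the integers `τ = 0, ..., L * N`.
  set x : ℝ := (L + 1) * M - N with hx
  have hx0 : 0 ≤ x := by
    rw [div_le_iff₀ hL] at hM₁
    linarith
  have hxU : x ≤ L * N := by
    have := mul_le_mul_of_nonneg_left hM₂ hL.le
    linarith
  set τ := ⌊x⌋₊ with hτ
  have hτx : (τ : ℝ) ≤ x := Nat.floor_le hx0
  have hxτ : x < τ + 1 := Nat.lt_floor_add_one x
  have hτU : τ ≤ L * N := by
    have : (τ : ℝ) ≤ L * N := hτx.trans hxU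
    exact_mod_cast this
  have hmem : ∀ τ ≤ L * N, (((N : ℝ) + τ) / (L + 1), cornerLoad (L * N) N τ) ∈
      convexHull ℝ (schemeAPoints (L + 1) N) := fun τ hτ => subset_convexHull _ _ (by
    rw [schemeAPoints_eq]
    exact ⟨τ, by simpa using hτ, by simp⟩)
  have hMx : M = (N + x) / (L + 1) := by
    rw [eq_div_iff hL.ne', hx]
    ring
  rcases eq_or_lt_of_le hτU with h | h
  · have hxe : x = τ := le_antisymm (by rw [h]; push_cast; exact hxU) hτx
    refine ⟨cornerLoad (L * N) N τ, ?_, cornerLoad_le_natCast N hτU, fun hpos => ?_⟩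
    · rw [hMx, hxe]
      exact hmem τ hτU
    · refine (cornerLoad_le hτU).trans ?_
      have h1 : ((L * N : ℕ) : ℝ) - τ = 0 := by rw [h, sub_self]
      rw [h1, zero_div]
      exact div_nonneg (by linarith) hpos.le
  · have h1 := hmem τ hτU
    have h2 := hmem (τ + 1) h
    have h3 := (convex_convexHull ℝ (schemeAPoints (L + 1) N)) h1 h2
      (show 0 ≤ 1 - (x - τ) by linarith) (show 0 ≤ x - τ by linarith) (by ring)
    have c1 := cornerLoad_le (N := N) hτU
    have c2 := cornerLoad_le (N := N) (show τ + 1 ≤ L * N from h)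
    refine ⟨(1 - (x - τ)) * cornerLoad (L * N) N τ + (x - τ) * cornerLoad (L * N) N (τ + 1),
      ?_, ?_, fun hpos => ?_⟩
    · convert h3 using 1
      simp only [Prod.smul_mk, Prod.mk_add_mk, smul_eq_mul, Prod.mk.injEq, and_true]
      rw [hMx]
      push_cast
      field_simp
      ring
    · have n1 := mul_le_mul_of_nonneg_left (cornerLoad_le_natCast N hτU)
        (show 0 ≤ 1 - (x - τ) by linarith)
      have n2 := mul_le_mul_of_nonneg_left (cornerLoad_le_natCast N (show τ + 1 ≤ L * N from h))
        (show 0 ≤ x - τ by linarith)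
      linarith
    · push_cast at c1 c2
      have hτ0 : (0 : ℝ) ≤ τ := Nat.cast_nonneg τ
      have hU : (τ : ℝ) + 1 ≤ L * N := by exact_mod_cast h
      -- Giving both endpoints the denominator `τ + 1` makes the interpolated bound collapse to `(L
      -- * N - x) / (τ + 1)`.
      have c2' : cornerLoad (L * N) N (τ + 1) ≤ ((L : ℝ) * N - (τ + 1)) / (τ + 1) :=
        c2.trans (div_le_div_of_nonneg_left (by linarith) (by linarith) (by linarith))
      have n1 := mul_le_mul_of_nonneg_left c1 (show 0 ≤ 1 - (x - τ) by linarith)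
      have n2 := mul_le_mul_of_nonneg_left c2' (show 0 ≤ x - τ by linarith)
      have e : (1 - (x - τ)) * (((L : ℝ) * N - τ) / (τ + 1)) +
          (x - τ) * (((L : ℝ) * N - (τ + 1)) / (τ + 1)) = ((L : ℝ) * N - x) / (τ + 1) := by
        field_simp
        ring
      have e2 : ((L : ℝ) * N - x) / (τ + 1) ≤ ((L : ℝ) * N - x) / x :=
        div_le_div_of_nonneg_left (by linarith) hpos hxτ.le
      linarith

/-- The infimum that defines the load of Scheme A is attained. -/
lemma schemeALoad_mem {L N : ℕ} {M : ℝ} (hM₁ : (N : ℝ) / (L + 1) ≤ M) (hM₂ : M ≤ N) :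
    (M, schemeALoad (L + 1) N M) ∈ convexHull ℝ (schemeAPoints (L + 1) N) := by
  have hfin : (schemeAPoints (L + 1) N).Finite := by
    rw [schemeAPoints_eq]
    exact (Set.finite_Iic _).image _
  -- The hull of finitely many points is closed, hence so is its vertical slice.
  have hclosed : IsClosed {R : ℝ | (M, R) ∈ convexHull ℝ (schemeAPoints (L + 1) N)} :=
    (hfin.isClosed_convexHull ℝ).preimage (by fun_prop : Continuous fun R : ℝ => (M, R))
  obtain ⟨R, hR, -⟩ := exists_mem_convexHull hM₁ hM₂
  exact hclosed.csInf_mem ⟨R, hR⟩ (bddBelow_schemeA _ _ _)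

lemma schemeALoad_le {L N : ℕ} {M : ℝ} (hM₁ : (N : ℝ) / (L + 1) ≤ M) (hM₂ : M ≤ N) :
    schemeALoad (L + 1) N M ≤ N ∧ (0 < (L + 1) * M - N → schemeALoad (L + 1) N M ≤
      (L * N - ((L + 1) * M - N)) / ((L + 1) * M - N)) := by
  obtain ⟨R, hR, h1, h2⟩ := exists_mem_convexHull hM₁ hM₂
  have h3 : schemeALoad (L + 1) N M ≤ R := csInf_le (bddBelow_schemeA _ _ _) hR
  exact ⟨h3.trans h1, fun h => h3.trans (h2 h)⟩

/-- Scheme A is within a factor `18` of any achievable load. -/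
lemma Achievable.schemeALoad_le_mul {L N : ℕ} {dl : PMF (Demand (L + 1) N)} {M R : ℝ}
    (h : Achievable (L + 1) N dl M R) (hL : 0 < L) (hLN : L + 1 ≤ N) (hfull : ∀ d, dl d ≠ 0)
    (hM₁ : (N : ℝ) / (L + 1) ≤ M) (hM₂ : M ≤ N) : schemeALoad (L + 1) N M ≤ 18 * R := by
  obtain ⟨hA1, hA2⟩ := schemeALoad_le hM₁ hM₂
  have hL' : (0 : ℝ) < L := Nat.cast_pos.2 hL
  have hN' : (0 : ℝ) < N := Nat.cast_pos.2 (by omega)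
  have hM0 : 0 < M := lt_of_lt_of_le (by positivity) hM₁
  have hKM : (N : ℝ) ≤ (L + 1) * M := by
    rw [div_le_iff₀ (by positivity)] at hM₁
    linarith
  set x : ℝ := (L + 1) * M - N with hx
  -- The privacy bound after substituting `(L + 1) * M = N + x`.
  have hpriv : ∀ J : ℕ, J * L ≤ N → L * J * (N - J * x) ≤ N * R := fun J hJ => by
    have := h.private_bound hL (by omega) hfull hJ
    rw [hx]
    linarith
  -- For small `x`, `J` is taken as large as `J * L ≤ N` and `J * x ≤ N / 2` allow; the second
  -- condition keeps at least half of `L * J`.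
  rcases le_or_gt x (N / 2) with hxN | hxN
  · set J₀ := N / L with hJ₀
    have hJ₀L : J₀ * L ≤ N := Nat.div_mul_le_self N L
    have hJ₀pos : 1 ≤ J₀ := (Nat.one_le_div_iff hL).2 (by omega)
    have hJ₀N : N ≤ 2 * (J₀ * L) := by
      have h1 := Nat.lt_div_mul_add (a := N) hL
      rw [← hJ₀] at h1
      have h2 : L ≤ J₀ * L := Nat.le_mul_of_pos_left L hJ₀pos
      omega
    have hJ₀N' : (N : ℝ) ≤ 2 * (J₀ * L) := by exact_mod_cast hJ₀N
    rcases le_or_gt (J₀ * x) (N / 2) with hcase | hcase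
    -- `R ≥ L * J₀ / 2 ≥ N / 4`, against a load of at most `N`.
    · have h1 := hpriv J₀ hJ₀L
      have h2 : L * J₀ * (N / 2 : ℝ) ≤ L * J₀ * (N - J₀ * x) :=
        mul_le_mul_of_nonneg_left (by linarith) (by positivity)
      have h3 : (N : ℝ) * (L * J₀ / 2) ≤ N * R := by linarith
      have h4 := le_of_mul_le_mul_left h3 hN'
      linarith
    · have hx0 : 0 < x := by
        by_contra hneg
        have := mul_nonpos_of_nonneg_of_nonpos (Nat.cast_nonneg J₀ : (0 : ℝ) ≤ J₀)
          (not_lt.1 hneg)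
        linarith
      -- `N < 2 * x * (J + 1) ≤ 4 * J * x`, so `R ≥ L * J / 2 ≥ L * N / (8 * x)`: a factor `8`.
      set J := ⌊(N : ℝ) / (2 * x)⌋₊ with hJ
      have hle : (J : ℝ) ≤ N / (2 * x) := Nat.floor_le (by positivity)
      have hlt : (N : ℝ) / (2 * x) < J + 1 := Nat.lt_floor_add_one _
      have hJ1 : 1 ≤ J := Nat.le_floor (by
        rw [Nat.cast_one, le_div_iff₀ (by positivity)]
        linarith)
      rw [le_div_iff₀ (by positivity)] at hle
      rw [div_lt_iff₀ (by positivity)] at hlt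
      have hJJ : J ≤ J₀ := by
        have h1 : (J : ℝ) * x < J₀ * x := by linarith
        have h2 := lt_of_mul_lt_mul_right h1 hx0.le
        exact_mod_cast h2.le
      have h1 := hpriv J ((Nat.mul_le_mul_right L hJJ).trans hJ₀L)
      have h2 : L * J * (N / 2 : ℝ) ≤ L * J * (N - J * x) :=
        mul_le_mul_of_nonneg_left (by linarith) (by positivity)
      have h3 : (N : ℝ) * (L * J / 2) ≤ N * R := by linarith
      have h4 := le_of_mul_le_mul_left h3 hN'
      refine (hA2 hx0).trans ?_
      rw [div_le_iff₀ hx0]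
      have hJ1' : (1 : ℝ) ≤ J := by exact_mod_cast hJ1
      have h5 : (N : ℝ) ≤ 4 * (J * x) := by nlinarith
      have h6 : (L : ℝ) * N ≤ L * (4 * (J * x)) := mul_le_mul_of_nonneg_left h5 hL'.le
      have h7 : L * J / 2 * x ≤ R * x := mul_le_mul_of_nonneg_right h4 hx0.le
      have h8 : 0 ≤ L * J / 2 * x := by positivity
      linarith
  -- Here `(L + 1) * M = N + x < 3 * x`, which turns the bound on Scheme A into `3 * (N - M) / M`.
  · have hx0 : 0 < x := by linarith
    have h1 : schemeALoad (L + 1) N M ≤ 3 * (N - M) / M := by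
      refine (hA2 hx0).trans ?_
      rw [div_le_div_iff₀ hx0 hM0]
      have e : (L * N - x) * M = ((L + 1) * M) * (N - M) := by rw [hx]; ring
      rw [e]
      have : (L + 1) * M ≤ 3 * x := by linarith
      have := mul_le_mul_of_nonneg_right this (sub_nonneg.2 hM₂)
      linarith
    refine h1.trans ?_
    rw [div_le_iff₀ hM0]
    have hsh : ∀ m : ℕ, m ≤ L + 1 → (N : ℝ) * m - (m * (m + 1) / 2) * M ≤ N * R := fun m hm =>
      h.shared_link_bound (by omega) hLN hfull hm
    rcases le_or_gt (N : ℝ) (6 * M) with hc | hc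
    -- Origin of the constant: `m = 1` gives `N - M ≤ N * R`, and `3 * N / M ≤ 18`.
    · have h2 := hsh 1 (by omega)
      norm_num at h2
      have hR : 0 ≤ R := by
        by_contra hneg
        have := mul_neg_of_pos_of_neg hN' (not_le.1 hneg)
        linarith
      have := mul_le_mul_of_nonneg_right hc hR
      linarith
    -- From `m * M ≤ N < (m + 1) * M`, the bound gives `N * R ≥ m * (N - M) / 2`, while `m * M > N -
    -- M > 5 / 6 * N`: a factor `36 / 5`.
    · set m := ⌊(N : ℝ) / M⌋₊ with hm
      have hle : (m : ℝ) ≤ N / M := Nat.floor_le (by positivity)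
      have hlt : (N : ℝ) / M < m + 1 := Nat.lt_floor_add_one _
      rw [le_div_iff₀ hM0] at hle
      rw [div_lt_iff₀ hM0] at hlt
      have hmK : m ≤ L + 1 := by
        have : (m : ℝ) * M ≤ (L + 1) * M := by linarith
        have := le_of_mul_le_mul_right this hM0
        exact_mod_cast this
      have h2 := hsh m hmK
      have hm0 : (0 : ℝ) ≤ m := Nat.cast_nonneg m
      have h3 : (m : ℝ) * ((N - M) / 2) ≤ N * R := by nlinarith
      have h4 : (5 / 6 : ℝ) * N ≤ m * M := by linarith
      have h5 := mul_le_mul_of_nonneg_right h4 (show (0 : ℝ) ≤ (N - M) / 2 by linarith)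
      have h6 := mul_le_mul_of_nonneg_right h3 hM0.le
      have h7 : (N : ℝ) * (5 / 12 * (N - M)) ≤ N * (R * M) := by linarith
      have h8 := le_of_mul_le_mul_left h7 hN'
      linarith

end D2DCaching

/-! ### Redundancy of the coded messages -/

namespace D2DCaching

section Redundancy

variable {V ι : Type*} [DecidableEq V] [DecidableEq ι] (dem : V → ι)

/-- The sum of `Y` over the sets obtained from `S` by removing a user that wants file `n`. -/
def removeUser (n : ι) (Y : Finset V → ZMod 2) (S : Finset V) : ZMod 2 :=
  ∑ u ∈ S.filter (fun u => dem u = n), Y (S.erase u)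

lemma removeUser_zero (n : ι) : removeUser dem n 0 = 0 := by
  funext S
  simp [removeUser]

lemma removeUser_sum {κ : Type*} (n : ι) (t : Finset κ) (Y : κ → Finset V → ZMod 2) :
    removeUser dem n (∑ i ∈ t, Y i) = ∑ i ∈ t, removeUser dem n (Y i) := by
  funext S
  simp only [removeUser, Finset.sum_apply]
  exact Finset.sum_comm

lemma removeUser_comm (n m : ι) (Y : Finset V → ZMod 2) :
    removeUser dem n (removeUser dem m Y) = removeUser dem m (removeUser dem n Y) := by
  funext S
  simp only [removeUser]
  rw [Finset.sum_comm' (t' := S.filter fun u => dem u = m)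
    (s' := fun u' => (S.erase u').filter fun u => dem u = n)]
  · refine Finset.sum_congr rfl fun u _ => Finset.sum_congr rfl fun u' _ => ?_
    rw [Finset.erase_right_comm]
  · intro u u'
    simp only [Finset.mem_filter, Finset.mem_erase]
    tauto

/-- Two users are removed in either order; the two terms agree and cancel in characteristic two, as
for a boundary operator. -/
lemma removeUser_removeUser (n : ι) (Y : Finset V → ZMod 2) :
    removeUser dem n (removeUser dem n Y) = 0 := by
  funext S
  simp only [removeUser, Pi.zero_apply]
  rw [Finset.sum_sigma']
  refine Finset.sum_involution (fun x _ => ⟨x.2, x.1⟩) ?_ ?_ ?_ ?_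
  · rintro ⟨u, u'⟩ _
    rw [Finset.erase_right_comm]
    exact CharTwo.add_self_eq_zero _
  · rintro ⟨u, u'⟩ h _ heq
    simp only [Finset.mem_sigma, Finset.mem_filter, Finset.mem_erase] at h
    simp only [Sigma.mk.injEq, heq_eq_eq] at heq
    exact h.2.1.1 heq.1
  · rintro ⟨u, u'⟩ h
    simp only [Finset.mem_sigma, Finset.mem_filter, Finset.mem_erase] at h ⊢
    tauto
  · rintro ⟨u, u'⟩ _
    rfl

lemma foldr_removeUser_sum {κ : Type*} (l : List ι) (t : Finset κ) (Y : κ → Finset V → ZMod 2) :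
    l.foldr (removeUser dem) (∑ i ∈ t, Y i) = ∑ i ∈ t, l.foldr (removeUser dem) (Y i) := by
  induction l with
  | nil => rfl
  | cons a l ih => simp only [List.foldr_cons, ih, removeUser_sum]

lemma foldr_removeUser_comm (l : List ι) (n : ι) (Y : Finset V → ZMod 2) :
    l.foldr (removeUser dem) (removeUser dem n Y) = removeUser dem n (l.foldr (removeUser dem) Y) := by
  induction l with
  | nil => rfl
  | cons a l ih => rw [List.foldr_cons, List.foldr_cons, ih, removeUser_comm]

lemma foldr_removeUser_eq_zero {l : List ι} {n : ι} (hn : n ∈ l) (Y : Finset V → ZMod 2) :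
    l.foldr (removeUser dem) (removeUser dem n Y) = 0 := by
  induction l with
  | nil => simp at hn
  | cons a l ih =>
    rw [List.foldr_cons]
    rcases List.mem_cons.1 hn with rfl | h
    · rw [foldr_removeUser_comm, removeUser_removeUser]
    · rw [ih h, removeUser_zero]

variable {dem} {lead : ι → V}

/-- Each operator removes one user, so with fewer operators than leaders some leader survives, and
`Y` vanishes there. -/
lemma foldr_removeUser_apply_eq_zero {Y : Finset V → ZMod 2}
    (hY : ∀ S, (∃ n, lead n ∈ S) → Y S = 0) (l : List ι) (S : Finset V)
    (hS : l.length < (S.filter fun u => lead (dem u) = u).card) :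
    l.foldr (removeUser dem) Y S = 0 := by
  induction l generalizing S with
  | nil =>
    obtain ⟨u, hu⟩ := Finset.card_pos.1 hS
    rw [Finset.mem_filter] at hu
    exact hY S ⟨dem u, by rw [hu.2]; exact hu.1⟩
  | cons a l ih =>
    rw [List.foldr_cons, removeUser]
    refine Finset.sum_eq_zero fun u _ => ih _ ?_
    rw [Finset.filter_erase]
    have := Finset.pred_card_le_card_erase (s := S.filter fun u => lead (dem u) = u) (a := u)
    rw [List.length_cons] at hS
    omega

/-- Only the removal of exactly the added leaders ends at a set without a leader, and that set is
`S`. -/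
lemma foldr_removeUser_apply_union (hlead : ∀ n, dem (lead n) = n) {Y : Finset V → ZMod 2}
    (hY : ∀ S, (∃ n, lead n ∈ S) → Y S = 0) {S : Finset V} (hS : ∀ n, lead n ∉ S) (l : List ι)
    (hl : l.Nodup) : l.foldr (removeUser dem) Y (S ∪ l.toFinset.image lead) = Y S := by
  have hinj : Function.Injective lead := fun a b h => by rw [← hlead a, h, hlead]
  induction l with
  | nil => simp
  | cons a l ih =>
    obtain ⟨ha, hl⟩ := List.nodup_cons.1 hl
    rw [List.foldr_cons, removeUser, Finset.sum_eq_single (lead a)]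
    · rw [← ih hl]
      refine congrArg (l.foldr (removeUser dem) Y) ?_
      ext u
      simp only [Finset.mem_erase, Finset.mem_union, Finset.mem_image, List.mem_toFinset,
        List.mem_cons]
      constructor
      · rintro ⟨hu, h | ⟨n, rfl | hn, rfl⟩⟩
        · exact Or.inl h
        · exact absurd rfl hu
        · exact Or.inr ⟨n, hn, rfl⟩
      · rintro (h | ⟨n, hn, rfl⟩)
        · exact ⟨fun h' => hS a (h' ▸ h), Or.inl h⟩
        · exact ⟨fun h' => ha (hinj h' ▸ hn), Or.inr ⟨n, Or.inr hn, rfl⟩⟩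
    · intro u hu hne
      rw [Finset.mem_filter] at hu
      refine foldr_removeUser_apply_eq_zero hY l _ ?_
      have hsub : (a :: l).toFinset.image lead ⊆
          ((S ∪ (a :: l).toFinset.image lead).erase u).filter fun u => lead (dem u) = u := by
        intro v hv
        obtain ⟨n, hn, rfl⟩ := Finset.mem_image.1 hv
        rw [Finset.mem_filter, Finset.mem_erase, hlead]
        refine ⟨⟨fun h => hne ?_, Finset.mem_union_right _ hv⟩, rfl⟩
        have : n = a := by rw [← hu.2, ← h, hlead]
        rw [← h, this]
      have h1 := Finset.card_le_card hsub
      rw [Finset.card_image_of_injective _ hinj, List.toFinset_card_of_nodup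
        (List.nodup_cons.2 ⟨ha, hl⟩), List.length_cons] at h1
      omega
    · intro h
      exact absurd (Finset.mem_filter.2 ⟨Finset.mem_union_right _ (Finset.mem_image_of_mem _
        (by simp)), hlead a⟩) h

/-- The coded messages for the sets of users with a leader determine all the coded messages. -/
lemma sum_removeUser_eq_zero [Fintype ι] (hlead : ∀ n, dem (lead n) = n)
    (W : ι → Finset V → ZMod 2)
    (h : ∀ S, (∃ n, lead n ∈ S) → (∑ n, removeUser dem n (W n)) S = 0) (S : Finset V) :
    (∑ n, removeUser dem n (W n)) S = 0 := by
  by_cases hS : ∃ n, lead n ∈ S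
  · exact h S hS
  · push Not at hS
    -- The product of all the operators, evaluated at `S` with every leader added, returns the value
    -- at `S`; yet it kills each summand, on which one operator acts twice.
    rw [← foldr_removeUser_apply_union hlead h hS (Finset.univ.toList) (Finset.nodup_toList _),
      foldr_removeUser_sum]
    have : ∀ n ∈ (Finset.univ : Finset ι),
        (Finset.univ.toList).foldr (removeUser dem) (removeUser dem n (W n)) = 0 := fun n _ =>
      foldr_removeUser_eq_zero dem (by simp) (W n)
    rw [Finset.sum_eq_zero this]
    rfl

end Redundancy

/-! ### Scheme A -/

section SchemeA

variable (L N B : ℕ) (b : ℕ → ℕ)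

/-- The effective users served by a transmitter: one for each other user and each file. -/
abbrev EffUser : Type := Fin L × Fin N

/-- A label: the transmitter, the effective users who store the bit, and the index of the bit. -/
abbrev Label : Type := Fin (L + 1) × (Σ T : Finset (EffUser L N), Fin (b T.card))

variable {L N B b}

/-- Bits as elements of the field with two elements. -/
def bitVal (x : Bool) : ZMod 2 := if x then 1 else 0

lemma bitVal_injective : Function.Injective bitVal := by
  intro x y h
  revert h
  cases x <;> cases y <;> decide

variable (loc : Label L N b ↪ Fin B)

/-- The bit of file `n` with label `(k, T, r)`, or `0` if there is no such label. -/
def labelBit (F : Library N B) (k : Fin (L + 1)) (r : ℕ) (n : Fin N)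
    (T : Finset (EffUser L N)) : ZMod 2 :=
  if h : r < b T.card then bitVal (F n (loc (k, ⟨T, ⟨r, h⟩⟩))) else 0

/-- The positions, in every file, stored by user `j` with slot `i`. -/
def storedPos (j : Fin (L + 1)) (i : Fin N) : Finset (Fin B) :=
  open Classical in
  Finset.univ.filter fun x => ∀ l, loc l = x →
    l.1 = j ∨ ∃ r : Fin L, j = l.1.succAbove r ∧ (r, i) ∈ l.2.1

/-- At a position without a label the condition is void: everybody stores it, and the leftovers of
rounding need no delivery. -/
lemma mem_storedPos {j : Fin (L + 1)} {i : Fin N} {x : Fin B} : x ∈ storedPos loc j i ↔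
    ∀ l, loc l = x → l.1 = j ∨ ∃ r : Fin L, j = l.1.succAbove r ∧ (r, i) ∈ l.2.1 := by
  simp [storedPos]

lemma loc_mem_storedPos {j : Fin (L + 1)} {i : Fin N} {l : Label L N b} :
    loc l ∈ storedPos loc j i ↔ l.1 = j ∨ ∃ r : Fin L, j = l.1.succAbove r ∧ (r, i) ∈ l.2.1 := by
  rw [mem_storedPos]
  exact ⟨fun h => h l rfl, fun h l' hl' => loc.injective hl' ▸ h⟩

/-- The content of the cache of user `j` with slot `i`. -/
noncomputable def schemeAContent (j : Fin (L + 1)) (i : Fin N) (F : Library N B) : List Bool :=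
  ((Finset.univ ×ˢ storedPos loc j i : Finset (Fin N × Fin B)).toList).map fun x => F x.1 x.2

lemma schemeAContent_eq_iff {j : Fin (L + 1)} {i : Fin N} {F G : Library N B} :
    schemeAContent loc j i F = schemeAContent loc j i G ↔
      ∀ n, ∀ x ∈ storedPos loc j i, F n x = G n x := by
  simp [schemeAContent, List.map_inj_left]

lemma labelBit_eq_of_content_eq {j : Fin (L + 1)} {i : Fin N} {F G : Library N B}
    (h : schemeAContent loc j i F = schemeAContent loc j i G) {k : Fin (L + 1)} {r : ℕ} {n : Fin N}
    {T : Finset (EffUser L N)} (hT : k = j ∨ ∃ r : Fin L, j = k.succAbove r ∧ (r, i) ∈ T) :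
    labelBit loc F k r n T = labelBit loc G k r n T := by
  unfold labelBit
  split_ifs with hr
  · rw [(schemeAContent_eq_iff loc).1 h n _ ((loc_mem_storedPos loc).2 hT)]
  · rfl

/-- The file wanted by an effective user, when the users are shifted by `g`. -/
def effDemand (k : Fin (L + 1)) (g : Fin (L + 1) → Fin N) (u : EffUser L N) : Fin N :=
  g (k.succAbove u.1) + u.2

/-- The coded message of transmitter `k` for the effective users in `S`. -/
def codedBit (F : Library N B) (k : Fin (L + 1)) (r : ℕ) (g : Fin (L + 1) → Fin N)
    (S : Finset (EffUser L N)) : ZMod 2 :=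
  ∑ u ∈ S, labelBit loc F k r (effDemand k g u) (S.erase u)

/-- All the coded messages of transmitter `k`. -/
noncomputable def encode (k : Fin (L + 1)) (g : Fin (L + 1) → Fin N) (F : Library N B) : List Bool :=
  (Finset.univ : Finset (Finset (EffUser L N) × Fin B)).toList.map fun q =>
    decide (codedBit loc F k q.2 g q.1 = 1)

lemma encode_eq_iff {k : Fin (L + 1)} {g : Fin (L + 1) → Fin N} {F G : Library N B} :
    encode loc k g F = encode loc k g G ↔ ∀ (S : Finset (EffUser L N)) (r : Fin B),
      codedBit loc F k r g S = codedBit loc G k r g S := by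
  have h2 : ∀ x y : ZMod 2, (decide (x = 1) = decide (y = 1)) ↔ x = y := by decide
  simp [encode, List.map_inj_left, -decide_eq_decide, h2]

/-- Grouping the effective users by the file they want gives the form required by
`sum_removeUser_eq_zero`. -/
lemma codedBit_eq_sum (F : Library N B) (k : Fin (L + 1)) (r : ℕ) (g : Fin (L + 1) → Fin N)
    (S : Finset (EffUser L N)) : codedBit loc F k r g S =
      (∑ n, removeUser (effDemand k g) n (labelBit loc F k r n)) S := by
  rw [codedBit, Finset.sum_apply]
  simp only [removeUser]
  rw [← Finset.sum_fiberwise_of_maps_to (s := S) (t := Finset.univ) (g := effDemand k g) (by simp)]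
  refine Finset.sum_congr rfl fun n _ => Finset.sum_congr rfl fun u hu => ?_
  rw [(Finset.mem_filter.1 hu).2]

lemma encode_eq_of_content_eq {k : Fin (L + 1)} {i : Fin N} {F G : Library N B}
    (h : schemeAContent loc k i F = schemeAContent loc k i G) (g : Fin (L + 1) → Fin N) :
    encode loc k g F = encode loc k g G := by
  rw [encode_eq_iff]
  intro S r
  refine Finset.sum_congr rfl fun u _ => ?_
  exact labelBit_eq_of_content_eq loc h (Or.inl rfl)

/-- Decoding: every other summand of the message has a label set still containing `(i, n)`, so user
`j` in slot `n` stores it; cancellation leaves the wanted bit. -/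
lemma labelBit_eq_of_codedBit_eq {F G : Library N B} {k j : Fin (L + 1)} {r : ℕ}
    {g : Fin (L + 1) → Fin N} {i : Fin L} {n : Fin N} {T : Finset (EffUser L N)}
    (hc : schemeAContent loc j n F = schemeAContent loc j n G) (hj : j = k.succAbove i)
    (hT : (i, n) ∉ T)
    (h : codedBit loc F k r g (insert (i, n) T) = codedBit loc G k r g (insert (i, n) T)) :
    labelBit loc F k r (effDemand k g (i, n)) T = labelBit loc G k r (effDemand k g (i, n)) T := by
  rw [codedBit, codedBit, Finset.sum_insert hT, Finset.sum_insert hT, Finset.erase_insert hT] at h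
  have h2 : ∑ v ∈ T, labelBit loc F k r (effDemand k g v) ((insert (i, n) T).erase v) =
      ∑ v ∈ T, labelBit loc G k r (effDemand k g v) ((insert (i, n) T).erase v) := by
    refine Finset.sum_congr rfl fun v hv => labelBit_eq_of_content_eq loc hc (Or.inr ⟨i, hj, ?_⟩)
    exact Finset.mem_erase.2 ⟨fun h => hT (h ▸ hv), Finset.mem_insert_self _ _⟩
  rw [h2] at h
  exact add_right_cancel h

/-- The payload of transmitter `k`, computed from its cache. -/
noncomputable def schemeAPayload (k : Fin (L + 1)) (g : Fin (L + 1) → Fin N) (z : Fin N × List Bool) :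
    List Bool :=
  open Classical in
  if h : ∃ F, schemeAContent loc k z.1 F = z.2 then encode loc k g h.choose else []

/-- A transmitter stores every bit labelled with itself, so any library compatible with its cache
yields the same messages and the choice in `schemeAPayload` is immaterial. -/
lemma schemeAPayload_content (k : Fin (L + 1)) (g : Fin (L + 1) → Fin N) (i : Fin N)
    (F : Library N B) :
    schemeAPayload loc k g (i, schemeAContent loc k i F) = encode loc k g F := by
  have h : ∃ G, schemeAContent loc k i G = schemeAContent loc k i F := ⟨F, rfl⟩
  rw [schemeAPayload, dif_pos h]
  exact encode_eq_of_content_eq loc h.choose_spec g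

variable [NeZero N]

/-- The effective users `(i₀, n)` want each file exactly once and serve as leaders. By linearity the
redundancy is applied to the difference of the two libraries. -/
lemma codedBit_eq_of_leaders {F G : Library N B} {k : Fin (L + 1)} {r : ℕ}
    {g : Fin (L + 1) → Fin N} (i₀ : Fin L)
    (h : ∀ S : Finset (EffUser L N), (∃ n, (i₀, n) ∈ S) →
      codedBit loc F k r g S = codedBit loc G k r g S) (S : Finset (EffUser L N)) :
    codedBit loc F k r g S = codedBit loc G k r g S := by
  have key : ∀ S, codedBit loc F k r g S - codedBit loc G k r g S =
      (∑ n, removeUser (effDemand k g) n (labelBit loc F k r n - labelBit loc G k r n)) S := by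
    intro S
    rw [codedBit_eq_sum, codedBit_eq_sum, Finset.sum_apply, Finset.sum_apply, Finset.sum_apply,
      ← Finset.sum_sub_distrib]
    refine Finset.sum_congr rfl fun n _ => ?_
    simp only [removeUser, Pi.sub_apply, Finset.sum_sub_distrib]
  rw [← sub_eq_zero, key]
  refine sum_removeUser_eq_zero (lead := fun n => (i₀, n - g (k.succAbove i₀)))
    (fun n => by simp [effDemand]) _ (fun S hS => ?_) S
  rw [← key, sub_eq_zero]
  obtain ⟨n, hn⟩ := hS
  exact h S ⟨_, hn⟩

/-- Scheme A: every user occupies a secret random slot, and the server publishes the difference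
between the demand and the slot. -/
noncomputable def schemeA : Scheme (L + 1) N B where
  CacheMeta _ := Fin N
  cacheMetaFintype _ := inferInstance
  SendMeta _ := Fin (L + 1) → Fin N
  sendMetaFintype _ := inferInstance
  placement := PMF.uniformOfFintype (Fin (L + 1) → Fin N)
  content := schemeAContent loc
  query d c := PMF.pure fun _ j => d j - c j
  payload := schemeAPayload loc

lemma schemeA_isUncoded : (schemeA loc).IsUncoded := fun j i =>
  ⟨(Finset.univ ×ˢ storedPos loc j i : Finset (Fin N × Fin B)).toList, fun _ => rfl⟩

lemma schemeA_signal (k : Fin (L + 1)) (ω : (schemeA loc).Outcome) :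
    (schemeA loc).signal k ω = (ω.2.2.2 k, encode loc k (ω.2.2.2 k) ω.1) :=
  Prod.ext rfl (schemeAPayload_content loc k (ω.2.2.2 k) (ω.2.1 k) ω.1)

lemma schemeA_query_eq {dl : PMF (Demand (L + 1) N)} {F : Library N B}
    {c : Fin (L + 1) → Fin N} {d : Demand (L + 1) N} {p : Fin (L + 1) → Fin (L + 1) → Fin N}
    (h : weight ((schemeA loc).law dl) (F, c, d, p) ≠ 0) (k : Fin (L + 1)) :
    p k = fun j => d j - c j := by
  classical
  have e1 := (schemeA loc).weight_law dl F (c, d, p)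
  have e2 := (schemeA loc).weight_metaLaw dl c d p
  have h1 : weight ((schemeA loc).query d c) p ≠ 0 := fun h0 =>
    h (e1.trans (by rw [e2, h0, mul_zero, mul_zero, mul_zero]))
  have h2 : p = fun _ j => d j - c j := by
    by_contra hne
    exact h1 (congrArg ENNReal.toReal (PMF.pure_apply_of_ne _ _ hne))
  rw [h2]

lemma schemeA_decodable (hb : ∀ τ, b τ ≤ B) (dl : PMF (Demand (L + 1) N)) {ε : ℝ} (hε : 0 ≤ ε) :
    (schemeA loc).Decodable dl ε := by
  intro k
  refine le_trans (condEntropy_le_zero_of_determines _ ?_) (by positivity)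
  rintro ⟨F, (c : Fin (L + 1) → Fin N), d, p⟩ ⟨F', (c' : Fin (L + 1) → Fin N), d', p'⟩ hw hw' h
  simp only [Prod.mk.injEq] at h
  obtain ⟨hsig, hcache, hdem⟩ := h
  have hp := schemeA_query_eq loc hw
  have hp' := schemeA_query_eq loc hw'
  have hdk : d k = d' k := hdem
  have hck : c k = c' k := congrArg Prod.fst hcache
  have hcont : schemeAContent loc k (c k) F = schemeAContent loc k (c k) F' := by
    have h1 : schemeAContent loc k (c k) F = schemeAContent loc k (c' k) F' :=
      congrArg Prod.snd hcache
    rw [h1, hck]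
  have hcode : ∀ k', ∀ (S : Finset (EffUser L N)) (r : Fin B),
      codedBit loc F k' r (p k') S = codedBit loc F' k' r (p k') S := by
    intro k'
    have h1 : (schemeA loc).signal k' (F, c, d, p) = (schemeA loc).signal k' (F', c', d', p') :=
      congrFun hsig k'
    rw [schemeA_signal, schemeA_signal] at h1
    have h2 : p k' = p' k' := congrArg Prod.fst h1
    have h3 : encode loc k' (p k') F = encode loc k' (p' k') F' := congrArg Prod.snd h1
    rw [← h2] at h3
    exact (encode_eq_iff loc).1 h3
  change F (d k) = F' (d' k)
  rw [← hdk]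
  funext x
  by_cases hx : x ∈ storedPos loc k (c k)
  · exact (schemeAContent_eq_iff loc).1 hcont (d k) x hx
  · rw [mem_storedPos] at hx
    push Not at hx
    -- A missing position has a label with `k' ≠ k` and `(i, c k) ∉ T`; the message of `k'` for
    -- `insert (i, c k) T` delivers it.
    obtain ⟨⟨k', T, r⟩, rfl, hk', hT⟩ := hx
    obtain ⟨i, hi⟩ := Fin.exists_succAbove_eq (Ne.symm hk')
    have hrB : (r : ℕ) < B := r.2.trans_le (hb _)
    have h1 := labelBit_eq_of_codedBit_eq loc hcont hi.symm (hT i hi.symm)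
      (hcode k' (insert (i, c k) T) ⟨r, hrB⟩)
    have h2 : effDemand k' (p k') (i, c k) = d k := by
      refine (congrArg (fun g : Fin (L + 1) → Fin N => effDemand k' g (i, c k)) (hp k')).trans ?_
      change d (k'.succAbove i) - c (k'.succAbove i) + c k = d k
      rw [hi]
      exact sub_add_cancel _ _
    rw [h2, labelBit, labelBit, dif_pos r.2, dif_pos r.2] at h1
    exact bitVal_injective h1

lemma uniform_bind_equiv {α β : Type*} [Fintype α] [Nonempty α] (e : α ≃ α) (f : α → PMF β) :
    ((PMF.uniformOfFintype α).bind fun a => f (e a)) = (PMF.uniformOfFintype α).bind f := by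
  ext x
  simp only [PMF.bind_apply, PMF.uniformOfFintype_apply]
  exact e.tsum_eq fun a => (Fintype.card α : ENNReal)⁻¹ * f a x

/-- Replacing `d` by `d'` and the slots `c` by `c + (d' - d)` preserves the published differences,
and the slots of `S` when `d` and `d'` agree there. The slots being uniform, the view of `S` keeps
its law. -/
lemma schemeA_private (dl : PMF (Demand (L + 1) N)) : (schemeA loc).PrivateUnderCollusion dl := by
  intro S _
  set s := schemeA loc with hs
  refine condMutualInfo_eq_zero_of_factor (s.law dl) s.demands _
    (fun d (k : S) => d k) (fun d w => prob (s.law (PMF.pure d))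
      (fun ω => (s.signals ω, s.cachesOf S ω)) w) ?_ ?_
  · intro d d' hd
    funext w
    rw [← toReal_map_apply, ← toReal_map_apply]
    congr 2
    have key : ∀ d : Demand (L + 1) N,
        (s.law (PMF.pure d)).map (fun ω => (s.signals ω, s.cachesOf S ω)) =
        (PMF.uniformOfFintype (Library N B)).bind fun F =>
          (PMF.uniformOfFintype (Fin (L + 1) → Fin N)).bind fun c =>
            PMF.pure (s.signals (F, c, d, fun _ j => d j - c j),
              s.cachesOf S (F, c, d, fun _ j => d j - c j)) := by
      intro d
      simp only [Scheme.law, PMF.map_bind, PMF.pure_bind, PMF.map_comp, Function.comp_def]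
      exact congrArg _ (funext fun F => congrArg
        (PMF.bind (PMF.uniformOfFintype (Fin (L + 1) → Fin N)))
        (funext fun c => PMF.pure_map _ _))
    rw [key, key]
    congr 1
    funext F
    rw [← uniform_bind_equiv (Equiv.addRight (d' - d)) (fun c : Fin (L + 1) → Fin N =>
            PMF.pure (s.signals (F, c, d', fun _ j => d' j - c j),
              s.cachesOf S (F, c, d', fun _ j => d' j - c j)))]
    congr 1
    funext c
    congr 1
    have e1 : (fun j => d' j - Equiv.addRight (d' - d) c j) = fun j => d j - c j := by
      funext j
      change d' j - (c j + (d' j - d j)) = d j - c j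
      abel
    refine Prod.ext ?_ ?_
    · funext k
      change s.signal k _ = s.signal k _
      rw [schemeA_signal, schemeA_signal]
      simp only [e1]
    · funext k
      have e2 : Equiv.addRight (d' - d) c (k : Fin (L + 1)) = c k := by
        have : d k = d' k := congrFun hd k
        simp [this]
      change s.cache k _ = s.cache k _
      simp only [Scheme.cache, e2]
  · intro d w
    rw [Scheme.prob_law_demands, Scheme.prob_demands]

end SchemeA

end D2DCaching

/-! ### Memory and load of Scheme A -/

namespace D2DCaching

lemma sum_powerset_eq {V : Type*} [DecidableEq V] (x : Finset V) (f : ℕ → ℝ) :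
    ∑ T ∈ x.powerset, f T.card = ∑ τ ∈ Finset.range (x.card + 1), (x.card.choose τ : ℝ) * f τ := by
  rw [Finset.sum_powerset_apply_card]
  simp only [nsmul_eq_mul]

section Sizes

variable {L N B : ℕ} {b : ℕ → ℕ} (loc : Label L N b ↪ Fin B)

lemma card_effUser : (Finset.univ : Finset (EffUser L N)).card = L * N := by simp

/-- The number of bits of every file that are stored by a given user. -/
lemma card_storedPos (j : Fin (L + 1)) (i : Fin N) :
    ((storedPos loc j i).card : ℝ) =
      B - L * ∑ τ ∈ Finset.range (L * N), ((L * N - 1).choose τ : ℝ) * b τ := by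
  classical
  set P : Label L N b → Prop := fun l =>
    l.1 = j ∨ ∃ r : Fin L, j = l.1.succAbove r ∧ (r, i) ∈ l.2.1 with hP
  have h1 : (storedPos loc j i)ᶜ = (Finset.univ.filter fun l => ¬ P l).map loc := by
    ext x
    rw [Finset.mem_compl, mem_storedPos]
    simp only [Finset.mem_map, Finset.mem_filter, Finset.mem_univ, true_and, hP]
    push Not
    constructor
    · rintro ⟨l, hl, h⟩
      exact ⟨l, h, hl⟩
    · rintro ⟨l, h, hl⟩
      exact ⟨l, hl, h⟩
  have h2 : ((storedPos loc j i).card : ℝ) + ((storedPos loc j i)ᶜ.card : ℝ) = B := by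
    have := Finset.card_add_card_compl (storedPos loc j i)
    rw [Fintype.card_fin] at this
    exact_mod_cast this
  -- User `j` stores all the labels of its own transmissions; for another transmitter it misses
  -- exactly the sets `T` that avoid its effective user.
  have h3 : ∀ k : Fin (L + 1), (∑ T : Finset (EffUser L N),
      if ¬ (k = j ∨ ∃ r : Fin L, j = k.succAbove r ∧ (r, i) ∈ T) then (b T.card : ℝ) else 0) =
      if k = j then 0 else ∑ τ ∈ Finset.range (L * N), ((L * N - 1).choose τ : ℝ) * b τ := by
    intro k
    by_cases hk : k = j
    · simp [hk]
    · obtain ⟨r, hr⟩ := Fin.exists_succAbove_eq (Ne.symm hk)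
      have h4 : ∀ T : Finset (EffUser L N),
          (¬ (k = j ∨ ∃ r : Fin L, j = k.succAbove r ∧ (r, i) ∈ T)) ↔
          T ∈ (Finset.univ.erase ((r, i) : EffUser L N)).powerset := by
        intro T
        rw [Finset.mem_powerset, Finset.subset_erase]
        simp only [hk, false_or, Finset.subset_univ, true_and, not_exists, not_and]
        constructor
        · intro h
          exact h r hr.symm
        · intro h r' hr'
          rw [← hr] at hr'
          rwa [← Fin.succAbove_right_injective hr']
      simp_rw [h4, hk, if_false]
      rw [Finset.sum_ite_mem, Finset.univ_inter, sum_powerset_eq _ (fun t => (b t : ℝ)),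
        Finset.card_erase_of_mem (Finset.mem_univ _), card_effUser]
      have : 0 < L * N := Nat.mul_pos (Fin.pos r) (Fin.pos i)
      rw [Nat.sub_add_cancel this]
  have h5 : ((Finset.univ.filter fun l => ¬ P l).card : ℝ) =
      L * ∑ τ ∈ Finset.range (L * N), ((L * N - 1).choose τ : ℝ) * b τ := by
    rw [Finset.card_filter]
    push_cast
    rw [Fintype.sum_prod_type]
    simp_rw [Fintype.sum_sigma]
    have : ∀ k : Fin (L + 1), (∑ T : Finset (EffUser L N), ∑ r : Fin (b T.card),
        if ¬ P (k, ⟨T, r⟩) then (1 : ℝ) else 0) =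
        if k = j then 0 else ∑ τ ∈ Finset.range (L * N), ((L * N - 1).choose τ : ℝ) * b τ := by
      intro k
      rw [← h3]
      refine Finset.sum_congr rfl fun T _ => ?_
      simp only [hP]
      rw [Finset.sum_const, Finset.card_univ, Fintype.card_fin, nsmul_eq_mul, mul_ite, mul_one,
        mul_zero]
    simp_rw [this]
    rw [Fin.sum_univ_succAbove _ j]
    simp [Fin.succAbove_ne]
  rw [h1, Finset.card_map, h5] at h2
  linarith

/-- The coded messages that have a leader, one for each bit of a packet. -/
abbrev LeaderIndex (L N : ℕ) (b : ℕ → ℕ) (i₀ : Fin L) : Type :=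
  Σ S : {S : Finset (EffUser L N) // ∃ n, (i₀, n) ∈ S}, Fin (b (S.1.card - 1))

/-- Sets without a leader are the subsets of the `L * N - N` effective users not belonging to `i₀`.
A set of size `τ + 1` combines packets of type `τ`. -/
lemma card_leaderIndex (i₀ : Fin L) : (Fintype.card (LeaderIndex L N b i₀) : ℝ) =
    ∑ τ ∈ Finset.range (L * N),
      (((L * N).choose (τ + 1) : ℝ) - ((L * N - N).choose (τ + 1) : ℝ)) * b τ := by
  classical
  set D : Finset (EffUser L N) := Finset.univ.filter fun u => u.1 ≠ i₀ with hD
  have hLN : N ≤ L * N := Nat.le_mul_of_pos_left N (Fin.pos i₀)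
  have hDcard : D.card = L * N - N := by
    have h1 : D = (Finset.univ.erase i₀) ×ˢ Finset.univ := by
      ext u
      simp [hD]
    rw [h1, Finset.card_product, Finset.card_erase_of_mem (Finset.mem_univ _)]
    simp [Nat.sub_mul]
  have h1 : ∀ S : Finset (EffUser L N), (¬ ∃ n, (i₀, n) ∈ S) ↔ S ∈ D.powerset := by
    intro S
    rw [Finset.mem_powerset]
    constructor
    · intro h u hu
      rw [hD, Finset.mem_filter]
      refine ⟨Finset.mem_univ _, fun h' => h ⟨u.2, ?_⟩⟩
      rw [← h']
      exact hu
    · rintro h ⟨n, hn⟩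
      have := h hn
      simp [hD] at this
  have h2 : (Fintype.card (LeaderIndex L N b i₀) : ℝ) =
      ∑ S : Finset (EffUser L N), if ∃ n, (i₀, n) ∈ S then (b (S.card - 1) : ℝ) else 0 := by
    rw [Fintype.card_sigma]
    push_cast
    simp only [Fintype.card_fin]
    rw [← Finset.sum_filter]
    exact (Finset.sum_subtype (p := fun S : Finset (EffUser L N) => ∃ n, (i₀, n) ∈ S) _
      (by simp) (fun S => (b (S.card - 1) : ℝ))).symm
  have h3 : (∑ S : Finset (EffUser L N), if ∃ n, (i₀, n) ∈ S then (b (S.card - 1) : ℝ) else 0) +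
      ∑ S ∈ D.powerset, (b (S.card - 1) : ℝ) =
      ∑ S ∈ (Finset.univ : Finset (EffUser L N)).powerset, (b (S.card - 1) : ℝ) := by
    rw [Finset.powerset_univ]
    have : ∑ S ∈ D.powerset, (b (S.card - 1) : ℝ) =
        ∑ S : Finset (EffUser L N), if ¬ ∃ n, (i₀, n) ∈ S then (b (S.card - 1) : ℝ) else 0 := by
      simp_rw [h1]
      rw [Finset.sum_ite_mem, Finset.univ_inter]
    rw [this, ← Finset.sum_add_distrib]
    refine Finset.sum_congr rfl fun S _ => ?_
    by_cases h : ∃ n, (i₀, n) ∈ S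
    · rw [if_pos h, if_neg (not_not.2 h), add_zero]
    · rw [if_neg h, if_pos h, zero_add]
  -- The empty set contributes `b 0` to both powerset sums, as `0 - 1 = 0`, and cancels.
  rw [sum_powerset_eq D (fun t => (b (t - 1) : ℝ)), sum_powerset_eq _ (fun t => (b (t - 1) : ℝ)),
    card_effUser, hDcard, Finset.sum_range_succ', Finset.sum_range_succ'] at h3
  simp only [Nat.choose_zero_right, Nat.add_sub_cancel] at h3
  have h4 : ∑ τ ∈ Finset.range (L * N - N), ((L * N - N).choose (τ + 1) : ℝ) * (b τ : ℝ) =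
      ∑ τ ∈ Finset.range (L * N), ((L * N - N).choose (τ + 1) : ℝ) * (b τ : ℝ) := by
    refine Finset.sum_subset (Finset.range_subset_range.2 (Nat.sub_le _ _)) fun τ _ hτ => ?_
    rw [Finset.mem_range, not_lt] at hτ
    rw [Nat.choose_eq_zero_of_lt (by omega), Nat.cast_zero, zero_mul]
  rw [h4] at h3
  rw [h2]
  simp only [sub_mul, Finset.sum_sub_distrib]
  linarith

lemma length_schemeAContent (j : Fin (L + 1)) (i : Fin N) (F : Library N B) :
    (schemeAContent loc j i F).length = N * (storedPos loc j i).card := by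
  simp [schemeAContent]

/-- Reading the content as a vector of length `m`, the same for all slots, gives the cache a finite
alphabet. -/
lemma schemeAContent_eq_of_getD_eq {j : Fin (L + 1)} {i : Fin N} {m : ℕ}
    (hm : N * (storedPos loc j i).card = m) {F G : Library N B}
    (h : ∀ t : Fin m, (schemeAContent loc j i F).getD t false =
      (schemeAContent loc j i G).getD t false) :
    schemeAContent loc j i F = schemeAContent loc j i G := by
  refine List.ext_getElem (by rw [length_schemeAContent, length_schemeAContent]) fun t h1 h2 => ?_
  have h3 : (schemeAContent loc j i F).getD t false = (schemeAContent loc j i G).getD t false :=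
    h ⟨t, by rwa [length_schemeAContent, hm] at h1⟩
  rwa [List.getD_eq_getElem _ _ h1, List.getD_eq_getElem _ _ h2] at h3

variable [NeZero N]

lemma entropy_cache_schemeA_le (P : PMF (schemeA loc).Outcome) (j : Fin (L + 1)) :
    entropy P ((schemeA loc).cache j) ≤ Real.logb 2 N +
      N * (B - L * ∑ τ ∈ Finset.range (L * N), ((L * N - 1).choose τ : ℝ) * b τ) := by
  classical
  set m := N * (storedPos loc j 0).card with hm
  have hm' : ∀ i : Fin N, N * (storedPos loc j i).card = m := by
    intro i
    have := (card_storedPos loc j i).trans (card_storedPos loc j 0).symm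
    rw [hm, Nat.cast_injective this]
  refine (entropy_le_log_card_of_determines (β := Fin N × (Fin m → Bool)) P _
    (fun ω => (ω.2.1 j, fun t => (schemeAContent loc j (ω.2.1 j) ω.1).getD t false)) ?_).trans ?_
  · rintro ⟨F, (c : Fin (L + 1) → Fin N), d, p⟩ ⟨F', (c' : Fin (L + 1) → Fin N), d', p'⟩ h
    have h1 : c j = c' j := congrArg Prod.fst h
    have h2 : (fun t : Fin m => (schemeAContent loc j (c j) F).getD t false) =
        fun t : Fin m => (schemeAContent loc j (c' j) F').getD t false := congrArg Prod.snd h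
    rw [← h1] at h2
    refine Prod.ext h1 ?_
    change schemeAContent loc j (c j) F = schemeAContent loc j (c' j) F'
    rw [← h1]
    exact schemeAContent_eq_of_getD_eq loc (hm' _) (congrFun h2)
  · rw [Fintype.card_prod, Fintype.card_fun, Fintype.card_fin, Fintype.card_fin, Fintype.card_bool]
    push_cast
    have hN : (N : ℝ) ≠ 0 := Nat.cast_ne_zero.2 (NeZero.ne N)
    rw [Real.logb_mul hN (by positivity), Real.logb_pow, Real.logb_self_eq_one one_lt_two, hm,
      ← card_storedPos loc j 0]
    push_cast
    linarith

lemma encode_eq_of_leaders {k : Fin (L + 1)} {g : Fin (L + 1) → Fin N} {F G : Library N B}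
    (i₀ : Fin L) (h : ∀ q : LeaderIndex L N b i₀,
      codedBit loc F k q.2 g q.1.1 = codedBit loc G k q.2 g q.1.1) :
    encode loc k g F = encode loc k g G := by
  rw [encode_eq_iff]
  intro S r
  refine codedBit_eq_of_leaders loc i₀ (fun S hS => ?_) S
  by_cases hr : (r : ℕ) < b (S.card - 1)
  · exact h ⟨⟨S, hS⟩, ⟨r, hr⟩⟩
  -- Beyond the packet size every summand is the default `0`.
  · have hz : ∀ F, codedBit loc F k r g S = 0 := fun F =>
      Finset.sum_eq_zero fun u hu => by
        rw [labelBit, dif_neg (by rwa [Finset.card_erase_of_mem hu])]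
    rw [hz, hz]

lemma entropy_signal_schemeA_le (P : PMF (schemeA loc).Outcome) (k : Fin (L + 1)) (i₀ : Fin L) :
    entropy P ((schemeA loc).signal k) ≤ (L + 1) * Real.logb 2 N +
      ∑ τ ∈ Finset.range (L * N),
        (((L * N).choose (τ + 1) : ℝ) - ((L * N - N).choose (τ + 1) : ℝ)) * b τ := by
  classical
  refine (entropy_le_log_card_of_determines
    (β := (Fin (L + 1) → Fin N) × (LeaderIndex L N b i₀ → ZMod 2)) P _
    (fun ω => (ω.2.2.2 k, fun q => codedBit loc ω.1 k q.2 (ω.2.2.2 k) q.1.1)) ?_).trans ?_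
  · rintro ⟨F, c, d, (p : Fin (L + 1) → Fin (L + 1) → Fin N)⟩
      ⟨F', c', d', (p' : Fin (L + 1) → Fin (L + 1) → Fin N)⟩ h
    have hg : p k = p' k := congrArg Prod.fst h
    have hc : (fun q : LeaderIndex L N b i₀ => codedBit loc F k q.2 (p k) q.1.1) =
        fun q => codedBit loc F' k q.2 (p' k) q.1.1 := congrArg Prod.snd h
    rw [← hg] at hc
    rw [schemeA_signal, schemeA_signal]
    refine Prod.ext hg ?_
    change encode loc k (p k) F = encode loc k (p' k) F'
    rw [← hg]
    exact encode_eq_of_leaders loc i₀ (congrFun hc)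
  · rw [Fintype.card_prod, Fintype.card_fun, Fintype.card_fun, Fintype.card_fin, Fintype.card_fin,
      ZMod.card, ← card_leaderIndex (N := N) (b := b) i₀]
    push_cast
    have hN : (N : ℝ) ≠ 0 := Nat.cast_ne_zero.2 (NeZero.ne N)
    rw [Real.logb_mul (by positivity) (by positivity), Real.logb_pow, Real.logb_pow,
      Real.logb_self_eq_one one_lt_two]
    push_cast
    linarith

end Sizes

end D2DCaching

/-! ### Achievability by memory sharing -/

namespace D2DCaching

/-- The size of the packets stored by `τ` effective users, when a fraction `w τ` of the library is
devoted to them. -/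
noncomputable def packetSize (L N B : ℕ) (w : ℕ → ℝ) (τ : ℕ) : ℕ :=
  ⌊w τ * B / ((L + 1) * ((L * N).choose τ : ℝ))⌋₊

section MemorySharing

variable {L N : ℕ} {w : ℕ → ℝ} (B : ℕ)

lemma choose_mul_packetSize_le (hw : ∀ τ, 0 ≤ w τ) {τ : ℕ} (hτ : τ ≤ L * N) :
    ((L * N).choose τ : ℝ) * packetSize L N B w τ ≤ w τ * B / (L + 1) := by
  have hc : (0 : ℝ) < ((L * N).choose τ : ℝ) := Nat.cast_pos.2 (Nat.choose_pos hτ)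
  have h := Nat.floor_le (show 0 ≤ w τ * B / ((L + 1) * ((L * N).choose τ : ℝ)) from
    div_nonneg (mul_nonneg (hw τ) (Nat.cast_nonneg _)) (by positivity))
  calc ((L * N).choose τ : ℝ) * packetSize L N B w τ
      ≤ ((L * N).choose τ : ℝ) * (w τ * B / ((L + 1) * ((L * N).choose τ : ℝ))) :=
        mul_le_mul_of_nonneg_left h hc.le
    _ = w τ * B / (L + 1) := by field_simp

lemma le_choose_mul_packetSize {τ : ℕ} (hτ : τ ≤ L * N) :
    w τ * B / (L + 1) - ((L * N).choose τ : ℝ) ≤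
      ((L * N).choose τ : ℝ) * packetSize L N B w τ := by
  have hc : (0 : ℝ) < ((L * N).choose τ : ℝ) := Nat.cast_pos.2 (Nat.choose_pos hτ)
  have h := Nat.lt_floor_add_one (w τ * B / ((L + 1) * ((L * N).choose τ : ℝ)))
  have h1 := mul_le_mul_of_nonneg_left h.le hc.le
  have h2 : ((L * N).choose τ : ℝ) * (w τ * B / ((L + 1) * ((L * N).choose τ : ℝ))) =
      w τ * B / (L + 1) := by field_simp
  rw [h2, mul_add, mul_one] at h1
  unfold packetSize
  linarith

lemma packetSize_le (hw1 : ∀ τ ≤ L * N, w τ ≤ 1) (τ : ℕ) : packetSize L N B w τ ≤ B := by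
  rcases le_or_gt τ (L * N) with hτ | hτ
  · refine Nat.floor_le_of_le ?_
    have hc : (1 : ℝ) ≤ ((L * N).choose τ : ℝ) := by
      exact_mod_cast Nat.choose_pos hτ
    have hL : (0 : ℝ) ≤ L := Nat.cast_nonneg L
    rw [div_le_iff₀ (by positivity)]
    have h1 := mul_le_mul_of_nonneg_right (hw1 τ hτ) (Nat.cast_nonneg B : (0 : ℝ) ≤ B)
    have h2 : (1 : ℝ) ≤ (L + 1) * ((L * N).choose τ : ℝ) := by nlinarith
    have h3 := mul_le_mul_of_nonneg_left h2 (Nat.cast_nonneg B : (0 : ℝ) ≤ B)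
    linarith
  · rw [packetSize, Nat.choose_eq_zero_of_lt hτ]
    simp

/-- With sizes rounded down, the packets of all `L + 1` transmitters need at most `(L + 1) * (B / (L
+ 1))` positions. -/
lemma exists_label_embedding (hw : ∀ τ, 0 ≤ w τ)
    (hsum : ∑ τ ∈ Finset.range (L * N + 1), w τ = 1) :
    Nonempty (Label L N (packetSize L N B w) ↪ Fin B) := by
  refine Function.Embedding.nonempty_of_card_le ?_
  rw [Fintype.card_fin, ← Nat.cast_le (α := ℝ), Fintype.card_prod, Fintype.card_sigma]
  simp only [Fintype.card_fin]
  push_cast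
  have h1 := sum_powerset_eq (Finset.univ : Finset (EffUser L N))
    (fun t => (packetSize L N B w t : ℝ))
  rw [Finset.powerset_univ, card_effUser] at h1
  rw [h1]
  have h2 : ∑ τ ∈ Finset.range (L * N + 1), ((L * N).choose τ : ℝ) * packetSize L N B w τ ≤
      ∑ τ ∈ Finset.range (L * N + 1), w τ * (B / (L + 1)) :=
    Finset.sum_le_sum fun τ hτ => by
      rw [← mul_div_assoc]
      exact choose_mul_packetSize_le B hw (Nat.lt_succ_iff.1 (Finset.mem_range.1 hτ))
  rw [← Finset.sum_mul, hsum, one_mul] at h2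
  calc ((L : ℝ) + 1) * ∑ τ ∈ Finset.range (L * N + 1), ((L * N).choose τ : ℝ) *
        packetSize L N B w τ ≤ (L + 1) * (B / (L + 1)) :=
        mul_le_mul_of_nonneg_left h2 (by positivity)
    _ = B := by field_simp

/-- Since `L * N * (L * N - 1).choose τ = (L * N - τ) * (L * N).choose τ`, packets of type `τ` would
use memory `w τ * B * (N + τ) / (L + 1)` without rounding. Rounding loses at most one bit per
packet, whence the last term. -/
lemma stored_le {M : ℝ} (hU : 0 < L * N) (hsum : ∑ τ ∈ Finset.range (L * N + 1), w τ = 1)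
    (hM : ∑ τ ∈ Finset.range (L * N + 1), w τ * ((N + τ) / (L + 1)) = M) :
    (N : ℝ) * (B - L * ∑ τ ∈ Finset.range (L * N),
      ((L * N - 1).choose τ : ℝ) * packetSize L N B w τ) ≤ B * M + L * N * 2 ^ (L * N) := by
  have h1 : ∀ τ ∈ Finset.range (L * N), ((L : ℝ) * N - τ) * (w τ * B / (L + 1)) -
      L * N * ((L * N).choose τ : ℝ) ≤
      L * N * (((L * N - 1).choose τ : ℝ) * packetSize L N B w τ) := by
    intro τ hτ
    have hτ := (Finset.mem_range.1 hτ).le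
    have h2 : ((L * N - 1).choose τ : ℝ) * (L * N) = ((L * N).choose τ : ℝ) * (L * N - τ) := by
      have := Nat.choose_mul_succ_eq (L * N - 1) τ
      rw [Nat.sub_add_cancel hU] at this
      have h3 : ((L * N - τ : ℕ) : ℝ) = L * N - τ := by
        rw [Nat.cast_sub hτ]
        push_cast
        rfl
      rw [← h3]
      exact_mod_cast this
    have h4 := le_choose_mul_packetSize (w := w) B hτ
    have hτ' : (τ : ℝ) ≤ L * N := by exact_mod_cast hτ
    have h5 := mul_le_mul_of_nonneg_left h4 (sub_nonneg.2 hτ')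
    have h6 : (L : ℝ) * N * (((L * N - 1).choose τ : ℝ) * packetSize L N B w τ) =
        (L * N - τ) * (((L * N).choose τ : ℝ) * packetSize L N B w τ) := by
      calc _ = (((L * N - 1).choose τ : ℝ) * (L * N)) * packetSize L N B w τ := by ring
        _ = _ := by rw [h2]; ring
    have h7 : 0 ≤ (τ : ℝ) * ((L * N).choose τ : ℝ) := by positivity
    rw [h6]
    linarith
  have h8 := Finset.sum_le_sum h1
  rw [← Finset.mul_sum, Finset.sum_sub_distrib, ← Finset.mul_sum] at h8
  have h9 : ∑ τ ∈ Finset.range (L * N), ((L * N).choose τ : ℝ) ≤ 2 ^ (L * N) := by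
    have := Nat.sum_range_choose (L * N)
    rw [Finset.sum_range_succ] at this
    have h : ∑ τ ∈ Finset.range (L * N), (L * N).choose τ ≤ 2 ^ (L * N) := by omega
    exact_mod_cast h
  have h10 : ∑ τ ∈ Finset.range (L * N), ((L : ℝ) * N - τ) * (w τ * B / (L + 1)) =
      N * B - B * M := by
    have e1 : ∑ τ ∈ Finset.range (L * N + 1), ((L : ℝ) * N - τ) * (w τ * B / (L + 1)) =
        ∑ τ ∈ Finset.range (L * N), ((L : ℝ) * N - τ) * (w τ * B / (L + 1)) := by
      rw [Finset.sum_range_succ]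
      push_cast
      ring
    rw [← e1, ← hM]
    have e2 : ∀ τ ∈ Finset.range (L * N + 1), ((L : ℝ) * N - τ) * (w τ * B / (L + 1)) =
        N * B * w τ - B * (w τ * ((N + τ) / (L + 1))) := by
      intro τ _
      field_simp
      ring
    rw [Finset.sum_congr rfl e2, Finset.sum_sub_distrib, ← Finset.mul_sum, hsum, ← Finset.mul_sum,
      mul_one]
  have h11 := mul_le_mul_of_nonneg_left h9 (show (0 : ℝ) ≤ L * N by positivity)
  rw [h10] at h8
  linarith

lemma sent_le {R : ℝ} (hw : ∀ τ, 0 ≤ w τ)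
    (hR : ∑ τ ∈ Finset.range (L * N + 1), w τ * cornerLoad (L * N) N τ = R) :
    ∑ τ ∈ Finset.range (L * N), (((L * N).choose (τ + 1) : ℝ) - ((L * N - N).choose (τ + 1) : ℝ)) *
      packetSize L N B w τ ≤ B * R / (L + 1) := by
  have h1 : ∀ τ ∈ Finset.range (L * N), (((L * N).choose (τ + 1) : ℝ) -
      ((L * N - N).choose (τ + 1) : ℝ)) * packetSize L N B w τ ≤
      B / (L + 1) * (w τ * cornerLoad (L * N) N τ) := by
    intro τ hτ
    have hτ := (Finset.mem_range.1 hτ).le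
    have hc : (0 : ℝ) < ((L * N).choose τ : ℝ) := Nat.cast_pos.2 (Nat.choose_pos hτ)
    have h2 : ((L * N).choose (τ + 1) : ℝ) - ((L * N - N).choose (τ + 1) : ℝ) =
        cornerLoad (L * N) N τ * ((L * N).choose τ : ℝ) := by
      rw [cornerLoad, div_mul_cancel₀ _ hc.ne']
    have h3 := mul_le_mul_of_nonneg_left (choose_mul_packetSize_le B hw hτ)
      (cornerLoad_nonneg (L * N) N τ)
    rw [h2, mul_assoc]
    refine h3.trans (le_of_eq (by ring))
  refine (Finset.sum_le_sum h1).trans ?_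
  rw [← Finset.mul_sum, ← hR, Finset.sum_range_succ, mul_div_right_comm]
  refine mul_le_mul_of_nonneg_left ?_ (by positivity)
  -- The term `τ = L * N` occurs on the right only and is nonnegative.
  have := mul_nonneg (hw (L * N)) (cornerLoad_nonneg (L * N) N (L * N))
  linarith

end MemorySharing

/-- Metadata and rounding cost a number of bits independent of `B`: `C₁` for a cache, `C₂` for all
the signals. Divided by `B` they tend to zero. -/
lemma achievable_of_weights {L N : ℕ} (hL : 0 < L) (hN : 0 < N) (dl : PMF (Demand (L + 1) N))
    {w : ℕ → ℝ} (hw : ∀ τ, 0 ≤ w τ) (hsum : ∑ τ ∈ Finset.range (L * N + 1), w τ = 1) {M R : ℝ}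
    (hM : ∑ τ ∈ Finset.range (L * N + 1), w τ * ((N + τ) / (L + 1)) = M)
    (hR : ∑ τ ∈ Finset.range (L * N + 1), w τ * cornerLoad (L * N) N τ = R) :
    Achievable (L + 1) N dl M R := by
  have : NeZero N := ⟨hN.ne'⟩
  have hlog : 0 ≤ Real.logb 2 N := Real.logb_nonneg one_lt_two (by exact_mod_cast hN)
  set C₁ : ℝ := Real.logb 2 N + L * N * 2 ^ (L * N) with hC₁
  set C₂ : ℝ := (L + 1) * ((L + 1) * Real.logb 2 N) with hC₂
  have hC₁0 : 0 ≤ C₁ := by positivity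
  have hC₂0 : 0 ≤ C₂ := by positivity
  refine ⟨fun B => (C₁ + C₂) / B, fun B => by positivity,
    tendsto_const_div_atTop_nhds_zero_nat _, ?_⟩
  filter_upwards [eventually_gt_atTop 0] with B hB
  have hB0 : (B : ℝ) ≠ 0 := Nat.cast_ne_zero.2 hB.ne'
  obtain ⟨loc⟩ := exists_label_embedding (N := N) B hw hsum
  have hw1 : ∀ τ ≤ L * N, w τ ≤ 1 := fun τ hτ => by
    rw [← hsum]
    exact Finset.single_le_sum (f := w) (fun τ _ => hw τ) (Finset.mem_range.2 (by omega))
  have hmul : ∀ x : ℝ, B * (x + (C₁ + C₂) / B) = B * x + (C₁ + C₂) := fun x => by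
    field_simp
  refine ⟨schemeA loc, schemeA_isUncoded loc, fun k => ?_,
    schemeA_decodable loc (packetSize_le B hw1) dl (by positivity), schemeA_private loc dl, ?_⟩
  · have h1 := entropy_cache_schemeA_le loc ((schemeA loc).law dl) k
    have h2 := stored_le B (Nat.mul_pos hL hN) hsum hM
    rw [hmul]
    linarith
  · have h1 : ∀ k : Fin (L + 1), entropy ((schemeA loc).law dl) ((schemeA loc).signal k) ≤
        (L + 1) * Real.logb 2 N + B * R / (L + 1) := fun k => by
      have := entropy_signal_schemeA_le loc ((schemeA loc).law dl) k ⟨0, hL⟩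
      have := sent_le B hw hR
      linarith
    unfold Scheme.LoadAtMost
    refine (Finset.sum_le_sum fun k _ => h1 k).trans ?_
    rw [hmul, Finset.sum_const, Finset.card_univ, Fintype.card_fin, nsmul_eq_mul]
    have h2 : ((L + 1 : ℕ) : ℝ) * ((L + 1) * Real.logb 2 N + B * R / (L + 1)) = C₂ + B * R := by
      push_cast
      field_simp
      rw [hC₂]
      ring
    rw [h2]
    linarith

/-- The pairs represented by weights form a convex set containing the corner points, hence their
hull. -/
lemma exists_weights {L N : ℕ} {q : ℝ × ℝ} (hq : q ∈ convexHull ℝ (schemeAPoints (L + 1) N)) :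
    ∃ w : ℕ → ℝ, (∀ τ, 0 ≤ w τ) ∧ ∑ τ ∈ Finset.range (L * N + 1), w τ = 1 ∧
      ∑ τ ∈ Finset.range (L * N + 1), w τ * ((N + τ) / (L + 1)) = q.1 ∧
      ∑ τ ∈ Finset.range (L * N + 1), w τ * cornerLoad (L * N) N τ = q.2 := by
  set C : Set (ℝ × ℝ) := {q | ∃ w : ℕ → ℝ, (∀ τ, 0 ≤ w τ) ∧
      ∑ τ ∈ Finset.range (L * N + 1), w τ = 1 ∧
      ∑ τ ∈ Finset.range (L * N + 1), w τ * ((N + τ) / (L + 1)) = q.1 ∧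
      ∑ τ ∈ Finset.range (L * N + 1), w τ * cornerLoad (L * N) N τ = q.2} with hC
  have h : convexHull ℝ (schemeAPoints (L + 1) N) ⊆ C := by
    refine convexHull_min ?_ ?_
    · rw [schemeAPoints_eq]
      rintro _ ⟨τ, hτ, rfl⟩
      simp only [Nat.add_sub_cancel, Set.mem_Iic] at hτ
      refine ⟨fun t => if t = τ then 1 else 0, fun t => by positivity, ?_, ?_, ?_⟩
      · simp; omega
      · simp only [ite_mul, one_mul, zero_mul, Finset.sum_ite_eq', Finset.mem_range]
        rw [if_pos (by omega)]
        push_cast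
        rfl
      · simp only [ite_mul, one_mul, zero_mul, Finset.sum_ite_eq', Finset.mem_range]
        rw [if_pos (by omega), Nat.add_sub_cancel]
    · rintro q ⟨w, hw, h1, h2, h3⟩ q' ⟨w', hw', h1', h2', h3'⟩ a b ha hb hab
      refine ⟨fun τ => a * w τ + b * w' τ,
        fun τ => add_nonneg (mul_nonneg ha (hw τ)) (mul_nonneg hb (hw' τ)), ?_, ?_, ?_⟩
      · rw [Finset.sum_add_distrib, ← Finset.mul_sum, ← Finset.mul_sum, h1, h1', mul_one, mul_one,
          hab]
      · simp only [add_mul, mul_assoc, Finset.sum_add_distrib, ← Finset.mul_sum, h2, h2']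
        rfl
      · simp only [add_mul, mul_assoc, Finset.sum_add_distrib, ← Finset.mul_sum, h3, h3']
        rfl
  exact h hq

end D2DCaching

/-! ### Achievability and converse combined. -/

theorem theorem7 (K N : ℕ) (hK : 2 ≤ K) (hKN : K ≤ N)
    (demandLaw : PMF (D2DCaching.Demand K N)) (hfull : ∀ d, demandLaw d ≠ 0)
    (M : ℝ) (hM₁ : (N : ℝ) / K ≤ M) (hM₂ : M ≤ N) :
    D2DCaching.Achievable K N demandLaw M (D2DCaching.schemeALoad K N M) ∧
      D2DCaching.schemeALoad K N M ≤ 18 * D2DCaching.optimalLoad K N demandLaw M := by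
  obtain ⟨L, rfl⟩ : ∃ L, K = L + 1 := ⟨K - 1, by omega⟩
  have hL : 0 < L := by omega
  push_cast at hM₁
  have hach : D2DCaching.Achievable (L + 1) N demandLaw M (D2DCaching.schemeALoad (L + 1) N M) := by
    obtain ⟨w, hw, hsum, hM, hR⟩ := D2DCaching.exists_weights (D2DCaching.schemeALoad_mem hM₁ hM₂)
    exact D2DCaching.achievable_of_weights hL (by omega) demandLaw hw hsum hM hR
  refine ⟨hach, ?_⟩
  have h : D2DCaching.schemeALoad (L + 1) N M / 18 ≤
      D2DCaching.optimalLoad (L + 1) N demandLaw M := by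
    -- Achievability of Scheme A also ensures that the infimum is over a nonempty set.
    refine le_csInf ⟨_, hach⟩ fun R hR => ?_
    have := D2DCaching.Achievable.schemeALoad_le_mul hR hL hKN hfull hM₁ hM₂
    linarith
  linarith
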